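/- **Setting.** Let $X,Y$ be (real or complex) Hilbert spaces, let $F:D(F)\subset X\to Y$ be Fréchet differentiable, $x^\dagger\in D(F)$, $y=F(x^\dagger)$, $x_0\in X$, and write $A^*$ for the adjoint and $N(A)$ for the kernel of a bounded operator $A$, and $B_\rho(x^\dagger)$ for the open ball. For $\delta>0$ let $y^\delta\in Y$ satisfy $\|y^\delta-y\|\le\delta$. For $\alpha>0$ let $g_\alpha$ be a real function on $[0,\infty)$, continuous on $[0,1/2]$, and put $r_\alpha(\lambda)=1-\lambda g_\alpha(\lambda)$. Functions of the self-adjoint operators $A^*A$, $\|A\|\le 1/\sqrt2$, are understood in the sense of the continuous functional calculus. The iterates are $x_0^\delta=x_0$, $$x_{k+1}^\delta=x_0-g_{\alpha_k}\big(F'(x_k^\delta)^*F'(x_k^\delta)\big)F'(x_k^\delta)^*\big(F(x_k^\delta)-y^\delta-F'(x_k^\delta)(x_k^\delta-x_0)\big),$$ and, for $\tau>1$, $k_\delta$ is the first integer $k\ge 0$ with $\|F(x_k^\delta)-y^\delta\|\le\tau\delta$. **Common hypotheses.** (H1) There are positive constants $c_0,c_1,c_2$ such that for all $\lambda\in[0,1/2]$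 and $0<\alpha\le\beta$: $0<r_\alpha(\lambda)\le 1$, $r_\alpha(\lambda)\lambda\le c_0\alpha$, $0\le g_\alpha(\lambda)\le c_1\alpha^{-1}$, $r_\alpha(\lambda)\le r_\beta(\lambda)$ and $r_\beta(\lambda)-r_\alpha(\lambda)\le c_2\sqrt{\lambda/\alpha}\,r_\beta(\lambda)$. Moreover $c_3\le c_0^{1/2}$ and $c_4\le c_1^{1/2}$ are constants with $r_\alpha(\lambda)\lambda^{1/2}\le c_3\alpha^{1/2}$ and $g_\alpha(\lambda)\lambda^{1/2}\le c_4\alpha^{-1/2}$ for all $\alpha>0$, $\lambda\in[0,1/2]$. (H2) $\alpha_k>0$, $1\le\alpha_k/\alpha_{k+1}\le r$ with a constant $r>1$, $\alpha_k\to0$, and for some $c_5>1$, $r_{\alpha_k}(\lambda)\le c_5 r_{\alpha_{k+1}}(\lambda)$ for all $k$ and $\lambda\in[0,1/2]$. (H3) $\bar\nu\in[1,\infty]$ is the qualification: the largest number such that for each finite $0\le\nu\le\bar\nu$ there is $d_\nu>0$ with $r_\alpha(\lambda)\lambda^\nu\le d_\nu\alpha^\nu$ for all $\alpha>0$, $\lambda\in[0,1/2]$.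 (H4) $B_\rho(x^\dagger)\subset D(F)$ and $\|F'(x)\|\le\min\{c_3\alpha_0^{1/2},\beta_0^{1/2}\}$ for $x\in B_\rho(x^\dagger)$, where $0<\beta_0\le1/2$ is such that $r_{\alpha_0}\ge 3/4$ on $[0,\beta_0]$. **(i)** There is a constant $\eta_0>0$ depending only on $r,\tau,c_0,\dots,c_6$ such that the following holds. Assume (H1)–(H4) and $\rho>4\|x_0-x^\dagger\|$; assume that $\|F'(x)-F'(z)\|\le L\|x-z\|$ for $x,z\in B_\rho(x^\dagger)$; and assume that $c_6>0$ is such that for all $\alpha>0$ and all bounded linear $A,B:X\to Y$ with $\|A\|,\|B\|\le1/\sqrt2$, $$\|r_\alpha(A^*A)-r_\alpha(B^*B)\|\le c_6\alpha^{-1/2}\|A-B\|,\qquad \|[r_\alpha(A^*A)-r_\alpha(B^*B)]B^*\|\le c_6\|A-B\|,$$ $$\|A[r_\alpha(A^*A)-r_\alpha(B^*B)]B^*\|\le c_6\alpha^{1/2}\|A-B\|,\qquad \|[g_\alpha(A^*A)-g_\alpha(B^*B)]B^*\|\le c_6\alpha^{-1}\|A-B\|.$$ Let $\bar\nu>1$,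 let $x_0-x^\dagger=(F'(x^\dagger)^*F'(x^\dagger))^\nu\omega$ with $\omega\in N(F'(x^\dagger))^\perp$ and $1/2\le\nu<\bar\nu-1/2$, and let $L\|u\|\le\eta_0$, where $u\in N(F'(x^\dagger)^*)^\perp$ is the unique element with $x_0-x^\dagger=F'(x^\dagger)^*u$. Then for all sufficiently small $\delta>0$ the index $k_\delta$ exists and $x_k^\delta\in B_\rho(x^\dagger)$ for $0\le k\le k_\delta$, and $$\|x_{k_\delta}^\delta-x^\dagger\|=o\big(\delta^{2\nu/(1+2\nu)}\big)\qquad(\delta\to0).$$ **(ii)** Let $\gamma_1>c_3r^{1/2}/(\tau-1)$. There is a constant $\eta_1>0$ depending only on $r,\tau,\gamma_1$ and $c_0,\dots,c_5,c_7,c_8$ such that the following holds. Assume (H1)–(H4) and $\rho>2(1+c_4\gamma_1)\|x_0-x^\dagger\|$, and assume that there are positive constants $K_0,K_1,K_2,c_7,c_8$ and bounded linear operators $R(x,z):X\to X$ such that for all $x,z\in B_\rho(x^\dagger)$, $w\in X$, $\alpha>0$, with $\mathcal A_x:=F'(x)^*F'(x)$, $$F'(x)=F'(z)R(x,z),\qquad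 \|I-R(x,z)\|\le K_0\|x-z\|,$$ $$\|[F'(x)-F'(z)]w\|\le K_1\|x-z\|\,\|F'(z)w\|+K_2\|F'(z)(x-z)\|\,\|w\|,$$ $$\|r_\alpha(\mathcal A_x)-r_\alpha(\mathcal A_z)\|\le c_7K_0\|x-z\|,$$ $$\|F'(x)[r_\alpha(\mathcal A_x)-r_\alpha(\mathcal A_z)]\|\le c_8(K_0+K_1)\alpha^{1/2}\|x-z\|+c_8K_2\big(\|F'(x)(x-z)\|+\|F'(z)(x-z)\|\big).$$ Let $(K_0+K_1+K_2)\|x_0-x^\dagger\|\le\eta_1$. Then for all sufficiently small $\delta>0$ the index $k_\delta$ exists and $x_k^\delta\in B_\rho(x^\dagger)$ for $0\le k\le k_\delta$. If $x_0-x^\dagger=(F'(x^\dagger)^*F'(x^\dagger))^\nu\omega$ with $\omega\in N(F'(x^\dagger))^\perp$ and $0\le\nu<\bar\nu-1/2$, then $$\|x_{k_\delta}^\delta-x^\dagger\|=o\big(\delta^{2\nu/(1+2\nu)}\big)\qquad(\delta\to0).$$ In particular (the case $\nu=0$), if $x_0-x^\dagger\in N(F'(x^\dagger))^\perp$, then $x_{k_\delta}^\delta\to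 x^\dagger$ as $\delta\to0$. -/

import Mathlib

open Filter Topology Asymptotics
open scoped Polynomial ENNReal NNReal

universe u v w

namespace NewtonReg

/-- The value `p(T)` of a real polynomial `p` at a bounded operator `T` on a real or complex
Hilbert space. -/
noncomputable def polyOp {𝕜 E : Type*} [RCLike 𝕜] [NormedAddCommGroup E] [InnerProductSpace 𝕜 E]
    (p : ℝ[X]) (T : E →L[𝕜] E) : E →L[𝕜] E :=
  Polynomial.aeval T (p.map (algebraMap ℝ 𝕜))

/-- The filter of real polynomials converging to `f` uniformly on `[0, 1/2]`. -/
def polyApprox (f : ℝ → ℝ) : Filter ℝ[X] :=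
  ⨅ ε ∈ Set.Ioi (0 : ℝ), 𝓟 {p : ℝ[X] | ∀ t ∈ Set.Icc (0 : ℝ) (1 / 2), |p.eval t - f t| ≤ ε}

/-- The continuous functional calculus `f(T)` for a self-adjoint operator `T` with spectrum in
`[0, 1/2]` and a function `f` that is continuous on `[0, 1/2]`: the operator-norm limit of `p(T)`
as the polynomial `p` tends to `f` uniformly on `[0, 1/2]`. (Mathlib's `cfc` is not available for
operators on a real Hilbert space.) -/
noncomputable def opFun {𝕜 E : Type*} [RCLike 𝕜] [NormedAddCommGroup E] [InnerProductSpace 𝕜 E]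
    (f : ℝ → ℝ) (T : E →L[𝕜] E) : E →L[𝕜] E :=
  limUnder (polyApprox f) (fun p => polyOp p T)

/-- The operator `A* A`. -/
noncomputable def normalOp {𝕜 X Y : Type*} [RCLike 𝕜]
    [NormedAddCommGroup X] [InnerProductSpace 𝕜 X] [CompleteSpace X]
    [NormedAddCommGroup Y] [InnerProductSpace 𝕜 Y] [CompleteSpace Y]
    (A : X →L[𝕜] Y) : X →L[𝕜] X :=
  (ContinuousLinearMap.adjoint A) ∘L A

/-- The residual function `r_α(t) = 1 - t g_α(t)`. -/
def residual (g : ℝ → ℝ → ℝ) (α t : ℝ) : ℝ := 1 - t * g α t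

/-- The structure conditions on the functions `g_α`, `α > 0`, with constants `c₀, c₁, c₂`, together
with constants `c₃ ≤ c₀^{1/2}` and `c₄ ≤ c₁^{1/2}` for which
`r_α(t) t^{1/2} ≤ c₃ α^{1/2}` and `g_α(t) t^{1/2} ≤ c₄ α^{-1/2}`. -/
structure IsFilterFamily (g : ℝ → ℝ → ℝ) (c₀ c₁ c₂ c₃ c₄ : ℝ) : Prop where
  c₀_pos : 0 < c₀
  c₁_pos : 0 < c₁
  c₂_pos : 0 < c₂
  c₃_le : c₃ ≤ √c₀
  c₄_le : c₄ ≤ √c₁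
  continuousOn : ∀ α : ℝ, 0 < α → ContinuousOn (g α) (Set.Icc 0 (1 / 2))
  residual_pos : ∀ α : ℝ, 0 < α → ∀ t ∈ Set.Icc (0 : ℝ) (1 / 2), 0 < residual g α t
  residual_le_one : ∀ α : ℝ, 0 < α → ∀ t ∈ Set.Icc (0 : ℝ) (1 / 2), residual g α t ≤ 1
  residual_mul_le : ∀ α : ℝ, 0 < α → ∀ t ∈ Set.Icc (0 : ℝ) (1 / 2), residual g α t * t ≤ c₀ * α
  nonneg : ∀ α : ℝ, 0 < α → ∀ t ∈ Set.Icc (0 : ℝ) (1 / 2), 0 ≤ g α t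
  le : ∀ α : ℝ, 0 < α → ∀ t ∈ Set.Icc (0 : ℝ) (1 / 2), g α t ≤ c₁ * α⁻¹
  residual_mul_sqrt_le : ∀ α : ℝ, 0 < α → ∀ t ∈ Set.Icc (0 : ℝ) (1 / 2),
    residual g α t * √t ≤ c₃ * √α
  mul_sqrt_le : ∀ α : ℝ, 0 < α → ∀ t ∈ Set.Icc (0 : ℝ) (1 / 2), g α t * √t ≤ c₄ * (√α)⁻¹
  residual_mono : ∀ α β : ℝ, 0 < α → α ≤ β → ∀ t ∈ Set.Icc (0 : ℝ) (1 / 2),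
    residual g α t ≤ residual g β t
  residual_sub_le : ∀ α β : ℝ, 0 < α → α ≤ β → ∀ t ∈ Set.Icc (0 : ℝ) (1 / 2),
    residual g β t - residual g α t ≤ c₂ * √(t / α) * residual g β t

/-- `r_α(t) t^ν ≤ d α^ν` for all `α > 0`, `t ∈ [0, 1/2]`, with some constant `d > 0`. -/
def HasOrder (g : ℝ → ℝ → ℝ) (ν : ℝ≥0) : Prop :=
  ∃ d : ℝ, 0 < d ∧ ∀ α : ℝ, 0 < α → ∀ t ∈ Set.Icc (0 : ℝ) (1 / 2),
    residual g α t * t ^ (ν : ℝ) ≤ d * α ^ (ν : ℝ)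

/-- `q ∈ [0, ∞]` is the qualification: the largest number such that `HasOrder g ν` holds for each
(finite) `0 ≤ ν ≤ q`. -/
def IsQualification (g : ℝ → ℝ → ℝ) (q : ℝ≥0∞) : Prop :=
  IsGreatest {s : ℝ≥0∞ | ∀ ν : ℝ≥0, (ν : ℝ≥0∞) ≤ s → HasOrder g ν} q

/-- The standing conditions on the sequence `(α_k)`. -/
structure IsParameterSequence (α : ℕ → ℝ) (r : ℝ) : Prop where
  pos : ∀ k, 0 < α k
  one_le_ratio : ∀ k, 1 ≤ α k / α (k + 1)
  ratio_le : ∀ k, α k / α (k + 1) ≤ r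
  tendsto_zero : Tendsto α atTop (𝓝 0)

/-- The condition `r_{α_k} ≤ c₅ r_{α_{k+1}}` on `[0, 1/2]`, with `c₅ > 1`. -/
def ResidualRatioBound (g : ℝ → ℝ → ℝ) (α : ℕ → ℝ) (c₅ : ℝ) : Prop :=
  1 < c₅ ∧ ∀ k, ∀ t ∈ Set.Icc (0 : ℝ) (1 / 2),
    residual g (α k) t ≤ c₅ * residual g (α (k + 1)) t

/-- The commutator estimates for pairs of bounded operators `A, B : X → Y` of norm at most
`1/√2`. -/
structure CommutatorBounds (𝕜 X Y : Type*) [RCLike 𝕜]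
    [NormedAddCommGroup X] [InnerProductSpace 𝕜 X] [CompleteSpace X]
    [NormedAddCommGroup Y] [InnerProductSpace 𝕜 Y] [CompleteSpace Y]
    (g : ℝ → ℝ → ℝ) (c₆ : ℝ) : Prop where
  c₆_pos : 0 < c₆
  residual_sub : ∀ α : ℝ, 0 < α → ∀ A B : X →L[𝕜] Y, ‖A‖ ≤ 1 / √2 → ‖B‖ ≤ 1 / √2 →
    ‖opFun (residual g α) (normalOp A) - opFun (residual g α) (normalOp B)‖
      ≤ c₆ * (√α)⁻¹ * ‖A - B‖
  residual_sub_comp : ∀ α : ℝ, 0 < α → ∀ A B : X →L[𝕜] Y, ‖A‖ ≤ 1 / √2 → ‖B‖ ≤ 1 / √2 →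
    ‖(opFun (residual g α) (normalOp A) - opFun (residual g α) (normalOp B)) ∘L
        ContinuousLinearMap.adjoint B‖ ≤ c₆ * ‖A - B‖
  comp_residual_sub_comp : ∀ α : ℝ, 0 < α → ∀ A B : X →L[𝕜] Y, ‖A‖ ≤ 1 / √2 → ‖B‖ ≤ 1 / √2 →
    ‖A ∘L (opFun (residual g α) (normalOp A) - opFun (residual g α) (normalOp B)) ∘L
        ContinuousLinearMap.adjoint B‖ ≤ c₆ * √α * ‖A - B‖
  sub_comp : ∀ α : ℝ, 0 < α → ∀ A B : X →L[𝕜] Y, ‖A‖ ≤ 1 / √2 → ‖B‖ ≤ 1 / √2 →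
    ‖(opFun (g α) (normalOp A) - opFun (g α) (normalOp B)) ∘L
        ContinuousLinearMap.adjoint B‖ ≤ c₆ * α⁻¹ * ‖A - B‖

/-- `F`, with domain `D`, is Fréchet differentiable, `B_ρ(x†) ⊆ D`, and the derivative is scaled so
that `‖F'(x)‖ ≤ min {c₃ α₀^{1/2}, β₀^{1/2}}` on `B_ρ(x†)`, where `0 < β₀ ≤ 1/2` is such that
`r_{α₀} ≥ 3/4` on `[0, β₀]`. -/
structure IsScaledOperator (𝕜 : Type*) {X Y : Type*} [RCLike 𝕜]
    [NormedAddCommGroup X] [InnerProductSpace 𝕜 X] [NormedAddCommGroup Y] [InnerProductSpace 𝕜 Y]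
    (F : X → Y) (D : Set X) (xd : X) (ρ : ℝ) (g : ℝ → ℝ → ℝ) (α₀ c₃ β₀ : ℝ) : Prop where
  differentiableOn : DifferentiableOn 𝕜 F D
  ball_subset : Metric.ball xd ρ ⊆ D
  β₀_pos : 0 < β₀
  β₀_le : β₀ ≤ 1 / 2
  residual_ge : ∀ t ∈ Set.Icc (0 : ℝ) β₀, 3 / 4 ≤ residual g α₀ t
  norm_fderiv_le : ∀ x ∈ Metric.ball xd ρ, ‖fderiv 𝕜 F x‖ ≤ min (c₃ * √α₀) (√β₀)

/-- The Lipschitz condition on `F'` in `B_ρ(x†)`. -/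
def LipschitzDeriv (𝕜 : Type*) {X Y : Type*} [RCLike 𝕜]
    [NormedAddCommGroup X] [InnerProductSpace 𝕜 X] [NormedAddCommGroup Y] [InnerProductSpace 𝕜 Y]
    (F : X → Y) (xd : X) (ρ L : ℝ) : Prop :=
  ∀ x ∈ Metric.ball xd ρ, ∀ z ∈ Metric.ball xd ρ, ‖fderiv 𝕜 F x - fderiv 𝕜 F z‖ ≤ L * ‖x - z‖

/-- `F'(x) = F'(z) R(x, z)` with bounded `R(x, z)` and `‖I - R(x, z)‖ ≤ K₀ ‖x - z‖` in
`B_ρ(x†)`. -/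
def RangeInvariance (𝕜 : Type*) {X Y : Type*} [RCLike 𝕜]
    [NormedAddCommGroup X] [InnerProductSpace 𝕜 X] [NormedAddCommGroup Y] [InnerProductSpace 𝕜 Y]
    (F : X → Y) (xd : X) (ρ K₀ : ℝ) : Prop :=
  0 < K₀ ∧ ∃ R : X → X → (X →L[𝕜] X),
    ∀ x ∈ Metric.ball xd ρ, ∀ z ∈ Metric.ball xd ρ,
      fderiv 𝕜 F x = fderiv 𝕜 F z ∘L R x z ∧
      ‖ContinuousLinearMap.id 𝕜 X - R x z‖ ≤ K₀ * ‖x - z‖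

/-- `‖[F'(x) - F'(z)] w‖ ≤ K₁ ‖x - z‖ ‖F'(z) w‖ + K₂ ‖F'(z)(x - z)‖ ‖w‖` in `B_ρ(x†)`. -/
def DerivVariation (𝕜 : Type*) {X Y : Type*} [RCLike 𝕜]
    [NormedAddCommGroup X] [InnerProductSpace 𝕜 X] [NormedAddCommGroup Y] [InnerProductSpace 𝕜 Y]
    (F : X → Y) (xd : X) (ρ K₁ K₂ : ℝ) : Prop :=
  0 < K₁ ∧ 0 < K₂ ∧ ∀ x ∈ Metric.ball xd ρ, ∀ z ∈ Metric.ball xd ρ, ∀ w : X,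
    ‖(fderiv 𝕜 F x - fderiv 𝕜 F z) w‖
      ≤ K₁ * ‖x - z‖ * ‖fderiv 𝕜 F z w‖ + K₂ * ‖fderiv 𝕜 F z (x - z)‖ * ‖w‖

/-- The estimates on `r_α(F'(x)* F'(x)) - r_α(F'(z)* F'(z))` that incorporate the constants
`K₀, K₁, K₂` of the structure conditions on `F`. -/
structure StructuredCommutatorBounds (𝕜 : Type*) {X Y : Type*} [RCLike 𝕜]
    [NormedAddCommGroup X] [InnerProductSpace 𝕜 X] [CompleteSpace X]
    [NormedAddCommGroup Y] [InnerProductSpace 𝕜 Y] [CompleteSpace Y]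
    (g : ℝ → ℝ → ℝ) (F : X → Y) (xd : X) (ρ K₀ K₁ K₂ c₇ c₈ : ℝ) : Prop where
  c₇_pos : 0 < c₇
  c₈_pos : 0 < c₈
  residual_sub : ∀ α : ℝ, 0 < α → ∀ x ∈ Metric.ball xd ρ, ∀ z ∈ Metric.ball xd ρ,
    ‖opFun (residual g α) (normalOp (fderiv 𝕜 F x))
        - opFun (residual g α) (normalOp (fderiv 𝕜 F z))‖ ≤ c₇ * K₀ * ‖x - z‖
  comp_residual_sub : ∀ α : ℝ, 0 < α → ∀ x ∈ Metric.ball xd ρ, ∀ z ∈ Metric.ball xd ρ,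
    ‖fderiv 𝕜 F x ∘L (opFun (residual g α) (normalOp (fderiv 𝕜 F x))
        - opFun (residual g α) (normalOp (fderiv 𝕜 F z)))‖
      ≤ c₈ * (K₀ + K₁) * √α * ‖x - z‖
        + c₈ * K₂ * (‖fderiv 𝕜 F x (x - z)‖ + ‖fderiv 𝕜 F z (x - z)‖)

/-- The Newton type iteration
`x_{k+1} = x₀ - g_{α_k}(F'(x_k)* F'(x_k)) F'(x_k)* (F(x_k) - y - F'(x_k)(x_k - x₀))`
for the data `y`, started at `x₀`. -/
noncomputable def newtonSeq (𝕜 : Type*) {X Y : Type*} [RCLike 𝕜]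
    [NormedAddCommGroup X] [InnerProductSpace 𝕜 X] [CompleteSpace X]
    [NormedAddCommGroup Y] [InnerProductSpace 𝕜 Y] [CompleteSpace Y]
    (F : X → Y) (g : ℝ → ℝ → ℝ) (α : ℕ → ℝ) (x₀ : X) (y : Y) : ℕ → X
  | 0 => x₀
  | k + 1 =>
    x₀ - opFun (g (α k)) (normalOp (fderiv 𝕜 F (newtonSeq 𝕜 F g α x₀ y k)))
      (ContinuousLinearMap.adjoint (fderiv 𝕜 F (newtonSeq 𝕜 F g α x₀ y k))
        (F (newtonSeq 𝕜 F g α x₀ y k) - y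
          - fderiv 𝕜 F (newtonSeq 𝕜 F g α x₀ y k) (newtonSeq 𝕜 F g α x₀ y k - x₀)))

/-- The discrepancy principle: `k` is the first index with `‖F(x_k) - y‖ ≤ τ δ`. -/
def IsStoppingIndex {X Y : Type*} [NormedAddCommGroup Y]
    (F : X → Y) (x : ℕ → X) (y : Y) (τ δ : ℝ) (k : ℕ) : Prop :=
  ‖F (x k) - y‖ ≤ τ * δ ∧ ∀ j < k, τ * δ < ‖F (x j) - y‖

/-- The source condition `x₀ - x† = (F'(x†)* F'(x†))^ν ω`. -/
def SourceCondition (𝕜 : Type*) {X Y : Type*} [RCLike 𝕜]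
    [NormedAddCommGroup X] [InnerProductSpace 𝕜 X] [CompleteSpace X]
    [NormedAddCommGroup Y] [InnerProductSpace 𝕜 Y] [CompleteSpace Y]
    (F : X → Y) (xd x₀ : X) (ν : ℝ) (ω : X) : Prop :=
  x₀ - xd = opFun (fun t : ℝ => t ^ ν) (normalOp (fderiv 𝕜 F xd)) ω

/-- The method is well defined for the noisy data `yd δ`, `δ > 0`: for all small `δ > 0` the
stopping index exists, and all iterates up to it stay in `B_ρ(x†)` (so that they, and the operator
functions in the iteration, are meaningful). -/
def EventuallyWellDefined (𝕜 : Type*) {X Y : Type*} [RCLike 𝕜]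
    [NormedAddCommGroup X] [InnerProductSpace 𝕜 X] [CompleteSpace X]
    [NormedAddCommGroup Y] [InnerProductSpace 𝕜 Y] [CompleteSpace Y]
    (F : X → Y) (g : ℝ → ℝ → ℝ) (α : ℕ → ℝ) (x₀ xd : X) (ρ τ : ℝ) (yd : ℝ → Y) : Prop :=
  ∀ᶠ δ in 𝓝[>] (0 : ℝ), ∃ k : ℕ,
    IsStoppingIndex F (newtonSeq 𝕜 F g α x₀ (yd δ)) (yd δ) τ δ k ∧
    ∀ j ≤ k, newtonSeq 𝕜 F g α x₀ (yd δ) j ∈ Metric.ball xd ρ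

end NewtonReg

/-! Write T for the derivative at `xd`, G for the derivative at the current iterate, and e_k = x_k −
`xd`. Since r_α = 1 − t g_α, a Newton step gives e_{k+1} = r_{α_k}(G*G) e_0 − g_{α_k}(G*G) G*(Taylor
remainder) + g_{α_k}(G*G) G*(noise) (`newtonSeq_succ_sub`). The iteration is therefore a
perturbation of the linear method r_{α_k}(T*T) e_0. Put φ_k = `linearError` and ψ_k =
`linearResidual`. For small η, the commutator and nonlinearity conditions bound the deviation from
the linear method by ε‖e_k‖ + c₄ δ/√α_k with small ε, and the residual at x_{k+1} by ‖T r_{α_k}(T*T)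
e_0‖ + δ plus a small multiple of ψ_k + δ. The summand √α_k φ_k belongs to ψ_k because the nonlinear
terms are controlled through √α_k ‖e_k‖.

These estimates propagate, together with a priori bounds, while a weight w_k (α_k‖u‖ in the
Lipschitz case, √α_k‖e_0‖ in the structured case) exceeds δ/γ. Once the weight reaches that level
the residual is at most τδ, so k_δ exists and all bounds hold up to it (`exists_stopping`).

The rate rests on three facts, combined in `isLittleO_of_estimates`. First, φ_k = o(α_k^ν) and ψ_k =
o(α_k^{ν+1/2}), because ω lies in the closure of the range of T*T and ν + 1/2 is strictly below the
qualification (`isLittleO_rpow_mul_residual`). Second, the residual at k_δ − 1 still exceeds τδ,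
which forces δ ≤ C ψ_{k_δ} when k_δ ≥ 2. Third, ‖e_{k_δ}‖ ≤ C(φ_m + δ/√α_m) at later indices m as
well, because T e_{k_δ} is small (`error_le_at_later_index`). Compare k_δ with the a priori index at
which α ≈ (Mδ)^{2/(1+2ν)}: the third fact settles early stopping, the second late stopping
(`isLittleO_of_balanced_bounds`).

The two cases differ in how T e_{k_δ} is bounded. Under the structure conditions it is at most
2(1+τ)δ. Under the Lipschitz condition a term L‖e‖² remains; the representation e_0 = T*u yields
‖e‖² = O(δ) (`lipschitz_error_sq_le`), so L‖e‖ ≤ κ√α_m whenever α_m ≥ cδ, and the a priori index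
meets this requirement because ν ≥ 1/2.

Operator inequalities are reduced to scalar ones by a functional calculus built on
`norm_polyOp_apply_le`; `norm_opFun_apply_mono` transfers pointwise domination to norms. -/

namespace NewtonReg

/-! ### Functional calculus by polynomial approximation on [0, 1/2] -/

section Calculus

variable {𝕜 E : Type*} [RCLike 𝕜] [NormedAddCommGroup E] [InnerProductSpace 𝕜 E]

/-- `T` is symmetric with quadratic form in `[0, b]`, that is, `0 ≤ T ≤ b`. -/
structure SpectrumIn (T : E →L[𝕜] E) (b : ℝ) : Prop where
  symm : ∀ x y, inner 𝕜 (T x) y = inner 𝕜 x (T y)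
  nonneg : ∀ x, 0 ≤ RCLike.re (inner 𝕜 (T x) x)
  le : ∀ x, RCLike.re (inner 𝕜 (T x) x) ≤ b * ‖x‖ ^ 2

/-- In an orthonormal eigenbasis p(S) is diagonal with entries p(λ_i); testing the form bounds on
eigenvectors puts each λ_i in [0, b], and Parseval finishes. -/
lemma norm_aeval_apply_le_of_finiteDimensional {V : Type*} [NormedAddCommGroup V]
    [InnerProductSpace 𝕜 V] [FiniteDimensional 𝕜 V] {S : V →ₗ[𝕜] V} (hS : S.IsSymmetric) {b : ℝ}
    (h0 : ∀ x, 0 ≤ RCLike.re (inner 𝕜 (S x) x))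
    (h1 : ∀ x, RCLike.re (inner 𝕜 (S x) x) ≤ b * ‖x‖ ^ 2) (p : ℝ[X]) {M : ℝ} (hM : 0 ≤ M)
    (hp : ∀ t ∈ Set.Icc 0 b, |p.eval t| ≤ M) (x : V) :
    ‖Polynomial.aeval S (p.map (algebraMap ℝ 𝕜)) x‖ ≤ M * ‖x‖ := by
  classical
  set B := hS.eigenvectorBasis rfl with hB
  set l := hS.eigenvalues rfl with hl
  have hlmem : ∀ i, l i ∈ Set.Icc 0 b := by
    intro i
    have hn : ‖B i‖ = 1 := B.orthonormal.1 i
    have e : RCLike.re (inner 𝕜 (S (B i)) (B i)) = l i := by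
      rw [hB, hS.apply_eigenvectorBasis, inner_smul_left, ← hB]
      rw [inner_self_eq_norm_sq_to_K, hn]
      simp [hl]
    have := h0 (B i)
    have h2 := h1 (B i)
    rw [e] at this h2
    rw [hn] at h2
    exact ⟨this, by simpa using h2⟩
  have hev : ∀ i, Polynomial.aeval S (p.map (algebraMap ℝ 𝕜)) (B i)
      = ((p.eval (l i) : ℝ) : 𝕜) • B i := by
    intro i
    have := Module.End.aeval_apply_of_hasEigenvector (p := p.map (algebraMap ℝ 𝕜))
      (hS.hasEigenvector_eigenvectorBasis rfl i)
    rw [← hB] at this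
    rw [this]
    congr 1
    rw [Polynomial.eval_map, ← RCLike.algebraMap_eq_ofReal]
    exact Polynomial.eval₂_at_apply _ _
  have hx : Polynomial.aeval S (p.map (algebraMap ℝ 𝕜)) x
      = ∑ i, (inner 𝕜 (B i) x * ((p.eval (l i) : ℝ) : 𝕜)) • B i := by
    conv_lhs => rw [← B.sum_repr' x]
    rw [map_sum]
    refine Finset.sum_congr rfl fun i _ => ?_
    rw [map_smul, hev, smul_smul]
  have hc : ∀ i, inner 𝕜 (B i) (Polynomial.aeval S (p.map (algebraMap ℝ 𝕜)) x)
      = inner 𝕜 (B i) x * ((p.eval (l i) : ℝ) : 𝕜) := by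
    intro i
    rw [hx, B.orthonormal.inner_right_fintype]
  refine (sq_le_sq₀ (norm_nonneg _) (by positivity)).1 ?_
  rw [← B.sum_sq_norm_inner_right, mul_pow, ← B.sum_sq_norm_inner_right x, Finset.mul_sum]
  refine Finset.sum_le_sum fun i _ => ?_
  rw [hc, norm_mul, mul_pow, mul_comm]
  gcongr
  rw [RCLike.norm_ofReal]
  exact hp _ (hlmem i)

/-- Reduction to finite dimensions: on the Krylov space of `x`, the polynomial `p(T) x` only sees
the compression of `T`. -/
lemma norm_polyOp_apply_le {T : E →L[𝕜] E} {b : ℝ} (hT : SpectrumIn T b) (p : ℝ[X]) {M : ℝ}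
    (hM : 0 ≤ M) (hp : ∀ t ∈ Set.Icc 0 b, |p.eval t| ≤ M) (x : E) :
    ‖polyOp p T x‖ ≤ M * ‖x‖ := by
  classical
  -- V need not be T-invariant: only the powers up to the degree of p are ever evaluated at x.
  set d := (p.map (algebraMap ℝ 𝕜)).natDegree
  set V : Submodule 𝕜 E := Submodule.span 𝕜 ((fun i : ℕ => (T ^ i) x) '' (Finset.range (d + 1)))
  have hfin : FiniteDimensional 𝕜 V :=
    FiniteDimensional.span_of_finite 𝕜 (Set.Finite.image _ (Finset.finite_toSet _))
  have hmem : ∀ i ≤ d, (T ^ i) x ∈ V := fun i hi =>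
    Submodule.subset_span ⟨i, by simpa using Nat.lt_succ_of_le hi, rfl⟩
  set S : V →ₗ[𝕜] V :=
    ContinuousLinearMap.toLinearMap (V.orthogonalProjectionOnto ∘L T ∘L V.subtypeL) with hSdef
  have hSa : ∀ v : V, S v = V.orthogonalProjectionOnto (T v) := fun v => rfl
  have hin : ∀ v w : V, inner 𝕜 (S v) w = inner 𝕜 (T (v : E)) (w : E) := by
    intro v w
    rw [hSa, Submodule.inner_orthogonalProjectionOnto_eq_of_mem_right]
  have hS : S.IsSymmetric := by
    intro v w
    rw [hin, hT.symm, ← inner_conj_symm, ← hin, inner_conj_symm]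
  -- The projection in S acts trivially as long as the next power of T applied to x still lies in V,
  -- hence the restriction i ≤ d.
  have hpow : ∀ i ≤ d, (((S ^ i) ⟨x, by simpa using hmem 0 (Nat.zero_le _)⟩ : V) : E) = (T ^ i) x := by
    intro i
    induction i with
    | zero => intro _; simp
    | succ i ih =>
      intro hi
      rw [pow_succ', pow_succ', Module.End.mul_apply, hSa, ih (by omega)]
      have : T ((T ^ i) x) ∈ V := by
        have := hmem (i + 1) hi
        rwa [pow_succ'] at this
      exact congrArg Subtype.val (Submodule.orthogonalProjectionOnto_mem_subspace_eq_self (⟨_, this⟩ : V))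
  have key : polyOp p T x = ((Polynomial.aeval S (p.map (algebraMap ℝ 𝕜))
      ⟨x, by simpa using hmem 0 (Nat.zero_le _)⟩ : V) : E) := by
    rw [polyOp, Polynomial.aeval_eq_sum_range, Polynomial.aeval_eq_sum_range]
    simp only [_root_.sum_apply, LinearMap.sum_apply, Submodule.coe_sum,
      _root_.smul_apply, LinearMap.smul_apply, Submodule.coe_smul]
    refine Finset.sum_congr rfl fun i hi => ?_
    rw [hpow i (by have := Finset.mem_range.1 hi; omega)]
  rw [key]
  refine norm_aeval_apply_le_of_finiteDimensional hS (b := b) (fun v => ?_) (fun v => ?_) p hM hp _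
  · rw [hin]; exact hT.nonneg _
  · rw [hin]; exact hT.le _

lemma polyApprox_hasBasis (f : ℝ → ℝ) :
    (polyApprox f).HasBasis (fun ε : ℝ => ε ∈ Set.Ioi (0 : ℝ))
      (fun ε => {p : ℝ[X] | ∀ t ∈ Set.Icc (0 : ℝ) (1 / 2), |p.eval t - f t| ≤ ε}) := by
  refine hasBasis_biInf_principal ?_ ⟨1, Set.mem_Ioi.2 one_pos⟩
  intro a ha b hb
  exact ⟨min a b, Set.mem_Ioi.2 (lt_min ha hb),
    fun p hp t ht => (hp t ht).trans (min_le_left _ _),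
    fun p hp t ht => (hp t ht).trans (min_le_right _ _)⟩

lemma polyApprox_neBot {f : ℝ → ℝ} (hf : ContinuousOn f (Set.Icc 0 (1 / 2))) :
    (polyApprox f).NeBot := by
  rw [(polyApprox_hasBasis f).neBot_iff]
  intro ε hε
  obtain ⟨p, hp⟩ := exists_polynomial_near_of_continuousOn 0 (1 / 2) f hf ε hε
  exact ⟨p, fun t ht => (hp t ht).le⟩

lemma tendsto_polyApprox {f : ℝ → ℝ} {P : ℕ → ℝ[X]}
    (h : ∀ ε > 0, ∀ᶠ n in atTop, ∀ t ∈ Set.Icc (0 : ℝ) (1 / 2), |(P n).eval t - f t| ≤ ε) :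
    Tendsto P atTop (polyApprox f) :=
  (polyApprox_hasBasis f).tendsto_right_iff.2 fun ε hε => h ε hε

lemma exists_polynomial_seq {f : ℝ → ℝ} (hf : ContinuousOn f (Set.Icc 0 (1 / 2))) :
    ∃ P : ℕ → ℝ[X], ∀ ε > 0, ∀ᶠ n in atTop,
      ∀ t ∈ Set.Icc (0 : ℝ) (1 / 2), |(P n).eval t - f t| ≤ ε := by
  choose P hP using fun n : ℕ =>
    exists_polynomial_near_of_continuousOn 0 (1 / 2) f hf (1 / ((n : ℝ) + 1)) (by positivity)
  refine ⟨P, fun ε hε => ?_⟩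
  filter_upwards [(tendsto_one_div_add_atTop_nhds_zero_nat (𝕜 := ℝ)).eventually_lt_const hε]
    with n hn t ht
  exact (hP n t ht).le.trans hn.le

lemma polyOp_sub (p r : ℝ[X]) (T : E →L[𝕜] E) :
    polyOp (p - r) T = polyOp p T - polyOp r T := by
  simp [polyOp]

lemma norm_polyOp_le {T : E →L[𝕜] E} {b : ℝ} (hT : SpectrumIn T b) (p : ℝ[X]) {M : ℝ}
    (hM : 0 ≤ M) (hp : ∀ t ∈ Set.Icc 0 b, |p.eval t| ≤ M) : ‖polyOp p T‖ ≤ M :=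
  ContinuousLinearMap.opNorm_le_bound _ hM (norm_polyOp_apply_le hT p hM hp)

lemma polyOp_symm {T : E →L[𝕜] E} {b : ℝ} (hT : SpectrumIn T b) (p : ℝ[X]) (x y : E) :
    inner 𝕜 (polyOp p T x) y = inner 𝕜 x (polyOp p T y) := by
  have hpow : ∀ (n : ℕ) (x y : E), inner 𝕜 ((T ^ n) x) y = inner 𝕜 x ((T ^ n) y) := by
    intro n
    induction n with
    | zero => intro x y; simp
    | succ n ih =>
      intro x y
      have h1 : (T ^ (n + 1)) x = T ((T ^ n) x) := by rw [pow_succ']; rfl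
      have h2 : (T ^ (n + 1)) y = (T ^ n) (T y) := by rw [pow_succ]; rfl
      rw [h1, h2, hT.symm, ih]
  rw [polyOp, Polynomial.aeval_eq_sum_range]
  simp only [_root_.sum_apply, _root_.smul_apply, sum_inner, inner_sum,
    inner_smul_left, inner_smul_right, hpow, Polynomial.coeff_map, RCLike.algebraMap_eq_ofReal,
    RCLike.conj_ofReal]

lemma opFun_congr {T : E →L[𝕜] E} {f h : ℝ → ℝ}
    (hfh : Set.EqOn f h (Set.Icc 0 (1 / 2))) : opFun f T = opFun h T := by
  have : polyApprox f = polyApprox h := by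
    unfold polyApprox
    refine iInf_congr fun ε => iInf_congr fun _ => congrArg 𝓟 (Set.ext fun p => ?_)
    exact forall₂_congr fun t ht => by rw [hfh ht]
  rw [opFun, this, opFun]

variable [CompleteSpace E] {T : E →L[𝕜] E} {b : ℝ} {f h : ℝ → ℝ}

/-- The sup-norm bound for polynomials makes p ↦ p(T) send the approximating filter to a Cauchy
filter, and the space of bounded operators is complete. -/
lemma tendsto_polyOp (hT : SpectrumIn T b) (hb : b ≤ 1 / 2)
    (hf : ContinuousOn f (Set.Icc 0 (1 / 2))) :
    Tendsto (fun p => polyOp p T) (polyApprox f) (𝓝 (opFun f T)) := by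
  have := polyApprox_neBot hf
  refine tendsto_nhds_limUnder (cauchy_map_iff_exists_tendsto.1 ?_)
  refine Metric.cauchy_iff.2 ⟨inferInstance, fun ε hε => ?_⟩
  refine ⟨_, image_mem_map ((polyApprox_hasBasis f).mem_of_mem (i := ε / 3)
    (Set.mem_Ioi.2 (by positivity))), ?_⟩
  rintro _ ⟨p, hp, rfl⟩ _ ⟨r, hr, rfl⟩
  rw [dist_eq_norm, ← polyOp_sub]
  refine (norm_polyOp_le hT _ (M := ε / 3 + ε / 3) (by positivity) fun t ht => ?_).trans_lt
    (by linarith)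
  have ht' : t ∈ Set.Icc (0 : ℝ) (1 / 2) := ⟨ht.1, ht.2.trans hb⟩
  have h1 := hp t ht'
  have h2 := hr t ht'
  rw [abs_le] at *
  simp only [Polynomial.eval_sub]
  constructor <;> linarith

lemma tendsto_polyOp_seq (hT : SpectrumIn T b) (hb : b ≤ 1 / 2)
    (hf : ContinuousOn f (Set.Icc 0 (1 / 2))) {P : ℕ → ℝ[X]}
    (h : ∀ ε > 0, ∀ᶠ n in atTop, ∀ t ∈ Set.Icc (0 : ℝ) (1 / 2), |(P n).eval t - f t| ≤ ε) :
    Tendsto (fun n => polyOp (P n) T) atTop (𝓝 (opFun f T)) :=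
  (tendsto_polyOp hT hb hf).comp (tendsto_polyApprox h)

lemma opFun_eval (hT : SpectrumIn T b) (hb : b ≤ 1 / 2) (p : ℝ[X]) :
    opFun (fun t => p.eval t) T = polyOp p T :=
  tendsto_nhds_unique (tendsto_polyOp_seq hT hb p.continuous.continuousOn (P := fun _ => p)
    fun ε hε => Eventually.of_forall fun n t _ => by simpa using hε.le) tendsto_const_nhds

lemma opFun_one (hT : SpectrumIn T b) (hb : b ≤ 1 / 2) :
    opFun (fun _ => 1) T = ContinuousLinearMap.id 𝕜 E := by
  have := opFun_eval hT hb 1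
  simp only [Polynomial.eval_one] at this
  rw [this]
  simp [polyOp, ContinuousLinearMap.one_def]

lemma opFun_id (hT : SpectrumIn T b) (hb : b ≤ 1 / 2) : opFun (fun t => t) T = T := by
  have := opFun_eval hT hb Polynomial.X
  simp only [Polynomial.eval_X] at this
  rw [this]
  simp [polyOp]

lemma opFun_sub (hT : SpectrumIn T b) (hb : b ≤ 1 / 2)
    (hf : ContinuousOn f (Set.Icc 0 (1 / 2))) (hh : ContinuousOn h (Set.Icc 0 (1 / 2))) :
    opFun (fun t => f t - h t) T = opFun f T - opFun h T := by
  obtain ⟨P, hP⟩ := exists_polynomial_seq hf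
  obtain ⟨R, hR⟩ := exists_polynomial_seq hh
  have := (tendsto_polyOp_seq hT hb hf hP).sub (tendsto_polyOp_seq hT hb hh hR)
  simp_rw [← polyOp_sub] at this
  refine tendsto_nhds_unique (tendsto_polyOp_seq hT hb (hf.sub hh) fun ε hε => ?_) this
  filter_upwards [hP (ε / 2) (by positivity), hR (ε / 2) (by positivity)] with n h1 h2 t ht
  have h1 := h1 t ht
  have h2 := h2 t ht
  rw [abs_le] at *
  simp only [Polynomial.eval_sub, Pi.sub_apply]
  constructor <;> linarith

lemma opFun_mul (hT : SpectrumIn T b) (hb : b ≤ 1 / 2)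
    (hf : ContinuousOn f (Set.Icc 0 (1 / 2))) (hh : ContinuousOn h (Set.Icc 0 (1 / 2))) :
    opFun (fun t => f t * h t) T = opFun f T ∘L opFun h T := by
  obtain ⟨P, hP⟩ := exists_polynomial_seq hf
  obtain ⟨R, hR⟩ := exists_polynomial_seq hh
  obtain ⟨Mf, hMf⟩ := isCompact_Icc.exists_bound_of_continuousOn hf
  obtain ⟨Mh, hMh⟩ := isCompact_Icc.exists_bound_of_continuousOn hh
  have h0 : (0 : ℝ) ∈ Set.Icc (0 : ℝ) (1 / 2) := by constructor <;> norm_num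
  have hMf0 : 0 ≤ Mf := (norm_nonneg _).trans (hMf 0 h0)
  have hMh0 : 0 ≤ Mh := (norm_nonneg _).trans (hMh 0 h0)
  have := (tendsto_polyOp_seq hT hb hf hP).mul (tendsto_polyOp_seq hT hb hh hR)
  have hmul : ∀ n, polyOp (P n) T * polyOp (R n) T = polyOp (P n * R n) T := fun n => by
    simp [polyOp]
  simp_rw [hmul] at this
  refine tendsto_nhds_unique (tendsto_polyOp_seq hT hb (hf.mul hh) fun ε hε => ?_) this
  have hK : 0 < Mf + Mh + 1 := by positivity
  -- The cap at 1 turns the product of the two errors into a linear term, so the total error is at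
  -- most η (Mf + Mh + 1).
  set η := min 1 (ε / (Mf + Mh + 1)) with hη
  have hη0 : 0 < η := lt_min one_pos (by positivity)
  filter_upwards [hP η hη0, hR η hη0] with n h1 h2 t ht
  have h1 := h1 t ht
  have h2 := h2 t ht
  have h3 := hMf t ht
  have h4 := hMh t ht
  rw [Real.norm_eq_abs] at h3 h4
  have e : (P n * R n).eval t - f t * h t
      = f t * ((R n).eval t - h t) + h t * ((P n).eval t - f t)
        + ((P n).eval t - f t) * ((R n).eval t - h t) := by
    rw [Polynomial.eval_mul]; ring
  have hη1 : η ≤ 1 := min_le_left _ _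
  have hη2 : η * (Mf + Mh + 1) ≤ ε := by
    have := min_le_right 1 (ε / (Mf + Mh + 1))
    rwa [← hη, le_div_iff₀ hK] at this
  show |(P n * R n).eval t - f t * h t| ≤ ε
  rw [e]
  calc _ ≤ |f t| * |(R n).eval t - h t| + |h t| * |(P n).eval t - f t|
        + |(P n).eval t - f t| * |(R n).eval t - h t| := by
        refine (abs_add_le _ _).trans (add_le_add ((abs_add_le _ _).trans ?_) ?_) <;>
          simp only [abs_mul, le_refl]
    _ ≤ Mf * η + Mh * η + 1 * η := by gcongr; exact h1.trans hη1
    _ ≤ ε := by linarith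

lemma opFun_mul_apply (hT : SpectrumIn T b) (hb : b ≤ 1 / 2)
    (hf : ContinuousOn f (Set.Icc 0 (1 / 2))) (hh : ContinuousOn h (Set.Icc 0 (1 / 2))) (x : E) :
    opFun f T (opFun h T x) = opFun (fun t => f t * h t) T x := by
  rw [opFun_mul hT hb hf hh]; rfl

lemma opFun_comm_apply (hT : SpectrumIn T b) (hb : b ≤ 1 / 2)
    (hf : ContinuousOn f (Set.Icc 0 (1 / 2))) (hh : ContinuousOn h (Set.Icc 0 (1 / 2))) (x : E) :
    opFun f T (opFun h T x) = opFun h T (opFun f T x) := by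
  rw [opFun_mul_apply hT hb hf hh, opFun_mul_apply hT hb hh hf]
  simp_rw [mul_comm]

lemma norm_opFun_apply_le (hT : SpectrumIn T b) (hb : b ≤ 1 / 2)
    (hf : ContinuousOn f (Set.Icc 0 (1 / 2))) {M : ℝ} (hM : 0 ≤ M)
    (hfM : ∀ t ∈ Set.Icc 0 b, |f t| ≤ M) (x : E) : ‖opFun f T x‖ ≤ M * ‖x‖ := by
  obtain ⟨P, hP⟩ := exists_polynomial_seq hf
  have hlim : ‖opFun f T‖ ≤ M := by
    refine le_of_forall_pos_le_add fun ε hε => ?_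
    refine le_of_tendsto (tendsto_polyOp_seq hT hb hf hP).norm ?_
    filter_upwards [hP ε hε] with n hn
    refine norm_polyOp_le hT _ (by positivity) fun t ht => ?_
    have h1 := hn t ⟨ht.1, ht.2.trans hb⟩
    have h2 := hfM t ht
    rw [abs_le] at *
    constructor <;> linarith
  exact (opFun f T).le_of_opNorm_le hlim x

/-- The calculus approximates on all of [0, 1/2], but the norm bound only sees [0, b]. -/
lemma opFun_apply_eq_of_eqOn (hT : SpectrumIn T b) (hb : b ≤ 1 / 2)
    (hf : ContinuousOn f (Set.Icc 0 (1 / 2))) (hh : ContinuousOn h (Set.Icc 0 (1 / 2)))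
    (hfh : Set.EqOn f h (Set.Icc 0 b)) (x : E) : opFun f T x = opFun h T x := by
  have := norm_opFun_apply_le hT hb (hf.sub hh) le_rfl
    (fun t ht => by rw [Pi.sub_apply, hfh ht, sub_self, abs_zero]) x
  rw [zero_mul, norm_le_zero_iff] at this
  have e : opFun (f - h) T = opFun f T - opFun h T := opFun_sub hT hb hf hh
  rw [e] at this
  exact sub_eq_zero.1 this

lemma opFun_symm (hT : SpectrumIn T b) (hb : b ≤ 1 / 2)
    (hf : ContinuousOn f (Set.Icc 0 (1 / 2))) (x y : E) :
    inner 𝕜 (opFun f T x) y = inner 𝕜 x (opFun f T y) := by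
  obtain ⟨P, hP⟩ := exists_polynomial_seq hf
  have h1 := tendsto_polyOp_seq hT hb hf hP
  have hx : Tendsto (fun n => polyOp (P n) T x) atTop (𝓝 (opFun f T x)) :=
    ((ContinuousLinearMap.apply 𝕜 E x).continuous.tendsto _).comp h1
  have hy : Tendsto (fun n => polyOp (P n) T y) atTop (𝓝 (opFun f T y)) :=
    ((ContinuousLinearMap.apply 𝕜 E y).continuous.tendsto _).comp h1
  refine tendsto_nhds_unique (hx.inner tendsto_const_nhds) ?_
  simp_rw [polyOp_symm hT]
  exact tendsto_const_nhds.inner hy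

lemma norm_opFun_const_mul_apply (hT : SpectrumIn T b) (hb : b ≤ 1 / 2)
    (hf : ContinuousOn f (Set.Icc 0 (1 / 2))) {c : ℝ} (hc : 0 ≤ c) (x : E) :
    ‖opFun (fun t => c * f t) T x‖ = c * ‖opFun f T x‖ := by
  have e := opFun_eval hT hb (Polynomial.C c)
  simp only [Polynomial.eval_C] at e
  rw [← opFun_mul_apply hT hb continuousOn_const hf, e]
  simp [polyOp, Algebra.algebraMap_eq_smul_one, norm_smul, abs_of_nonneg hc]

/-- Domination of functions carries over to the norms of the values of the calculus. -/
lemma norm_opFun_apply_mono (hT : SpectrumIn T b) (hb : b ≤ 1 / 2)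
    (hf : ContinuousOn f (Set.Icc 0 (1 / 2))) (hh : ContinuousOn h (Set.Icc 0 (1 / 2)))
    {c : ℝ} (hc : 0 ≤ c) (hfh : ∀ t ∈ Set.Icc (0 : ℝ) b, |f t| ≤ c * |h t|) (x : E) :
    ‖opFun f T x‖ ≤ c * ‖opFun h T x‖ := by
  have sq : ∀ {k : ℝ → ℝ}, ContinuousOn k (Set.Icc 0 (1 / 2)) →
      ‖opFun k T x‖ ^ 2 = RCLike.re (inner 𝕜 (opFun (fun t => k t * k t) T x) x) := by
    intro k hk
    rw [← inner_self_eq_norm_sq (𝕜 := 𝕜), opFun_symm hT hb hk, opFun_mul_apply hT hb hk hk,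
      inner_re_symm]
  rw [← norm_opFun_const_mul_apply hT hb hh hc]
  set h' : ℝ → ℝ := fun t => c * h t with hh'
  have hhc : ContinuousOn h' (Set.Icc 0 (1 / 2)) := continuousOn_const.mul hh
  -- With k² = h'² − f² on [0, b] one gets ‖h'(T)x‖² − ‖f(T)x‖² = ‖k(T)x‖² ≥ 0. Outside [0, b] the
  -- root may be truncated to 0, which leaves k continuous and is invisible to T.
  set k : ℝ → ℝ := fun t => √(h' t * h' t - f t * f t) with hk
  have hkc : ContinuousOn k (Set.Icc 0 (1 / 2)) := ((hhc.mul hhc).sub (hf.mul hf)).sqrt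
  have hkk : Set.EqOn (fun t => k t * k t) (fun t => h' t * h' t - f t * f t)
      (Set.Icc 0 b) := by
    intro t ht
    refine Real.mul_self_sqrt ?_
    have h1 : |f t| ≤ |h' t| := by
      rw [hh', abs_mul, abs_of_nonneg hc]; exact hfh t ht
    have := mul_self_le_mul_self (abs_nonneg _) h1
    rw [abs_mul_abs_self, abs_mul_abs_self] at this
    linarith
  have h1 := sq hkc
  have e : opFun (fun t => h' t * h' t - f t * f t) T
      = opFun (fun t => h' t * h' t) T - opFun (fun t => f t * f t) T :=
    opFun_sub hT hb (hhc.mul hhc) (hf.mul hf)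
  have e2 : opFun (fun t => k t * k t) T x = opFun (fun t => h' t * h' t - f t * f t) T x :=
    opFun_apply_eq_of_eqOn hT hb (hkc.mul hkc) ((hhc.mul hhc).sub (hf.mul hf)) hkk x
  rw [e2, e, _root_.sub_apply, inner_sub_left, map_sub, ← sq hhc, ← sq hf] at h1
  refine (sq_le_sq₀ (norm_nonneg _) (norm_nonneg _)).1 ?_
  nlinarith [sq_nonneg ‖opFun k T x‖]

end Calculus

/-! ### Functions of G*G combined with G and its adjoint -/

section NormalOperator

variable {𝕜 X Y : Type*} [RCLike 𝕜]
  [NormedAddCommGroup X] [InnerProductSpace 𝕜 X] [CompleteSpace X]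
  [NormedAddCommGroup Y] [InnerProductSpace 𝕜 Y] [CompleteSpace Y]
  {G : X →L[𝕜] Y} {b : ℝ} {f h : ℝ → ℝ}

lemma inner_normalOp (G : X →L[𝕜] Y) (x y : X) :
    inner 𝕜 (normalOp G x) y = inner 𝕜 (G x) (G y) := by
  rw [normalOp, ContinuousLinearMap.comp_apply, ContinuousLinearMap.adjoint_inner_left]

lemma spectrumIn_normalOp (hG : ‖G‖ ^ 2 ≤ b) : SpectrumIn (normalOp G) b where
  symm x y := by
    rw [inner_normalOp, ← inner_conj_symm, ← inner_normalOp, inner_conj_symm]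
  nonneg x := by
    rw [inner_normalOp]
    exact inner_self_nonneg
  le x := by
    rw [inner_normalOp, inner_self_eq_norm_sq]
    calc ‖G x‖ ^ 2 ≤ (‖G‖ * ‖x‖) ^ 2 := by gcongr; exact G.le_opNorm x
      _ ≤ b * ‖x‖ ^ 2 := by rw [mul_pow]; gcongr

lemma continuousOn_sqrt_mul (hf : ContinuousOn f (Set.Icc 0 (1 / 2))) :
    ContinuousOn (fun t => √t * f t) (Set.Icc 0 (1 / 2)) :=
  Real.continuous_sqrt.continuousOn.mul hf

/-- This is ‖Gv‖ = ‖(G*G)^{1/2} v‖: inside norms, a factor G may be traded for a factor √t of the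
function. -/
lemma norm_comp_opFun_apply (hG : ‖G‖ ^ 2 ≤ b) (hb : b ≤ 1 / 2)
    (hf : ContinuousOn f (Set.Icc 0 (1 / 2))) (x : X) :
    ‖G (opFun f (normalOp G) x)‖ = ‖opFun (fun t => √t * f t) (normalOp G) x‖ := by
  have hT := spectrumIn_normalOp hG
  have hs : ContinuousOn (fun t : ℝ => √t) (Set.Icc 0 (1 / 2)) :=
    Real.continuous_sqrt.continuousOn
  refine (sq_eq_sq₀ (norm_nonneg _) (norm_nonneg _)).1 ?_
  rw [← opFun_mul_apply hT hb hs hf, ← inner_self_eq_norm_sq (𝕜 := 𝕜),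
    ← inner_self_eq_norm_sq (𝕜 := 𝕜), ← inner_normalOp, opFun_symm hT hb hs,
    opFun_mul_apply hT hb hs hs, opFun_congr (h := fun t => t)
      (fun t ht => Real.mul_self_sqrt ht.1), opFun_id hT hb, hT.symm]

lemma norm_comp_opFun_apply_le (hG : ‖G‖ ^ 2 ≤ b) (hb : b ≤ 1 / 2)
    (hf : ContinuousOn f (Set.Icc 0 (1 / 2))) {M : ℝ} (hM : 0 ≤ M)
    (hfM : ∀ t ∈ Set.Icc 0 b, |√t * f t| ≤ M) (x : X) :
    ‖G (opFun f (normalOp G) x)‖ ≤ M * ‖x‖ := by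
  rw [norm_comp_opFun_apply hG hb hf]
  exact norm_opFun_apply_le (spectrumIn_normalOp hG) hb (continuousOn_sqrt_mul hf) hM hfM x

lemma norm_comp_opFun_apply_mono (hG : ‖G‖ ^ 2 ≤ b) (hb : b ≤ 1 / 2)
    (hf : ContinuousOn f (Set.Icc 0 (1 / 2))) (hh : ContinuousOn h (Set.Icc 0 (1 / 2)))
    {c : ℝ} (hc : 0 ≤ c) (hfh : ∀ t ∈ Set.Icc (0 : ℝ) b, |f t| ≤ c * |h t|) (x : X) :
    ‖G (opFun f (normalOp G) x)‖ ≤ c * ‖G (opFun h (normalOp G) x)‖ := by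
  rw [norm_comp_opFun_apply hG hb hf, norm_comp_opFun_apply hG hb hh]
  refine norm_opFun_apply_mono (spectrumIn_normalOp hG) hb (continuousOn_sqrt_mul hf)
    (continuousOn_sqrt_mul hh) hc (fun t ht => ?_) x
  rw [abs_mul, abs_mul]
  nlinarith [hfh t ht, abs_nonneg (√t)]

/-- Duality: f(G*G)G* is the adjoint of G f(G*G), which is bounded by the previous trade of G for
√t. -/
lemma norm_opFun_adjoint_apply_le (hG : ‖G‖ ^ 2 ≤ b) (hb : b ≤ 1 / 2)
    (hf : ContinuousOn f (Set.Icc 0 (1 / 2))) {M : ℝ} (hM : 0 ≤ M)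
    (hfM : ∀ t ∈ Set.Icc 0 b, |√t * f t| ≤ M) (y : Y) :
    ‖opFun f (normalOp G) (ContinuousLinearMap.adjoint G y)‖ ≤ M * ‖y‖ := by
  set v := opFun f (normalOp G) (ContinuousLinearMap.adjoint G y) with hv
  have h1 : ‖v‖ ^ 2 ≤ ‖y‖ * (M * ‖v‖) := by
    calc ‖v‖ ^ 2 = RCLike.re (inner 𝕜 y (G (opFun f (normalOp G) v))) := by
          rw [← inner_self_eq_norm_sq (𝕜 := 𝕜)]
          conv_lhs => rw [hv, opFun_symm (spectrumIn_normalOp hG) hb hf,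
            ContinuousLinearMap.adjoint_inner_left]
      _ ≤ ‖y‖ * ‖G (opFun f (normalOp G) v)‖ := re_inner_le_norm _ _
      _ ≤ _ := by gcongr; exact norm_comp_opFun_apply_le hG hb hf hM hfM v
  rcases (norm_nonneg v).eq_or_lt with h0 | h0
  · rw [← h0]; positivity
  · refine le_of_mul_le_mul_right ?_ h0
    linarith

lemma adjoint_inner_opFun (hG : ‖G‖ ^ 2 ≤ b) (hb : b ≤ 1 / 2)
    (hf : ContinuousOn f (Set.Icc 0 (1 / 2))) (x : X) (y : Y) :
    inner 𝕜 (opFun f (normalOp G) (ContinuousLinearMap.adjoint G y)) x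
      = inner 𝕜 y (G (opFun f (normalOp G) x)) := by
  rw [opFun_symm (spectrumIn_normalOp hG) hb hf, ContinuousLinearMap.adjoint_inner_left]

lemma opFun_sqrt_comp_sqrt_apply (hG : ‖G‖ ^ 2 ≤ b) (hb : b ≤ 1 / 2)
    (hf : ContinuousOn f (Set.Icc 0 (1 / 2))) (hf0 : ∀ t ∈ Set.Icc (0 : ℝ) (1 / 2), 0 ≤ f t)
    (x : X) : opFun f (normalOp G) x
      = opFun (fun t => √(f t)) (normalOp G) (opFun (fun t => √(f t)) (normalOp G) x) := by
  rw [opFun_mul_apply (spectrumIn_normalOp hG) hb hf.sqrt hf.sqrt]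
  rw [opFun_congr (h := fun t => √(f t) * √(f t)) fun t ht => (Real.mul_self_sqrt (hf0 t ht)).symm]

lemma abs_sqrt_mul_sqrt_le {M t : ℝ} (ht : 0 ≤ t) (hfM : t * f t ≤ M) :
    |√t * √(f t)| ≤ √M := by
  rw [abs_of_nonneg (by positivity), ← Real.sqrt_mul ht]
  exact Real.sqrt_le_sqrt hfM

/-- G f G* factors as (G √f)(√f G*), and each factor has norm at most √M. -/
lemma norm_comp_opFun_adjoint_apply_le (hG : ‖G‖ ^ 2 ≤ b) (hb : b ≤ 1 / 2)
    (hf : ContinuousOn f (Set.Icc 0 (1 / 2))) (hf0 : ∀ t ∈ Set.Icc (0 : ℝ) (1 / 2), 0 ≤ f t)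
    {M : ℝ} (hM : 0 ≤ M) (hfM : ∀ t ∈ Set.Icc 0 b, t * f t ≤ M) (y : Y) :
    ‖G (opFun f (normalOp G) (ContinuousLinearMap.adjoint G y))‖ ≤ M * ‖y‖ := by
  have hM' : ∀ t ∈ Set.Icc 0 b, |√t * √(f t)| ≤ √M := fun t ht =>
    abs_sqrt_mul_sqrt_le ht.1 (hfM t ht)
  rw [opFun_sqrt_comp_sqrt_apply hG hb hf hf0]
  refine (norm_comp_opFun_apply_le hG hb hf.sqrt (Real.sqrt_nonneg M) hM' _).trans ?_
  calc _ ≤ √M * (√M * ‖y‖) := by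
        gcongr; exact norm_opFun_adjoint_apply_le hG hb hf.sqrt (Real.sqrt_nonneg M) hM' y
    _ = M * ‖y‖ := by rw [← mul_assoc, Real.mul_self_sqrt hM]

/-- The operator B = G f(G*G) G* satisfies 0 ≤ B ≤ 1, so I − B is a contraction. With w = √f(G*G)
G*y and z = By, one has Re⟨y, z⟩ = ‖w‖² and ‖z‖ ≤ ‖w‖; expand ‖y − z‖². The constant 1 is what later
allows every τ > 1. -/
lemma norm_sub_comp_opFun_adjoint_apply_le (hG : ‖G‖ ^ 2 ≤ b) (hb : b ≤ 1 / 2)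
    (hf : ContinuousOn f (Set.Icc 0 (1 / 2))) (hf0 : ∀ t ∈ Set.Icc (0 : ℝ) (1 / 2), 0 ≤ f t)
    (hfM : ∀ t ∈ Set.Icc 0 b, t * f t ≤ 1) (y : Y) :
    ‖y - G (opFun f (normalOp G) (ContinuousLinearMap.adjoint G y))‖ ≤ ‖y‖ := by
  have hM' : ∀ t ∈ Set.Icc 0 b, |√t * √(f t)| ≤ 1 := fun t ht => by
    simpa using abs_sqrt_mul_sqrt_le ht.1 (hfM t ht)
  rw [opFun_sqrt_comp_sqrt_apply hG hb hf hf0]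
  set w := opFun (fun t => √(f t)) (normalOp G) (ContinuousLinearMap.adjoint G y) with hw
  set z := G (opFun (fun t => √(f t)) (normalOp G) w) with hz
  have h1 : ‖z‖ ≤ ‖w‖ := by
    simpa using norm_comp_opFun_apply_le hG hb hf.sqrt zero_le_one hM' w
  have h2 : RCLike.re (inner 𝕜 y z) = ‖w‖ ^ 2 := by
    rw [hz, ← adjoint_inner_opFun hG hb hf.sqrt, ← hw, inner_self_eq_norm_sq]
  refine (sq_le_sq₀ (norm_nonneg _) (norm_nonneg _)).1 ?_
  rw [norm_sub_sq (𝕜 := 𝕜), h2]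
  nlinarith [norm_nonneg z, norm_nonneg w]

end NormalOperator

/-! ### Operator bounds for the filter functions, and the qualification -/

section FilterFamily

variable {𝕜 X Y : Type*} [RCLike 𝕜]
  [NormedAddCommGroup X] [InnerProductSpace 𝕜 X] [CompleteSpace X]
  [NormedAddCommGroup Y] [InnerProductSpace 𝕜 Y] [CompleteSpace Y]
  {g : ℝ → ℝ → ℝ} {c₀ c₁ c₂ c₃ c₄ : ℝ} {G : X →L[𝕜] Y} {a : ℝ}

lemma continuousOn_self {S : Set ℝ} : ContinuousOn (fun t : ℝ => t) S := continuousOn_id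

lemma mem_Icc_half : (1 / 2 : ℝ) ∈ Set.Icc (0 : ℝ) (1 / 2) := by constructor <;> norm_num

namespace IsFilterFamily

lemma residual_continuousOn (hg : IsFilterFamily g c₀ c₁ c₂ c₃ c₄)
    (ha : 0 < a) :
    ContinuousOn (residual g a) (Set.Icc 0 (1 / 2)) :=
  continuousOn_const.sub (continuousOn_self.mul (hg.continuousOn a ha))

lemma c₃_pos (hg : IsFilterFamily g c₀ c₁ c₂ c₃ c₄)
    : 0 < c₃ := by
  have h1 := hg.residual_mul_sqrt_le 1 one_pos (1 / 2) mem_Icc_half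
  have h2 := hg.residual_pos 1 one_pos (1 / 2) mem_Icc_half
  rw [Real.sqrt_one, mul_one] at h1
  exact lt_of_lt_of_le (by positivity) h1

lemma c₄_nonneg (hg : IsFilterFamily g c₀ c₁ c₂ c₃ c₄)
    : 0 ≤ c₄ := by
  have h1 := hg.mul_sqrt_le 1 one_pos (1 / 2) mem_Icc_half
  have h2 := hg.nonneg 1 one_pos (1 / 2) mem_Icc_half
  rw [Real.sqrt_one, inv_one, mul_one] at h1
  exact le_trans (by positivity) h1

lemma mul_le_one (hg : IsFilterFamily g c₀ c₁ c₂ c₃ c₄)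
    (ha : 0 < a) : ∀ t ∈ Set.Icc (0 : ℝ) (1 / 2), t * g a t ≤ 1 := by
  intro t ht
  have := hg.residual_pos a ha t ht
  unfold residual at this
  linarith

lemma abs_residual_le_one (hg : IsFilterFamily g c₀ c₁ c₂ c₃ c₄)
    (ha : 0 < a) : ∀ t ∈ Set.Icc (0 : ℝ) (1 / 2), |residual g a t| ≤ 1 := by
  intro t ht
  rw [abs_of_pos (hg.residual_pos a ha t ht)]
  exact hg.residual_le_one a ha t ht

lemma abs_sqrt_mul_residual_le (hg : IsFilterFamily g c₀ c₁ c₂ c₃ c₄)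
    (ha : 0 < a) :
    ∀ t ∈ Set.Icc (0 : ℝ) (1 / 2), |√t * residual g a t| ≤ c₃ * √a := by
  intro t ht
  rw [abs_of_nonneg (mul_nonneg (Real.sqrt_nonneg _) (hg.residual_pos a ha t ht).le), mul_comm]
  exact hg.residual_mul_sqrt_le a ha t ht

lemma abs_sqrt_mul_le (hg : IsFilterFamily g c₀ c₁ c₂ c₃ c₄)
    (ha : 0 < a) :
    ∀ t ∈ Set.Icc (0 : ℝ) (1 / 2), |√t * g a t| ≤ c₄ * (√a)⁻¹ := by
  intro t ht
  rw [abs_of_nonneg (mul_nonneg (Real.sqrt_nonneg _) (hg.nonneg a ha t ht)), mul_comm]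
  exact hg.mul_sqrt_le a ha t ht

lemma opFun_residual_apply (hg : IsFilterFamily g c₀ c₁ c₂ c₃ c₄)
    (hG : ‖G‖ ^ 2 ≤ 1 / 2) (ha : 0 < a) (x : X) :
    opFun (residual g a) (normalOp G) x
      = x - opFun (g a) (normalOp G) (ContinuousLinearMap.adjoint G (G x)) := by
  have hT := spectrumIn_normalOp hG
  have e : opFun (residual g a) (normalOp G)
      = opFun (fun _ => 1) (normalOp G) - opFun (fun t => t * g a t) (normalOp G) :=
    opFun_sub hT le_rfl continuousOn_const (continuousOn_self.mul (hg.continuousOn a ha))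
  rw [e, opFun_one hT le_rfl, sub_apply,
    ← opFun_mul_apply hT le_rfl continuousOn_self (hg.continuousOn a ha),
    opFun_comm_apply hT le_rfl continuousOn_self (hg.continuousOn a ha), opFun_id hT le_rfl]
  rfl

lemma norm_residual_apply_le (hg : IsFilterFamily g c₀ c₁ c₂ c₃ c₄)
    (hG : ‖G‖ ^ 2 ≤ 1 / 2) (ha : 0 < a) (x : X) :
    ‖opFun (residual g a) (normalOp G) x‖ ≤ ‖x‖ := by
  simpa using norm_opFun_apply_le (spectrumIn_normalOp hG) le_rfl (hg.residual_continuousOn ha)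
    zero_le_one (hg.abs_residual_le_one ha) x

lemma norm_residual_adjoint_apply_le (hg : IsFilterFamily g c₀ c₁ c₂ c₃ c₄)
    (hG : ‖G‖ ^ 2 ≤ 1 / 2) (ha : 0 < a) (y : Y) :
    ‖opFun (residual g a) (normalOp G) (ContinuousLinearMap.adjoint G y)‖ ≤ c₃ * √a * ‖y‖ :=
  norm_opFun_adjoint_apply_le hG le_rfl (hg.residual_continuousOn ha)
    (mul_nonneg hg.c₃_pos.le (Real.sqrt_nonneg _)) (hg.abs_sqrt_mul_residual_le ha) y

lemma norm_comp_residual_apply_le (hg : IsFilterFamily g c₀ c₁ c₂ c₃ c₄)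
    (hG : ‖G‖ ^ 2 ≤ 1 / 2) (ha : 0 < a) (x : X) :
    ‖G (opFun (residual g a) (normalOp G) x)‖ ≤ c₃ * √a * ‖x‖ :=
  norm_comp_opFun_apply_le hG le_rfl (hg.residual_continuousOn ha)
    (mul_nonneg hg.c₃_pos.le (Real.sqrt_nonneg _)) (hg.abs_sqrt_mul_residual_le ha) x

lemma norm_comp_residual_adjoint_apply_le (hg : IsFilterFamily g c₀ c₁ c₂ c₃ c₄)
    (hG : ‖G‖ ^ 2 ≤ 1 / 2) (ha : 0 < a) (y : Y) :
    ‖G (opFun (residual g a) (normalOp G) (ContinuousLinearMap.adjoint G y))‖ ≤ c₀ * a * ‖y‖ :=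
  norm_comp_opFun_adjoint_apply_le hG le_rfl (hg.residual_continuousOn ha)
    (fun t ht => (hg.residual_pos a ha t ht).le) (mul_nonneg hg.c₀_pos.le ha.le)
    (fun t ht => by rw [mul_comm]; exact hg.residual_mul_le a ha t ht) y

lemma norm_adjoint_apply_le (hg : IsFilterFamily g c₀ c₁ c₂ c₃ c₄)
    (hG : ‖G‖ ^ 2 ≤ 1 / 2) (ha : 0 < a) (y : Y) :
    ‖opFun (g a) (normalOp G) (ContinuousLinearMap.adjoint G y)‖ ≤ c₄ * (√a)⁻¹ * ‖y‖ :=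
  norm_opFun_adjoint_apply_le hG le_rfl (hg.continuousOn a ha)
    (mul_nonneg hg.c₄_nonneg (by positivity)) (hg.abs_sqrt_mul_le ha) y

lemma norm_comp_adjoint_apply_le (hg : IsFilterFamily g c₀ c₁ c₂ c₃ c₄)
    (hG : ‖G‖ ^ 2 ≤ 1 / 2) (ha : 0 < a) (y : Y) :
    ‖G (opFun (g a) (normalOp G) (ContinuousLinearMap.adjoint G y))‖ ≤ ‖y‖ := by
  simpa using norm_comp_opFun_adjoint_apply_le hG le_rfl (hg.continuousOn a ha)
    (hg.nonneg a ha) zero_le_one (hg.mul_le_one ha) y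

lemma norm_sub_comp_adjoint_apply_le (hg : IsFilterFamily g c₀ c₁ c₂ c₃ c₄)
    (hG : ‖G‖ ^ 2 ≤ 1 / 2) (ha : 0 < a) (y : Y) :
    ‖y - G (opFun (g a) (normalOp G) (ContinuousLinearMap.adjoint G y))‖ ≤ ‖y‖ :=
  norm_sub_comp_opFun_adjoint_apply_le hG le_rfl (hg.continuousOn a ha)
    (hg.nonneg a ha) (hg.mul_le_one ha) y

lemma norm_normalOp_apply_le (hg : IsFilterFamily g c₀ c₁ c₂ c₃ c₄)
    (hG : ‖G‖ ^ 2 ≤ 1 / 2) (ha : 0 < a) (x : X) :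
    ‖opFun (g a) (normalOp G) (ContinuousLinearMap.adjoint G (G x))‖ ≤ ‖x‖ := by
  have hT := spectrumIn_normalOp hG
  have e : opFun (g a) (normalOp G) (ContinuousLinearMap.adjoint G (G x))
      = opFun (fun t => g a t * t) (normalOp G) x := by
    rw [← opFun_mul_apply hT le_rfl (hg.continuousOn a ha) continuousOn_self, opFun_id hT le_rfl]
    rfl
  rw [e]
  simpa using norm_opFun_apply_le hT le_rfl (f := fun t => g a t * t)
    ((hg.continuousOn a ha).mul continuousOn_self)
    zero_le_one (fun t ht => by
      rw [abs_of_nonneg (mul_nonneg (hg.nonneg a ha t ht) ht.1), mul_comm]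
      exact hg.mul_le_one ha t ht) x

lemma norm_comp_residual_apply_le_self (hg : IsFilterFamily g c₀ c₁ c₂ c₃ c₄)
    (hG : ‖G‖ ^ 2 ≤ 1 / 2) (ha : 0 < a) (x : X) :
    ‖G (opFun (residual g a) (normalOp G) x)‖ ≤ ‖G x‖ := by
  have := norm_comp_opFun_apply_mono hG le_rfl (hg.residual_continuousOn ha)
    (h := fun _ => 1) continuousOn_const zero_le_one
    (fun t ht => by simpa using hg.abs_residual_le_one ha t ht) x
  rw [opFun_one (spectrumIn_normalOp hG) le_rfl] at this
  simpa using this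

lemma norm_residual_residual_apply_le (hg : IsFilterFamily g c₀ c₁ c₂ c₃ c₄)
    {b : ℝ} (hG : ‖G‖ ^ 2 ≤ 1 / 2) (ha : 0 < a) (hb : 0 < b)
    (x : X) :
    ‖opFun (residual g a) (normalOp G) (opFun (residual g b) (normalOp G) x)‖
      ≤ ‖opFun (residual g a) (normalOp G) x‖ := by
  rw [opFun_comm_apply (spectrumIn_normalOp hG) le_rfl (hg.residual_continuousOn ha)
    (hg.residual_continuousOn hb)]
  exact hg.norm_residual_apply_le hG hb _

lemma abs_residual_mono (hg : IsFilterFamily g c₀ c₁ c₂ c₃ c₄)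
    {b c : ℝ} (ha : 0 < a) (hb : 0 < b)
    (h : ∀ t ∈ Set.Icc (0 : ℝ) (1 / 2), residual g a t ≤ c * residual g b t) :
    ∀ t ∈ Set.Icc (0 : ℝ) (1 / 2), |residual g a t| ≤ c * |residual g b t| := by
  intro t ht
  rw [abs_of_pos (hg.residual_pos a ha t ht), abs_of_pos (hg.residual_pos b hb t ht)]
  exact h t ht

lemma norm_residual_apply_mono (hg : IsFilterFamily g c₀ c₁ c₂ c₃ c₄)
    {b : ℝ} (hG : ‖G‖ ^ 2 ≤ 1 / 2) (ha : 0 < a) (hab : a ≤ b) (x : X) :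
    ‖opFun (residual g a) (normalOp G) x‖ ≤ ‖opFun (residual g b) (normalOp G) x‖ := by
  have hb := ha.trans_le hab
  simpa using norm_opFun_apply_mono (spectrumIn_normalOp hG) le_rfl (hg.residual_continuousOn ha)
    (hg.residual_continuousOn hb) zero_le_one (hg.abs_residual_mono ha hb
      (fun t ht => by simpa using hg.residual_mono a b ha hab t ht)) x

lemma norm_residual_apply_le_mul (hg : IsFilterFamily g c₀ c₁ c₂ c₃ c₄)
    {b c : ℝ} (hc : 0 ≤ c) (hG : ‖G‖ ^ 2 ≤ 1 / 2) (ha : 0 < a)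
    (hb : 0 < b) (h : ∀ t ∈ Set.Icc (0 : ℝ) (1 / 2), residual g a t ≤ c * residual g b t) (x : X) :
    ‖opFun (residual g a) (normalOp G) x‖ ≤ c * ‖opFun (residual g b) (normalOp G) x‖ :=
  norm_opFun_apply_mono (spectrumIn_normalOp hG) le_rfl (hg.residual_continuousOn ha)
    (hg.residual_continuousOn hb) hc (hg.abs_residual_mono ha hb h) x

lemma norm_comp_residual_apply_le_mul (hg : IsFilterFamily g c₀ c₁ c₂ c₃ c₄)
    {b c : ℝ} (hc : 0 ≤ c) (hG : ‖G‖ ^ 2 ≤ 1 / 2) (ha : 0 < a)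
    (hb : 0 < b) (h : ∀ t ∈ Set.Icc (0 : ℝ) (1 / 2), residual g a t ≤ c * residual g b t) (x : X) :
    ‖G (opFun (residual g a) (normalOp G) x)‖
      ≤ c * ‖G (opFun (residual g b) (normalOp G) x)‖ :=
  norm_comp_opFun_apply_mono hG le_rfl (hg.residual_continuousOn ha)
    (hg.residual_continuousOn hb) hc (hg.abs_residual_mono ha hb h) x

lemma one_le_mul_abs_residual {b : ℝ} (hr : ∀ t ∈ Set.Icc (0 : ℝ) b, 3 / 4 ≤ residual g a t) :
    ∀ t ∈ Set.Icc (0 : ℝ) b, |(1 : ℝ)| ≤ 4 / 3 * |residual g a t| := by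
  intro t ht
  have := hr t ht
  rw [abs_one, abs_of_pos (by linarith)]
  linarith

/-- On the spectrum r_a is at least 3/4, so r_a(G*G) can be undone at the cost of 4/3. This starts
the inductions at k = 0, where the iterate is the initial guess itself. -/
lemma norm_le_mul_residual (hg : IsFilterFamily g c₀ c₁ c₂ c₃ c₄)
    {b : ℝ} (hb : b ≤ 1 / 2) (hG : ‖G‖ ^ 2 ≤ b) (ha : 0 < a)
    (hr : ∀ t ∈ Set.Icc (0 : ℝ) b, 3 / 4 ≤ residual g a t) (x : X) :
    ‖x‖ ≤ 4 / 3 * ‖opFun (residual g a) (normalOp G) x‖ := by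
  have := norm_opFun_apply_mono (spectrumIn_normalOp hG) hb (f := fun _ => 1) continuousOn_const
    (hg.residual_continuousOn ha) (by norm_num) (one_le_mul_abs_residual hr) x
  rwa [opFun_one (spectrumIn_normalOp hG) hb] at this

lemma norm_comp_le_mul_residual (hg : IsFilterFamily g c₀ c₁ c₂ c₃ c₄)
    {b : ℝ} (hb : b ≤ 1 / 2) (hG : ‖G‖ ^ 2 ≤ b) (ha : 0 < a)
    (hr : ∀ t ∈ Set.Icc (0 : ℝ) b, 3 / 4 ≤ residual g a t) (x : X) :
    ‖G x‖ ≤ 4 / 3 * ‖G (opFun (residual g a) (normalOp G) x)‖ := by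
  have := norm_comp_opFun_apply_mono hG hb (f := fun _ => 1) continuousOn_const
    (hg.residual_continuousOn ha) (by norm_num) (one_le_mul_abs_residual hr) x
  rwa [opFun_one (spectrumIn_normalOp hG) hb] at this

/-- Interpolation: 0 < r ≤ 1 and ν ≤ 1 give r ≤ r^ν, hence r t^ν ≤ (r t)^ν ≤ (c₀ α)^ν. -/
lemma hasOrder_of_le_one (hg : IsFilterFamily g c₀ c₁ c₂ c₃ c₄)
    {ν : ℝ≥0} (hν : ν ≤ 1) : HasOrder g ν := by
  have hν' : (ν : ℝ) ≤ 1 := hν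
  refine ⟨c₀ ^ (ν : ℝ), Real.rpow_pos_of_pos hg.c₀_pos _, fun α hα t ht => ?_⟩
  have h1 := hg.residual_pos α hα t ht
  have h2 := hg.residual_le_one α hα t ht
  rw [← Real.mul_rpow hg.c₀_pos.le hα.le]
  calc residual g α t * t ^ (ν : ℝ) ≤ residual g α t ^ (ν : ℝ) * t ^ (ν : ℝ) := by
        gcongr
        · exact Real.rpow_nonneg ht.1 _
        · exact Real.self_le_rpow_of_le_one h1.le h2 hν'
    _ = (residual g α t * t) ^ (ν : ℝ) := (Real.mul_rpow h1.le ht.1).symm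
    _ ≤ _ := Real.rpow_le_rpow (mul_nonneg h1.le ht.1) (hg.residual_mul_le α hα t ht) ν.2

/-- This makes the exponent ν = 0 admissible without further assumptions, since 1/2 < 1. -/
lemma one_le_qualification (hg : IsFilterFamily g c₀ c₁ c₂ c₃ c₄)
    {q : ℝ≥0∞} (hq : IsQualification g q) : 1 ≤ q :=
  hq.2 fun _ hν => hg.hasOrder_of_le_one (by exact_mod_cast hν)

end IsFilterFamily

/-- A vector x orthogonal to the range of G*G satisfies 0 = ⟨G*Gx, x⟩ = ‖Gx‖²; take orthogonal
complements. -/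
lemma orthogonal_ker_le_closure_range (G : X →L[𝕜] Y) :
    ((LinearMap.ker G.toLinearMap)ᗮ : Set X) ⊆ closure (Set.range (normalOp G)) := by
  have hk : (LinearMap.range (normalOp G).toLinearMap)ᗮ ≤ LinearMap.ker G.toLinearMap := by
    intro x hx
    rw [Submodule.mem_orthogonal] at hx
    have h0 := hx _ ⟨x, rfl⟩
    have h1 : inner 𝕜 (normalOp G x) x = (0 : 𝕜) := h0
    rw [inner_normalOp, inner_self_eq_zero] at h1
    exact h1
  have h2 := Submodule.orthogonal_le hk
  rw [Submodule.orthogonal_orthogonal_eq_closure] at h2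
  intro x hx
  have := h2 hx
  exact this

lemma continuousOn_rpow_mul {s : ℝ} (hs : 0 ≤ s) {f : ℝ → ℝ}
    (hf : ContinuousOn f (Set.Icc 0 (1 / 2))) :
    ContinuousOn (fun t => t ^ s * f t) (Set.Icc 0 (1 / 2)) :=
  (Real.continuous_rpow_const hs).continuousOn.mul hf

/-- Below the qualification, `r_α(A) A^s ω = o(α^s)` for `ω ∈ N(G)ᗮ`, `A = G* G`. -/
lemma isLittleO_rpow_mul_residual (hg : IsFilterFamily g c₀ c₁ c₂ c₃ c₄)
    {q : ℝ≥0∞}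
    (hq : IsQualification g q) (hG : ‖G‖ ^ 2 ≤ 1 / 2) {s : ℝ} (hs : 0 ≤ s)
    (hsq : ENNReal.ofReal s < q) {ω : X} (hω : ω ∈ (LinearMap.ker G.toLinearMap)ᗮ)
    {α : ℕ → ℝ} (hα : ∀ k, 0 < α k) (hα0 : Tendsto α atTop (𝓝 0)) {ε : ℝ} (hε : 0 < ε) :
    ∀ᶠ k in atTop, ‖opFun (fun t => t ^ s * residual g (α k) t) (normalOp G) ω‖ ≤ ε * α k ^ s := by
  have hT := spectrumIn_normalOp hG
  -- θ is spare room between s and the qualification, capped at 1 so that t ≤ t^θ on [0, 1/2].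
  obtain ⟨θ, hθ0, hθ1, hθq⟩ : ∃ θ : ℝ, 0 < θ ∧ θ ≤ 1 ∧ ENNReal.ofReal (s + θ) ≤ q := by
    obtain ⟨z, hz1, hz2⟩ := ENNReal.lt_iff_exists_nnreal_btwn.1 hsq
    have hz1' : s < z := by
      rw [ENNReal.ofReal, ENNReal.coe_lt_coe] at hz1
      exact (Real.toNNReal_lt_iff_lt_coe hs).1 hz1
    refine ⟨min 1 (z - s), lt_min one_pos (by linarith), min_le_left _ _, le_trans ?_ hz2.le⟩
    rw [ENNReal.ofReal_le_iff_le_toReal ENNReal.coe_ne_top, ENNReal.coe_toReal]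
    linarith [min_le_right 1 ((z : ℝ) - s)]
  obtain ⟨d, hd, hdo⟩ := hq.1 s.toNNReal (le_trans (ENNReal.ofReal_le_ofReal (by linarith)) hθq)
  obtain ⟨d', hd', hdo'⟩ := hq.1 (s + θ).toNNReal hθq
  simp only [Real.coe_toNNReal _ hs] at hdo
  simp only [Real.coe_toNNReal _ (add_nonneg hs hθ0.le)] at hdo'
  -- Replace ω by G*Gη: the error contributes at most (ε/2) α^s, and on G*Gη the extra factor t
  -- improves the order to α^{s+θ}.
  obtain ⟨_, ⟨η, rfl⟩, hη⟩ := Metric.mem_closure_iff.1 (orthogonal_ker_le_closure_range G hω)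
    (ε / (2 * d)) (by positivity)
  rw [dist_eq_norm] at hη
  have hlim : Tendsto (fun k => d' * ‖η‖ * α k ^ θ) atTop (𝓝 0) := by
    have := (hα0.rpow_const (Or.inr hθ0.le)).const_mul (d' * ‖η‖)
    rwa [Real.zero_rpow hθ0.ne', mul_zero] at this
  filter_upwards [hlim.eventually_le_const (half_pos hε)] with k hk
  have hrc := hg.residual_continuousOn (hα k)
  have hfc := continuousOn_rpow_mul hs hrc
  have hpos : ∀ t ∈ Set.Icc (0 : ℝ) (1 / 2), 0 ≤ t ^ s * residual g (α k) t := fun t ht =>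
    mul_nonneg (Real.rpow_nonneg ht.1 _) (hg.residual_pos _ (hα k) t ht).le
  have h1 := norm_opFun_apply_le hT le_rfl hfc (M := d * α k ^ s)
    (mul_nonneg hd.le (Real.rpow_nonneg (hα k).le _))
    (fun t ht => by
      rw [abs_of_nonneg (hpos t ht), mul_comm]
      exact hdo _ (hα k) t ht) (ω - normalOp G η)
  have h2 : ‖opFun (fun t => t ^ s * residual g (α k) t) (normalOp G) (normalOp G η)‖
      ≤ d' * α k ^ (s + θ) * ‖η‖ := by
    have e : opFun (fun t => t ^ s * residual g (α k) t) (normalOp G) (normalOp G η)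
        = opFun (fun t => (t ^ s * residual g (α k) t) * t) (normalOp G) η := by
      rw [← opFun_mul_apply hT le_rfl hfc continuousOn_self, opFun_id hT le_rfl]
    rw [e]
    refine norm_opFun_apply_le hT le_rfl (hfc.mul continuousOn_self)
      (mul_nonneg hd'.le (Real.rpow_nonneg (hα k).le _)) (fun t ht => ?_) η
    have hp := hpos t ht
    change |t ^ s * residual g (α k) t * t| ≤ _
    rw [abs_of_nonneg (mul_nonneg hp ht.1)]
    refine le_trans ?_ (hdo' _ (hα k) t ht)
    rw [Real.rpow_add_of_nonneg ht.1 hs hθ0.le]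
    have : t ≤ t ^ θ := Real.self_le_rpow_of_le_one ht.1 (ht.2.trans (by norm_num)) hθ1
    calc _ ≤ (t ^ s * residual g (α k) t) * t ^ θ := mul_le_mul_of_nonneg_left this hp
      _ = _ := by ring
  have hαs : 0 ≤ α k ^ s := Real.rpow_nonneg (hα k).le _
  calc ‖opFun (fun t => t ^ s * residual g (α k) t) (normalOp G) ω‖
      = ‖opFun (fun t => t ^ s * residual g (α k) t) (normalOp G) (ω - normalOp G η)
        + opFun (fun t => t ^ s * residual g (α k) t) (normalOp G) (normalOp G η)‖ := by
        rw [← map_add, sub_add_cancel]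
    _ ≤ d * α k ^ s * (ε / (2 * d)) + d' * α k ^ (s + θ) * ‖η‖ := by
        refine (norm_add_le _ _).trans (add_le_add (h1.trans ?_) h2)
        gcongr
    _ = ε / 2 * α k ^ s + d' * ‖η‖ * α k ^ θ * α k ^ s := by
        rw [Real.rpow_add (hα k)]
        field_simp
    _ ≤ ε / 2 * α k ^ s + ε / 2 * α k ^ s := by gcongr
    _ = ε * α k ^ s := by ring

end FilterFamily

/-! ### Parameter sequences, balancing, stopping and scalar recursions -/

section Sequences

namespace IsParameterSequence

lemma antitone {α : ℕ → ℝ} {r : ℝ} (hα : IsParameterSequence α r) : Antitone α :=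
  antitone_nat_of_succ_le fun k => by
    have := hα.one_le_ratio k
    rwa [one_le_div (hα.pos _)] at this

lemma le_mul {α : ℕ → ℝ} {r : ℝ} (hα : IsParameterSequence α r) (k : ℕ) :
    α k ≤ r * α (k + 1) := by
  have := hα.ratio_le k
  rwa [div_le_iff₀ (hα.pos _)] at this

lemma sqrt_le_mul {α : ℕ → ℝ} {r : ℝ} (hα : IsParameterSequence α r) (hr : 0 ≤ r) (k : ℕ) :
    √(α k) ≤ √r * √(α (k + 1)) := by
  rw [← Real.sqrt_mul hr]
  exact Real.sqrt_le_sqrt (hα.le_mul k)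

lemma sqrt_pos {α : ℕ → ℝ} {r : ℝ} (hα : IsParameterSequence α r) (k : ℕ) : 0 < √(α k) :=
  Real.sqrt_pos.2 (hα.pos k)

lemma div_sqrt_mono {α : ℕ → ℝ} {r δ : ℝ} (hα : IsParameterSequence α r) (hδ : 0 ≤ δ) {k m : ℕ}
    (hkm : k ≤ m) : δ / √(α k) ≤ δ / √(α m) :=
  div_le_div_of_nonneg_left hδ (hα.sqrt_pos m) (Real.sqrt_le_sqrt (hα.antitone hkm))

/-- The first index at which `α` falls below a level. -/
lemma exists_first_le {α : ℕ → ℝ} {r β : ℝ} (hα : IsParameterSequence α r) (hβ : 0 < β) {K : ℕ}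
    (hK : β < α K) : ∃ k, K ≤ k ∧ α k ≤ β ∧ β ≤ r * α k := by
  classical
  have hex : ∃ k, α k ≤ β := (hα.tendsto_zero.eventually_le_const hβ).exists
  have hlt : K < Nat.find hex := by
    by_contra h
    exact absurd ((hα.antitone (not_lt.1 h)).trans (Nat.find_spec hex)) (not_le.2 hK)
  obtain ⟨m, hm⟩ := Nat.exists_eq_succ_of_ne_zero (Nat.ne_zero_of_lt hlt)
  refine ⟨Nat.find hex, hlt.le, Nat.find_spec hex, ?_⟩
  have h1 : β < α m := not_le.1 (Nat.find_min hex (by omega))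
  rw [hm]
  exact h1.le.trans (hα.le_mul m)

end IsParameterSequence

/-- Balancing of the approximation error `φ` against the propagated noise `δ / √α`. -/
lemma isLittleO_of_balanced_bounds {X : Type*} [NormedAddCommGroup X] {α : ℕ → ℝ} {r : ℝ}
    (hα : IsParameterSequence α r) (hr : 1 < r) {ν : ℝ} (hν : 0 ≤ ν) {φ ψ : ℕ → ℝ}
    (hφ : Antitone φ) (hφo : ∀ ε > 0, ∀ᶠ k in atTop, φ k ≤ ε * α k ^ ν)
    (hψo : ∀ ε > 0, ∀ᶠ k in atTop, ψ k ≤ ε * α k ^ (ν + 1 / 2))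
    {e : ℝ → X} {l : ℝ → ℕ} {C c : ℝ} (hC : 0 ≤ C) (hc : c = 0 ∨ 1 / 2 ≤ ν)
    (h : ∀ᶠ δ in 𝓝[>] (0 : ℝ), ‖e δ‖ ≤ C * (φ (l δ) + δ / √(α (l δ))) ∧
      (2 ≤ l δ → δ ≤ C * ψ (l δ)) ∧
      ∀ m, l δ ≤ m → c * δ ≤ α m → ‖e δ‖ ≤ C * (φ m + δ / √(α m))) :
    e =o[𝓝[>] (0 : ℝ)] fun δ : ℝ => δ ^ (2 * ν / (1 + 2 * ν)) := by
  have hr0 : 0 < r := one_pos.trans hr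
  -- At α = (Mδ)^{2κ} both α^ν and δ/√α are of the order δ^a.
  set κ : ℝ := 1 / (1 + 2 * ν) with hκ
  set a : ℝ := 2 * ν / (1 + 2 * ν) with ha
  have hden : 0 < 1 + 2 * ν := by linarith
  have hκ0 : 0 < κ := by positivity
  have ha0 : 0 ≤ a := by positivity
  have haκ : a + κ = 1 := by rw [ha, hκ]; field_simp; ring
  have h2κν : 2 * κ * ν = a := by rw [ha, hκ]; field_simp
  have hνκ : (ν + 1 / 2) * κ = 1 / 2 := by rw [hκ]; field_simp; ring
  refine isLittleO_iff.2 fun {ε₀} hε₀ => ?_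
  -- A large M makes the noise term a small multiple of δ^a; M ≥ r c will guarantee cδ ≤ α k. Only
  -- after M is fixed is ε₁ chosen, against the factor M^a.
  obtain ⟨M, hM1, hMc, hMε⟩ : ∃ M : ℝ, 1 ≤ M ∧ r * c ≤ M ∧ C * √r * M ^ (-κ) ≤ ε₀ / 2 := by
    have hlim : Tendsto (fun M : ℝ => C * √r * M ^ (-κ)) atTop (𝓝 0) := by
      simpa using (tendsto_rpow_neg_atTop hκ0).const_mul (C * √r)
    exact ((eventually_ge_atTop (1 : ℝ)).and ((eventually_ge_atTop (r * c)).and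
      (hlim.eventually_le_const (half_pos hε₀)))).exists
  have hM0 : 0 < M := one_pos.trans_le hM1
  obtain ⟨ε₁, hε₁, hε₁a, hε₁b⟩ : ∃ ε₁ : ℝ, 0 < ε₁ ∧ C * (ε₁ * M ^ a) ≤ ε₀ / 2 ∧
      C * (C * ε₁) ^ κ ≤ ε₀ / 2 := by
    have hlim1 : Tendsto (fun ε : ℝ => C * (ε * M ^ a)) (𝓝[>] 0) (𝓝 0) := by
      have : Continuous fun ε : ℝ => C * (ε * M ^ a) := by fun_prop
      simpa using (this.tendsto 0).mono_left nhdsWithin_le_nhds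
    have hlim2 : Tendsto (fun ε : ℝ => C * (C * ε) ^ κ) (𝓝[>] 0) (𝓝 0) := by
      have : Continuous fun ε : ℝ => C * (C * ε) ^ κ :=
        continuous_const.mul ((continuous_const.mul continuous_id).rpow_const
          fun _ => Or.inr hκ0.le)
      have h0 := (this.tendsto 0).mono_left (nhdsWithin_le_nhds (s := Set.Ioi 0))
      simpa [Real.zero_rpow hκ0.ne'] using h0
    have hpos : ∀ᶠ ε in 𝓝[>] (0 : ℝ), 0 < ε := self_mem_nhdsWithin
    exact (hpos.and
      ((hlim1.eventually_le_const (half_pos hε₀)).and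
        (hlim2.eventually_le_const (half_pos hε₀)))).exists
  obtain ⟨K₀, hK₀⟩ := eventually_atTop.1 ((hφo ε₁ hε₁).and (hψo ε₁ hε₁))
  -- The bound of δ by ψ is available only from index 2 on.
  set K := max K₀ 2 with hK
  have hlimβ : Tendsto (fun δ : ℝ => (M * δ) ^ (2 * κ)) (𝓝[>] 0) (𝓝 0) := by
    have : Continuous fun δ : ℝ => (M * δ) ^ (2 * κ) :=
      (continuous_const.mul continuous_id).rpow_const fun _ => Or.inr (by positivity)
    have h0 := (this.tendsto 0).mono_left (nhdsWithin_le_nhds (s := Set.Ioi 0))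
    simpa [Real.zero_rpow (mul_pos two_pos hκ0).ne'] using h0
  have hlimM : Tendsto (fun δ : ℝ => M * δ) (𝓝[>] 0) (𝓝 0) := by
    have : Continuous fun δ : ℝ => M * δ := by fun_prop
    simpa using (this.tendsto 0).mono_left nhdsWithin_le_nhds
  filter_upwards [h, self_mem_nhdsWithin, hlimβ.eventually_lt_const (hα.pos K),
    hlimM.eventually_le_const one_pos] with δ hδ hδ0 hδK hδM
  obtain ⟨h1, h2, h3⟩ := hδ
  have hδ0 : 0 < δ := hδ0
  have hMδ : 0 < M * δ := by positivity
  set β := (M * δ) ^ (2 * κ) with hβ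
  have hβ0 : 0 < β := Real.rpow_pos_of_pos hMδ _
  obtain ⟨k, hKk, hk1, hk2⟩ := hα.exists_first_le hβ0 hδK
  have hδa : 0 < δ ^ a := Real.rpow_pos_of_pos hδ0 _
  rw [Real.norm_of_nonneg hδa.le]
  have hφk : φ k ≤ ε₁ * M ^ a * δ ^ a := by
    calc φ k ≤ ε₁ * α k ^ ν := (hK₀ k ((le_max_left _ _).trans hKk)).1
      _ ≤ ε₁ * β ^ ν := by gcongr; exact (hα.pos k).le
      _ = _ := by rw [hβ, ← Real.rpow_mul hMδ.le, h2κν, Real.mul_rpow hM0.le hδ0.le]; ring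
  have hδs : δ = δ ^ a * δ ^ κ := by rw [← Real.rpow_add hδ0, haκ, Real.rpow_one]
  -- Stopping before the a priori index k: use the error bound at the later index k. Stopping after
  -- it: φ is even smaller, and the bound of δ by ψ controls the noise term.
  rcases le_or_gt (l δ) k with hlk | hlk
  · have hcα : c * δ ≤ α k := by
      rcases hc with hc | hc
      · rw [hc, zero_mul]; exact (hα.pos k).le
      -- Here ν ≥ 1/2 enters: it gives 2κ ≤ 1, so the level β = (Mδ)^{2κ} is at least Mδ.
      · have h2κ : 2 * κ ≤ 1 := by rw [hκ, mul_one_div, div_le_one hden]; linarith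
        have hβM : M * δ ≤ β := by
          have := Real.rpow_le_rpow_of_exponent_ge hMδ hδM h2κ
          rwa [Real.rpow_one] at this
        have h4 : r * c * δ ≤ M * δ := by gcongr
        have h5 : r * (c * δ) ≤ r * α k := by linarith
        exact le_of_mul_le_mul_left h5 hr0
    have hnoise : δ / √(α k) ≤ √r * M ^ (-κ) * δ ^ a := by
      have hsβ : √β = M ^ κ * δ ^ κ := by
        rw [Real.sqrt_eq_rpow, hβ, ← Real.rpow_mul hMδ.le, ← Real.mul_rpow hM0.le hδ0.le]
        congr 1; ring
      have h6 : M ^ κ * δ ^ κ ≤ √r * √(α k) := by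
        rw [← hsβ, ← Real.sqrt_mul hr0.le]; exact Real.sqrt_le_sqrt hk2
      rw [div_le_iff₀ (hα.sqrt_pos k)]
      have hMκ : M ^ (-κ) * M ^ κ = 1 := by rw [← Real.rpow_add hM0]; simp
      calc δ = M ^ (-κ) * δ ^ a * (M ^ κ * δ ^ κ) := by
            rw [show M ^ (-κ) * δ ^ a * (M ^ κ * δ ^ κ)
              = (M ^ (-κ) * M ^ κ) * (δ ^ a * δ ^ κ) by ring, hMκ, one_mul, ← hδs]
        _ ≤ M ^ (-κ) * δ ^ a * (√r * √(α k)) := by gcongr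
        _ = _ := by ring
    calc ‖e δ‖ ≤ C * (φ k + δ / √(α k)) := h3 k hlk hcα
      _ ≤ C * (ε₁ * M ^ a * δ ^ a + √r * M ^ (-κ) * δ ^ a) := by gcongr
      _ = (C * (ε₁ * M ^ a) + C * √r * M ^ (-κ)) * δ ^ a := by ring
      _ ≤ (ε₀ / 2 + ε₀ / 2) * δ ^ a := by gcongr
      _ = ε₀ * δ ^ a := by ring
  · have hKl : K ≤ l δ := hKk.trans hlk.le
    have h7 : δ ≤ C * ε₁ * α (l δ) ^ (ν + 1 / 2) := by
      calc δ ≤ C * ψ (l δ) := h2 ((le_max_right _ _).trans hKl)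
        _ ≤ C * (ε₁ * α (l δ) ^ (ν + 1 / 2)) := by
          gcongr; exact (hK₀ _ ((le_max_left _ _).trans hKl)).2
        _ = _ := by ring
    have hnoise : δ / √(α (l δ)) ≤ (C * ε₁) ^ κ * δ ^ a := by
      rw [div_le_iff₀ (hα.sqrt_pos _)]
      have h8 : δ ^ κ ≤ (C * ε₁) ^ κ * √(α (l δ)) := by
        calc δ ^ κ ≤ (C * ε₁ * α (l δ) ^ (ν + 1 / 2)) ^ κ := by gcongr
          _ = _ := by
            rw [Real.mul_rpow (by positivity) (Real.rpow_nonneg (hα.pos _).le _),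
              ← Real.rpow_mul (hα.pos _).le, hνκ, ← Real.sqrt_eq_rpow]
      calc δ = δ ^ a * δ ^ κ := hδs
        _ ≤ δ ^ a * ((C * ε₁) ^ κ * √(α (l δ))) := by gcongr
        _ = _ := by ring
    calc ‖e δ‖ ≤ C * (φ (l δ) + δ / √(α (l δ))) := h1
      _ ≤ C * (ε₁ * M ^ a * δ ^ a + (C * ε₁) ^ κ * δ ^ a) := by
        gcongr; exact (hφ hlk.le).trans hφk
      _ = (C * (ε₁ * M ^ a) + C * (C * ε₁) ^ κ) * δ ^ a := by ring
      _ ≤ (ε₀ / 2 + ε₀ / 2) * δ ^ a := by gcongr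
      _ = ε₀ * δ ^ a := by ring

/-- A discrepancy principle stops as long as the a priori bound `P` propagates until the weights
`w` reach the noise level. -/
lemma exists_stopping {P : ℕ → Prop} {ρ w : ℕ → ℝ} {δ γ τ a r : ℝ} (hδ : 0 < δ) (ha : 0 ≤ a)
    (hwpos : ∀ k, 0 ≤ w k) (hw : Tendsto w atTop (𝓝 0)) (hwr : ∀ k, w k ≤ r * w (k + 1))
    (hw0 : δ < γ * w 0) (hP0 : P 0) (hP : ∀ k, P k → δ < γ * w k → P (k + 1))
    (hρ : ∀ k, P k → P (k + 1) → δ < γ * w k → ρ (k + 1) ≤ δ + a * w k)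
    (har : a * r ≤ (τ - 1) * γ) (hτ : 1 < τ) :
    ∃ k, ρ k ≤ τ * δ ∧ (∀ j < k, τ * δ < ρ j) ∧ (∀ j ≤ k, P j) ∧ ∀ j < k, δ < γ * w j := by
  classical
  -- The first index at which the weight reaches the noise level; it is positive by `hw0` and bounds
  -- the stopping index from above.
  have hex : ∃ k, γ * w k ≤ δ := by
    have : Tendsto (fun k => γ * w k) atTop (𝓝 0) := by simpa using hw.const_mul γ
    exact (this.eventually_le_const hδ).exists
  have hlt : ∀ j < Nat.find hex, δ < γ * w j := fun j hj => not_le.1 (Nat.find_min hex hj)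
  have hPall : ∀ j ≤ Nat.find hex, P j := by
    intro j
    induction j with
    | zero => exact fun _ => hP0
    | succ j ih => exact fun hj => hP j (ih (by omega)) (hlt j (by omega))
  have hne : Nat.find hex ≠ 0 := fun h => by
    have := Nat.find_spec hex
    rw [h] at this
    linarith
  obtain ⟨m, hm⟩ := Nat.exists_eq_succ_of_ne_zero hne
  -- ρ (m+1) ≤ δ + a w_m ≤ δ + a r w_{m+1} ≤ δ + (τ − 1)γ w_{m+1} ≤ τδ.
  have hm_le : ρ (m + 1) ≤ τ * δ := by
    have h1 := hρ m (hPall m (by omega)) (hPall (m + 1) (by omega)) (hlt m (by omega))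
    have h2 := Nat.find_spec hex
    rw [hm] at h2
    have h3 : a * w m ≤ a * (r * w (m + 1)) := mul_le_mul_of_nonneg_left (hwr m) ha
    nlinarith [mul_le_mul_of_nonneg_right har (hwpos (m + 1)), mul_le_mul_of_nonneg_left h2
      (sub_nonneg.2 hτ.le)]
  have hex' : ∃ k, ρ k ≤ τ * δ := ⟨_, hm_le⟩
  have hle : Nat.find hex' ≤ Nat.find hex := by
    rw [hm]
    exact Nat.find_min' hex' hm_le
  exact ⟨Nat.find hex', Nat.find_spec hex', fun j hj => not_le.1 (Nat.find_min hex' hj),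
    fun j hj => hPall j (hj.trans hle), fun j hj => hlt j (hj.trans_le hle)⟩

/-- Induction step for E ≤ C(φ + d). Passing from φ to φ' loses the factor c₅, but ε c₅ ≤ 1/2 makes
the feedback εE cost only half of C, and C ≥ 2c₅, C ≥ 2c pay for the rest. -/
lemma error_bound_step {C c c₅ ε E E' φ φ' d d' : ℝ} (hφ : 0 ≤ φ) (hd : 0 ≤ d)
    (hc₅ : 1 ≤ c₅) (hε : 0 ≤ ε) (hεc : ε * c₅ ≤ 1 / 2) (hC₅ : 2 * c₅ ≤ C) (hCc : 2 * c ≤ C)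
    (hE : E ≤ C * (φ + d)) (hE' : E' ≤ φ + ε * E + c * d) (hφ' : φ ≤ c₅ * φ') (hd' : d ≤ d') :
    E' ≤ C * (φ' + d') := by
  have hC : 0 ≤ C := by linarith
  have hε2 : ε ≤ 1 / 2 := by nlinarith
  have h1 : E' ≤ (1 + ε * C) * φ + (ε * C + c) * d := by
    nlinarith [mul_le_mul_of_nonneg_left hE hε]
  have h2 : (1 + ε * C) * φ ≤ C * φ' := by
    have h3 : (1 + ε * C) * φ ≤ (1 + ε * C) * (c₅ * φ') :=
      mul_le_mul_of_nonneg_left hφ' (by positivity)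
    have hφ'0 : 0 ≤ φ' := by
      by_contra h
      nlinarith
    have h4 : (1 + ε * C) * c₅ ≤ C := by nlinarith
    nlinarith [mul_le_mul_of_nonneg_right h4 hφ'0]
  have h5 : (ε * C + c) * d ≤ C * d' := by
    have h6 : ε * C + c ≤ C := by nlinarith
    calc (ε * C + c) * d ≤ C * d := by gcongr
      _ ≤ C * d' := by gcongr
  linarith

/-- Absorption: the two hypotheses bound E by C(E' + εE + (c+1)d), and 4Cε ≤ 1 lets εE be moved to
the left. Thus the previous error is controlled by the current one up to noise. -/
lemma mul_prev_error_le {C c ε E E' φ d : ℝ} (hC : 0 ≤ C) (hε : 0 ≤ ε) (hCε : 4 * C * ε ≤ 1)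
    (hE0 : 0 ≤ E) (hE0' : 0 ≤ E') (hd : 0 ≤ d) (hc : 0 ≤ c) (hE : E ≤ C * (φ + d))
    (hφ : φ ≤ E' + (ε * E + c * d)) : ε * E ≤ E' / 2 + (c + 1) * d := by
  have h1 : C * (φ + d) ≤ C * (E' + ε * E + (c + 1) * d) :=
    mul_le_mul_of_nonneg_left (by linarith) hC
  have h2 : ε * E ≤ ε * (C * (E' + ε * E + (c + 1) * d)) :=
    mul_le_mul_of_nonneg_left (hE.trans h1) hε
  have h3 : 0 ≤ E' + ε * E + (c + 1) * d := by positivity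
  have h4 : ε * (C * (E' + ε * E + (c + 1) * d)) ≤ 1 / 4 * (E' + ε * E + (c + 1) * d) := by
    rw [← mul_assoc]
    exact mul_le_mul_of_nonneg_right (by linarith) h3
  have h6 : 0 ≤ (c + 1) * d := by positivity
  linarith

/-- Used to satisfy finitely many smallness conditions on η at once. -/
lemma eventually_mul_le (K : ℝ) {a : ℝ} (ha : 0 < a) : ∀ᶠ η in 𝓝[>] (0 : ℝ), η * K ≤ a := by
  have h : Continuous fun η : ℝ => η * K := by fun_prop
  have := (h.tendsto 0).mono_left (nhdsWithin_le_nhds (s := Set.Ioi 0))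
  rw [zero_mul] at this
  exact this.eventually_le_const ha

end Sequences

/-! ### The linear method with exact data, and rates for its perturbations -/

section LinearQuantities

variable {𝕜 X Y : Type*} [RCLike 𝕜]
  [NormedAddCommGroup X] [InnerProductSpace 𝕜 X] [CompleteSpace X]
  [NormedAddCommGroup Y] [InnerProductSpace 𝕜 Y] [CompleteSpace Y]

/-- The error `‖r_{α_k}(T* T) x‖` of the linear method with exact data. -/
noncomputable def linearError (g : ℝ → ℝ → ℝ) (α : ℕ → ℝ) (T : X →L[𝕜] Y) (x : X) (k : ℕ) : ℝ :=
  ‖opFun (residual g (α k)) (normalOp T) x‖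

/-- The residual `‖T r_{α_k}(T* T) x‖` of the linear method with exact data, increased by
`α_k^{1/2}` times its error. -/
noncomputable def linearResidual (g : ℝ → ℝ → ℝ) (α : ℕ → ℝ) (T : X →L[𝕜] Y) (x : X) (k : ℕ) :
    ℝ :=
  ‖T (opFun (residual g (α k)) (normalOp T) x)‖ + √(α k) * linearError g α T x k

variable {g : ℝ → ℝ → ℝ} {α : ℕ → ℝ} {T : X →L[𝕜] Y} {c₀ c₁ c₂ c₃ c₄ c₅ r : ℝ}

lemma linearError_nonneg (x : X) (k : ℕ) : 0 ≤ linearError g α T x k := norm_nonneg _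

lemma linearResidual_nonneg (x : X) (k : ℕ) : 0 ≤ linearResidual g α T x k :=
  add_nonneg (norm_nonneg _) (mul_nonneg (Real.sqrt_nonneg _) (norm_nonneg _))

lemma sqrt_mul_linearError_le (x : X) (k : ℕ) :
    √(α k) * linearError g α T x k ≤ linearResidual g α T x k :=
  le_add_of_nonneg_left (norm_nonneg _)

lemma norm_comp_le_linearResidual (x : X) (k : ℕ) :
    ‖T (opFun (residual g (α k)) (normalOp T) x)‖ ≤ linearResidual g α T x k :=
  le_add_of_nonneg_right (mul_nonneg (Real.sqrt_nonneg _) (norm_nonneg _))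

lemma linearError_antitone (hg : IsFilterFamily g c₀ c₁ c₂ c₃ c₄) (hα : IsParameterSequence α r)
    (hT : ‖T‖ ^ 2 ≤ 1 / 2) (x : X) : Antitone (linearError g α T x) := fun _ m hkm =>
  hg.norm_residual_apply_mono hT (hα.pos m) (hα.antitone hkm) x

lemma linearError_le_mul_succ (hg : IsFilterFamily g c₀ c₁ c₂ c₃ c₄)
    (hα : IsParameterSequence α r) (hc₅ : ResidualRatioBound g α c₅) (hT : ‖T‖ ^ 2 ≤ 1 / 2)
    (x : X) (k : ℕ) : linearError g α T x k ≤ c₅ * linearError g α T x (k + 1) :=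
  hg.norm_residual_apply_le_mul (by linarith [hc₅.1]) hT (hα.pos _) (hα.pos _) (hc₅.2 k) x

lemma linearResidual_le_mul_succ (hg : IsFilterFamily g c₀ c₁ c₂ c₃ c₄)
    (hα : IsParameterSequence α r) (hr : 1 < r) (hc₅ : ResidualRatioBound g α c₅)
    (hT : ‖T‖ ^ 2 ≤ 1 / 2) (x : X) (k : ℕ) :
    linearResidual g α T x k ≤ √r * c₅ * linearResidual g α T x (k + 1) := by
  have h5 : 0 < c₅ := by linarith [hc₅.1]
  have hr1 : 1 ≤ √r := Real.one_le_sqrt.2 hr.le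
  have h1 := hg.norm_comp_residual_apply_le_mul h5.le hT (hα.pos _) (hα.pos _) (hc₅.2 k) x
  have h2 := linearError_le_mul_succ hg hα hc₅ hT x k
  have h3 := hα.sqrt_le_mul (by linarith) k
  unfold linearResidual
  have h4 : √(α k) * linearError g α T x k
      ≤ (√r * √(α (k + 1))) * (c₅ * linearError g α T x (k + 1)) :=
    mul_le_mul h3 h2 (linearError_nonneg x k) (by positivity)
  have h6 : c₅ * ‖T (opFun (residual g (α (k + 1))) (normalOp T) x)‖
      ≤ √r * (c₅ * ‖T (opFun (residual g (α (k + 1))) (normalOp T) x)‖) :=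
    le_mul_of_one_le_left (by positivity) hr1
  linarith

lemma linearError_source (hg : IsFilterFamily g c₀ c₁ c₂ c₃ c₄) (hα : IsParameterSequence α r)
    (hT : ‖T‖ ^ 2 ≤ 1 / 2) {ν : ℝ} (hν : 0 ≤ ν) (ω : X) (k : ℕ) :
    linearError g α T (opFun (fun t : ℝ => t ^ ν) (normalOp T) ω) k
      = ‖opFun (fun t => t ^ ν * residual g (α k) t) (normalOp T) ω‖ := by
  have hc : ContinuousOn (fun t : ℝ => t ^ ν) (Set.Icc 0 (1 / 2)) :=
    (Real.continuous_rpow_const hν).continuousOn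
  have hr := hg.residual_continuousOn (hα.pos k)
  rw [linearError, opFun_comm_apply (spectrumIn_normalOp hT) le_rfl hr hc,
    opFun_mul_apply (spectrumIn_normalOp hT) le_rfl hc hr]

/-- The operator T contributes an extra √t, so the residual needs order ν + 1/2; this is why ν + 1/2
must lie below the qualification. -/
lemma norm_comp_residual_source (hg : IsFilterFamily g c₀ c₁ c₂ c₃ c₄)
    (hα : IsParameterSequence α r) (hT : ‖T‖ ^ 2 ≤ 1 / 2) {ν : ℝ} (hν : 0 ≤ ν) (ω : X) (k : ℕ) :
    ‖T (opFun (residual g (α k)) (normalOp T) (opFun (fun t : ℝ => t ^ ν) (normalOp T) ω))‖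
      = ‖opFun (fun t => t ^ (ν + 1 / 2) * residual g (α k) t) (normalOp T) ω‖ := by
  have hc : ContinuousOn (fun t : ℝ => t ^ ν) (Set.Icc 0 (1 / 2)) :=
    (Real.continuous_rpow_const hν).continuousOn
  have hr := hg.residual_continuousOn (hα.pos k)
  rw [opFun_comm_apply (spectrumIn_normalOp hT) le_rfl hr hc,
    opFun_mul_apply (spectrumIn_normalOp hT) le_rfl hc hr,
    norm_comp_opFun_apply hT le_rfl (f := fun t => t ^ ν * residual g (α k) t) (hc.mul hr),
    opFun_congr fun t ht => ?_]
  rw [Real.rpow_add_of_nonneg ht.1 hν (by norm_num), Real.sqrt_eq_rpow]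
  ring

lemma linearError_isLittleO (hg : IsFilterFamily g c₀ c₁ c₂ c₃ c₄) {q : ℝ≥0∞}
    (hq : IsQualification g q) (hα : IsParameterSequence α r) (hT : ‖T‖ ^ 2 ≤ 1 / 2)
    {ν : ℝ} (hν : 0 ≤ ν) (hνq : ENNReal.ofReal (ν + 1 / 2) < q) {ω : X}
    (hω : ω ∈ (LinearMap.ker T.toLinearMap)ᗮ) {ε : ℝ} (hε : 0 < ε) :
    ∀ᶠ k in atTop, linearError g α T (opFun (fun t : ℝ => t ^ ν) (normalOp T) ω) k
      ≤ ε * α k ^ ν := by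
  simp_rw [linearError_source hg hα hT hν]
  exact isLittleO_rpow_mul_residual hg hq hT hν
    ((ENNReal.ofReal_le_ofReal (by linarith)).trans_lt hνq) hω hα.pos hα.tendsto_zero hε

lemma linearResidual_isLittleO (hg : IsFilterFamily g c₀ c₁ c₂ c₃ c₄) {q : ℝ≥0∞}
    (hq : IsQualification g q) (hα : IsParameterSequence α r) (hT : ‖T‖ ^ 2 ≤ 1 / 2)
    {ν : ℝ} (hν : 0 ≤ ν) (hνq : ENNReal.ofReal (ν + 1 / 2) < q) {ω : X}
    (hω : ω ∈ (LinearMap.ker T.toLinearMap)ᗮ) {ε : ℝ} (hε : 0 < ε) :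
    ∀ᶠ k in atTop, linearResidual g α T (opFun (fun t : ℝ => t ^ ν) (normalOp T) ω) k
      ≤ ε * α k ^ (ν + 1 / 2) := by
  filter_upwards [linearError_isLittleO hg hq hα hT hν hνq hω (half_pos hε),
    isLittleO_rpow_mul_residual hg hq hT (by linarith) hνq hω hα.pos hα.tendsto_zero
      (half_pos hε)] with k h1 h2
  rw [linearResidual, norm_comp_residual_source hg hα hT hν]
  have e : α k ^ (ν + 1 / 2) = √(α k) * α k ^ ν := by
    rw [Real.rpow_add (hα.pos k), Real.sqrt_eq_rpow, mul_comm]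
  have h3 := mul_le_mul_of_nonneg_left h1 (Real.sqrt_nonneg (α k))
  rw [e] at h2 ⊢
  linarith

/-- If an iteration stays close to the linear method and is stopped by the discrepancy principle,
then its error is dominated by the approximation error plus the propagated noise, at every later
index. -/
lemma error_le_at_later_index (hg : IsFilterFamily g c₀ c₁ c₂ c₃ c₄)
    (hα : IsParameterSequence α r) (hT : ‖T‖ ^ 2 ≤ 1 / 2) {e : ℕ → X} {N m : ℕ}
    {δ ε C Ct κ : ℝ} (hδ : 0 ≤ δ) (hC : 0 ≤ C) (hε : 0 ≤ ε)
    (hE : ∀ k ≤ N, ‖e k‖ ≤ C * (linearError g α T (e 0) k + δ / √(α k)))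
    (hstep : ∀ k < N, ‖e (k + 1) - opFun (residual g (α k)) (normalOp T) (e 0)‖
      ≤ ε * ‖e k‖ + c₄ * (δ / √(α k)))
    (hNm : N ≤ m) (hTe : ‖T (e N)‖ ≤ Ct * δ + κ * √(α m) * ‖e N‖)
    (hCε : 4 * C * ε ≤ 1) (hκ : 4 * (c₄ * κ) ≤ 1) (hCt : 0 ≤ Ct) :
    ‖e N‖ ≤ (4 + 4 * (2 * c₄ + 1 + c₄ * Ct)) * (linearError g α T (e 0) m + δ / √(α m)) := by
  have hc₄ := hg.c₄_nonneg
  have hs := hα.sqrt_pos m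
  set φ := linearError g α T (e 0)
  have hφm : 0 ≤ φ m := linearError_nonneg _ _
  set d := δ / √(α m) with hd
  have hd0 : 0 ≤ d := by positivity
  -- Split e_N = r_{α_m}(T*T)e_N + g_{α_m}(T*T)T*T e_N. The second part is controlled by ‖T e_N‖,
  -- and its κ-term costs a quarter of ‖e_N‖.
  have hsplit : ‖e N‖ ≤ ‖opFun (residual g (α m)) (normalOp T) (e N)‖ + c₄ * Ct * d
      + ‖e N‖ / 4 := by
    have h1 := hg.norm_adjoint_apply_le hT (hα.pos m) (T (e N))
    have h2 : e N = opFun (residual g (α m)) (normalOp T) (e N)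
        + opFun (g (α m)) (normalOp T) (ContinuousLinearMap.adjoint T (T (e N))) := by
      rw [hg.opFun_residual_apply hT (hα.pos m)]; abel
    have h3 : ‖e N‖ ≤ ‖opFun (residual g (α m)) (normalOp T) (e N)‖
        + ‖opFun (g (α m)) (normalOp T) (ContinuousLinearMap.adjoint T (T (e N)))‖ := by
      conv_lhs => rw [h2]
      exact norm_add_le _ _
    have h4 : c₄ * (√(α m))⁻¹ * ‖T (e N)‖ ≤ c₄ * Ct * d + ‖e N‖ / 4 := by
      calc c₄ * (√(α m))⁻¹ * ‖T (e N)‖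
          ≤ c₄ * (√(α m))⁻¹ * (Ct * δ + κ * √(α m) * ‖e N‖) := by gcongr
        _ = c₄ * Ct * d + (c₄ * κ) * ‖e N‖ := by rw [hd]; field_simp
        _ ≤ _ := by nlinarith [norm_nonneg (e N)]
    linarith
  -- For N = 0 the first part is φ m itself; otherwise e_N is compared with the linear method at
  -- index N − 1.
  rcases Nat.eq_zero_or_eq_succ_pred N with h0 | hN
  · rw [h0] at hsplit ⊢
    change ‖e 0‖ ≤ φ m + _ + _ at hsplit
    have h0 : 0 ≤ c₄ * Ct := by positivity
    nlinarith [mul_nonneg h0 hd0, mul_nonneg hc₄ hd0, mul_nonneg h0 hφm, mul_nonneg hc₄ hφm]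
  · set k := N.pred
    have hkN : k < N := by omega
    have hstepk := hstep k hkN
    rw [← Nat.succ_eq_add_one, ← hN] at hstepk
    set dk := δ / √(α k) with hdk
    have hdk0 : 0 ≤ dk := div_nonneg hδ (Real.sqrt_nonneg _)
    have hdkm : dk ≤ d := hα.div_sqrt_mono hδ (hkN.le.trans hNm)
    have hrm : ‖opFun (residual g (α m)) (normalOp T) (e N)‖ ≤ φ m + (ε * ‖e k‖ + c₄ * dk) := by
      have h1 : opFun (residual g (α m)) (normalOp T) (e N)
          = opFun (residual g (α m)) (normalOp T) (opFun (residual g (α k)) (normalOp T) (e 0))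
          + opFun (residual g (α m)) (normalOp T)
            (e N - opFun (residual g (α k)) (normalOp T) (e 0)) := by
        rw [← map_add, add_sub_cancel]
      rw [h1]
      refine (norm_add_le _ _).trans (add_le_add ?_ ?_)
      · exact hg.norm_residual_residual_apply_le hT (hα.pos m) (hα.pos k) (e 0)
      · exact (hg.norm_residual_apply_le hT (hα.pos m) _).trans hstepk
    have hφk : φ k ≤ ‖e N‖ + (ε * ‖e k‖ + c₄ * dk) := by
      have := norm_sub_norm_le (opFun (residual g (α k)) (normalOp T) (e 0)) (e N)
      rw [norm_sub_rev] at this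
      change φ k - _ ≤ _ at this
      linarith
    have hEk := hE k hkN.le
    -- The previous error costs half of ‖e_N‖. Together with the quarter above, a quarter remains on
    -- the left, whence the factors 4.
    have hεEk := mul_prev_error_le hC hε hCε (norm_nonneg _) (norm_nonneg _) hdk0 hc₄ hEk hφk
    have h6 : (c₄ + 1) * dk ≤ (c₄ + 1) * d := by gcongr
    have h7 : c₄ * dk ≤ c₄ * d := by gcongr
    have h8 : ‖e N‖ ≤ 4 * φ m + 4 * (2 * c₄ + 1 + c₄ * Ct) * d := by linarith
    have h9 : 0 ≤ 4 * (2 * c₄ + 1 + c₄ * Ct) := by positivity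
    nlinarith [mul_nonneg h9 hφm]

/-- Convergence rates for iterations that stay close to the linear method and are stopped by the
discrepancy principle. -/
lemma isLittleO_of_estimates (hg : IsFilterFamily g c₀ c₁ c₂ c₃ c₄)
    (hα : IsParameterSequence α r) (hr : 1 < r) (hc₅ : ResidualRatioBound g α c₅)
    {q : ℝ≥0∞} (hq : IsQualification g q) (hT : ‖T‖ ^ 2 ≤ 1 / 2)
    {ν : ℝ} (hν : 0 ≤ ν) (hνq : ENNReal.ofReal (ν + 1 / 2) < q) {e₀ ω : X}
    (hω : ω ∈ (LinearMap.ker T.toLinearMap)ᗮ)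
    (he₀ : e₀ = opFun (fun t : ℝ => t ^ ν) (normalOp T) ω)
    {e : ℝ → ℕ → X} {ρ : ℝ → ℕ → ℝ} {N : ℝ → ℕ} {τ ε ε' C C' Ct c κ : ℝ}
    (hτ : 1 < τ) (hC : 0 ≤ C) (hC' : 0 ≤ C') (hε : 0 ≤ ε) (hCε : 4 * C * ε ≤ 1)
    (hε' : 2 * ε' ≤ τ - 1) (hκ : 4 * (c₄ * κ) ≤ 1) (hCt : 0 ≤ Ct)
    (hc : c = 0 ∨ 1 / 2 ≤ ν)
    (h0 : ∀ δ, e δ 0 = e₀)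
    (h : ∀ᶠ δ in 𝓝[>] (0 : ℝ),
      (∀ k ≤ N δ, ‖e δ k‖ ≤ C * (linearError g α T e₀ k + δ / √(α k))) ∧
      (∀ k < N δ, ‖e δ (k + 1) - opFun (residual g (α k)) (normalOp T) e₀‖
        ≤ ε * ‖e δ k‖ + c₄ * (δ / √(α k))) ∧
      (∀ k < N δ, ρ δ (k + 1) ≤ (1 + ε') * δ + C' * linearResidual g α T e₀ k) ∧
      (∀ k < N δ, τ * δ < ρ δ k) ∧
      ∀ m, N δ ≤ m → c * δ ≤ α m → ‖T (e δ (N δ))‖ ≤ Ct * δ + κ * √(α m) * ‖e δ (N δ)‖) :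
    (fun δ => e δ (N δ)) =o[𝓝[>] (0 : ℝ)] fun δ : ℝ => δ ^ (2 * ν / (1 + 2 * ν)) := by
  have h5 : 1 < c₅ := hc₅.1
  have hc₄ := hg.c₄_nonneg
  have hr0 : 0 < r := by linarith
  have hτ1 : 0 < τ - 1 := by linarith
  set A := 4 + 4 * (2 * c₄ + 1 + c₄ * Ct) with hA
  set B := 2 / (τ - 1) * (C' * (√r * c₅ * (√r * c₅))) with hB
  have hA0 : 0 ≤ A := by positivity
  have hB0 : 0 ≤ B := by positivity
  refine isLittleO_of_balanced_bounds hα hr hν (linearError_antitone hg hα hT e₀)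
    (ψ := linearResidual g α T e₀) (l := N) (C := C + A + B) (c := c) ?_ ?_ (by positivity)
    hc ?_
  · intro ε hε
    rw [he₀]
    exact linearError_isLittleO hg hq hα hT hν hνq hω hε
  · intro ε hε
    have := linearResidual_isLittleO hg hq hα hT hν hνq hω hε
    rw [← he₀] at this
    exact this
  filter_upwards [h, self_mem_nhdsWithin] with δ hδ hδ0
  obtain ⟨h1, h2, h3, h4, h6⟩ := hδ
  have hδ0 : 0 < δ := hδ0
  refine ⟨(h1 _ le_rfl).trans ?_, fun hN => ?_, fun m hNm hcm => ?_⟩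
  · have : 0 ≤ linearError g α T e₀ (N δ) := linearError_nonneg _ _
    gcongr
    linarith
  -- N ≥ 2 makes N − 1 = i + 1 an index reached by a step, so its residual is bounded by ψ_i and
  -- exceeds τδ. As ε' ≤ (τ − 1)/2, a positive multiple of δ survives; two ratio steps lead from ψ_i
  -- to ψ_N.
  · obtain ⟨i, hi⟩ := Nat.exists_eq_add_of_le' hN
    have h7 := h3 i (by omega)
    have h8 := h4 (i + 1) (by omega)
    have h9 : linearResidual g α T e₀ i
        ≤ √r * c₅ * (√r * c₅ * linearResidual g α T e₀ (N δ)) := by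
      rw [hi]
      refine (linearResidual_le_mul_succ hg hα hr hc₅ hT e₀ i).trans ?_
      gcongr
      exact linearResidual_le_mul_succ hg hα hr hc₅ hT e₀ (i + 1)
    have h10 : (τ - 1) / 2 * δ ≤ C' * linearResidual g α T e₀ i := by nlinarith
    have hψ : 0 ≤ linearResidual g α T e₀ (N δ) := linearResidual_nonneg _ _
    calc δ = 2 / (τ - 1) * ((τ - 1) / 2 * δ) := by field_simp
      _ ≤ 2 / (τ - 1) * (C' * (√r * c₅ * (√r * c₅ * linearResidual g α T e₀ (N δ)))) := by
        refine mul_le_mul_of_nonneg_left (h10.trans ?_) (by positivity)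
        exact mul_le_mul_of_nonneg_left h9 hC'
      _ = B * linearResidual g α T e₀ (N δ) := by rw [hB]; ring
      _ ≤ _ := by gcongr; linarith
  · have h7 := error_le_at_later_index hg hα hT (e := e δ) (N := N δ) (m := m) hδ0.le hC hε
      (by rw [h0]; exact h1) (by rw [h0]; exact h2) hNm (h6 m hNm hcm) hCε hκ hCt
    rw [h0, ← hA] at h7
    refine h7.trans ?_
    have : 0 ≤ linearError g α T e₀ m := linearError_nonneg _ _
    gcongr
    linarith

end LinearQuantities

/-! ### Taylor estimates and the error representation -/

section Nonlinear

variable {𝕜 X Y : Type*} [RCLike 𝕜]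
  [NormedAddCommGroup X] [InnerProductSpace 𝕜 X]
  [NormedAddCommGroup Y] [InnerProductSpace 𝕜 Y]
  {F : X → Y} {D : Set X} {xd x₀ : X} {ρ : ℝ} {g : ℝ → ℝ → ℝ} {α : ℕ → ℝ} {c₃ β₀ : ℝ}

namespace IsScaledOperator

lemma differentiableAt {α₀ : ℝ} (hF : IsScaledOperator 𝕜 F D xd ρ g α₀ c₃ β₀) {x : X}
    (hx : x ∈ Metric.ball xd ρ) : DifferentiableAt 𝕜 F x :=
  (hF.differentiableOn.mono hF.ball_subset).differentiableAt (Metric.isOpen_ball.mem_nhds hx)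

lemma norm_sq_le_β₀ {α₀ : ℝ} (hF : IsScaledOperator 𝕜 F D xd ρ g α₀ c₃ β₀) {x : X}
    (hx : x ∈ Metric.ball xd ρ) : ‖fderiv 𝕜 F x‖ ^ 2 ≤ β₀ := by
  have := (hF.norm_fderiv_le x hx).trans (min_le_right _ _)
  calc ‖fderiv 𝕜 F x‖ ^ 2 ≤ √β₀ ^ 2 := by gcongr
    _ = β₀ := Real.sq_sqrt hF.β₀_pos.le

lemma norm_sq_le {α₀ : ℝ} (hF : IsScaledOperator 𝕜 F D xd ρ g α₀ c₃ β₀) {x : X}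
    (hx : x ∈ Metric.ball xd ρ) : ‖fderiv 𝕜 F x‖ ^ 2 ≤ 1 / 2 :=
  (hF.norm_sq_le_β₀ hx).trans hF.β₀_le

lemma norm_le {α₀ : ℝ} (hF : IsScaledOperator 𝕜 F D xd ρ g α₀ c₃ β₀) {x : X}
    (hx : x ∈ Metric.ball xd ρ) : ‖fderiv 𝕜 F x‖ ≤ 1 / √2 := by
  rw [← Real.sqrt_one, ← Real.sqrt_div zero_le_one]
  exact Real.le_sqrt_of_sq_le (hF.norm_sq_le hx)

end IsScaledOperator

/-- Mean value inequality for t ↦ Λ(F(z + t(x − z)) − t F'(z)(x − z)) on [0, 1]. Keeping Λ inside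
lets operators such as g(G*G)G* act on the derivative difference before norms are taken. -/
lemma norm_map_taylor_le {Z : Type*} [NormedAddCommGroup Z] [NormedSpace 𝕜 Z] {B : Set X}
    (hB : ∀ x ∈ B, ∀ z ∈ B, ∀ t ∈ Set.Icc (0 : ℝ) 1, z + (t : 𝕜) • (x - z) ∈ B)
    (hF : ∀ x ∈ B, DifferentiableAt 𝕜 F x) (Λ : Y →L[𝕜] Z) {x z : X} (hx : x ∈ B) (hz : z ∈ B)
    {C : ℝ} (h : ∀ t ∈ Set.Icc (0 : ℝ) 1,
      ‖Λ ((fderiv 𝕜 F (z + (t : 𝕜) • (x - z)) - fderiv 𝕜 F z) (x - z))‖ ≤ C) :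
    ‖Λ (F x - F z - fderiv 𝕜 F z (x - z))‖ ≤ C := by
  -- The curve has a real parameter, so scalars are restricted to ℝ along it.
  let _ : NormedSpace ℝ X := NormedSpace.restrictScalars ℝ 𝕜 X
  let _ : NormedSpace ℝ Y := NormedSpace.restrictScalars ℝ 𝕜 Y
  let _ : NormedSpace ℝ Z := NormedSpace.restrictScalars ℝ 𝕜 Z
  have : IsScalarTower ℝ 𝕜 X := ⟨fun a b c => by rw [Algebra.smul_def, mul_smul]; rfl⟩
  have : IsScalarTower ℝ 𝕜 Y := ⟨fun a b c => by rw [Algebra.smul_def, mul_smul]; rfl⟩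
  have : IsScalarTower ℝ 𝕜 Z := ⟨fun a b c => by rw [Algebra.smul_def, mul_smul]; rfl⟩
  have hcurve : ∀ t : ℝ, HasDerivAt (fun s : ℝ => z + (s : 𝕜) • (x - z)) (x - z) t := by
    intro t
    have h1 : HasDerivAt (fun s : ℝ => (s : 𝕜)) 1 t := by
      simpa using (RCLike.ofRealCLM (K := 𝕜)).hasDerivAt (x := t)
    simpa using (h1.smul_const (x - z)).const_add z
  have hlin : ∀ t : ℝ, HasDerivAt (fun s : ℝ => (s : 𝕜) • fderiv 𝕜 F z (x - z))
      (fderiv 𝕜 F z (x - z)) t := by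
    intro t
    have h1 : HasDerivAt (fun s : ℝ => (s : 𝕜)) 1 t := by
      simpa using (RCLike.ofRealCLM (K := 𝕜)).hasDerivAt (x := t)
    simpa using h1.smul_const (fderiv 𝕜 F z (x - z))
  have hder : ∀ t ∈ Set.Icc (0 : ℝ) 1, HasDerivWithinAt
      (fun s : ℝ => Λ (F (z + (s : 𝕜) • (x - z)) - (s : 𝕜) • fderiv 𝕜 F z (x - z)))
      (Λ ((fderiv 𝕜 F (z + (t : 𝕜) • (x - z)) - fderiv 𝕜 F z) (x - z))) (Set.Icc 0 1) t := by
    intro t ht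
    have h1 := ((hF _ (hB x hx z hz t ht)).hasFDerivAt.restrictScalars ℝ).comp_hasDerivAt t
      (hcurve t)
    have h2 := (Λ.hasFDerivAt (x := F (z + (t : 𝕜) • (x - z))
      - (t : 𝕜) • fderiv 𝕜 F z (x - z))).restrictScalars ℝ
    exact (h2.comp_hasDerivAt t (h1.sub (hlin t))).hasDerivWithinAt
  have := norm_image_sub_le_of_norm_deriv_le_segment_01' hder
    fun t ht => h t ⟨ht.1, ht.2.le⟩
  simp only [map_one, one_smul, RCLike.ofReal_zero, zero_smul, add_zero,
    sub_zero, add_sub_cancel, ← map_sub] at this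
  rwa [sub_right_comm]

lemma ball_segment {x z : X} (hx : x ∈ Metric.ball xd ρ) (hz : z ∈ Metric.ball xd ρ) {t : ℝ}
    (ht : t ∈ Set.Icc (0 : ℝ) 1) : z + (t : 𝕜) • (x - z) ∈ Metric.ball xd ρ := by
  rw [mem_ball_iff_norm] at *
  have e : z + (t : 𝕜) • (x - z) - xd = ((1 - t : ℝ) : 𝕜) • (z - xd) + (t : 𝕜) • (x - xd) := by
    push_cast
    module
  rw [e]
  have h1 : 0 ≤ 1 - t := by linarith [ht.2]
  calc _ ≤ (1 - t) * ‖z - xd‖ + t * ‖x - xd‖ := by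
        refine (norm_add_le _ _).trans ?_
        rw [norm_smul, norm_smul, RCLike.norm_ofReal, RCLike.norm_ofReal, abs_of_nonneg h1,
          abs_of_nonneg ht.1]
    _ < ρ := by
        rcases h1.eq_or_lt with h2 | h2
        · have : t = 1 := by linarith
          subst this
          simpa using hx
        · nlinarith [ht.1]

lemma norm_segment_sub_le (x z : X) {t : ℝ} (ht : t ∈ Set.Icc (0 : ℝ) 1) :
    ‖z + (t : 𝕜) • (x - z) - z‖ ≤ ‖x - z‖ := by
  rw [add_sub_cancel_left, norm_smul, RCLike.norm_ofReal, abs_of_nonneg ht.1]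
  exact mul_le_of_le_one_left (norm_nonneg _) ht.2

lemma norm_taylor_le_of_lipschitz {α₀ L : ℝ} (hF : IsScaledOperator 𝕜 F D xd ρ g α₀ c₃ β₀)
    (hL : LipschitzDeriv 𝕜 F xd ρ L) (hL0 : 0 ≤ L) {x z : X} (hx : x ∈ Metric.ball xd ρ)
    (hz : z ∈ Metric.ball xd ρ) :
    ‖F x - F z - fderiv 𝕜 F z (x - z)‖ ≤ L * ‖x - z‖ ^ 2 := by
  refine norm_map_taylor_le (𝕜 := 𝕜) (fun x hx z hz t ht => ball_segment hx hz ht)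
    (fun x hx => hF.differentiableAt hx) (ContinuousLinearMap.id 𝕜 Y) hx hz fun t ht => ?_
  have h1 := (hL _ (ball_segment (𝕜 := 𝕜) hx hz ht) z hz).trans
    (mul_le_mul_of_nonneg_left (norm_segment_sub_le x z ht) hL0)
  rw [pow_two, ← mul_assoc]
  exact ContinuousLinearMap.le_of_opNorm_le _ h1 (x - z)

variable [CompleteSpace X] [CompleteSpace Y] {c₀ c₁ c₂ c₄ : ℝ}

/-- The bracket in the iteration is (Taylor remainder at x) − (noise) + F'(x)(x₀ − xd), and the last
term combines with x₀ − xd into the residual function r_{α_k}. -/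
lemma newtonSeq_succ_sub (hg : IsFilterFamily g c₀ c₁ c₂ c₃ c₄) (y : Y) (k : ℕ) (hα : 0 < α k)
    {x : X} (hx : newtonSeq 𝕜 F g α x₀ y k = x) (hG : ‖fderiv 𝕜 F x‖ ^ 2 ≤ 1 / 2) :
    newtonSeq 𝕜 F g α x₀ y (k + 1) - xd
      = opFun (residual g (α k)) (normalOp (fderiv 𝕜 F x)) (x₀ - xd)
        - opFun (g (α k)) (normalOp (fderiv 𝕜 F x)) (ContinuousLinearMap.adjoint (fderiv 𝕜 F x)
            (F x - F xd - fderiv 𝕜 F x (x - xd)))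
        + opFun (g (α k)) (normalOp (fderiv 𝕜 F x)) (ContinuousLinearMap.adjoint (fderiv 𝕜 F x)
            (y - F xd)) := by
  rw [newtonSeq, hx, hg.opFun_residual_apply hG hα]
  have e : F x - y - fderiv 𝕜 F x (x - x₀)
      = (F x - F xd - fderiv 𝕜 F x (x - xd)) - (y - F xd) + fderiv 𝕜 F x (x₀ - xd) := by
    have : x - x₀ = (x - xd) - (x₀ - xd) := by abel
    rw [this, map_sub (fderiv 𝕜 F x) (x - xd)]
    abel
  rw [e, map_add, map_add, map_sub, map_sub]
  abel

end Nonlinear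

/-! ### One Newton step under the Lipschitz condition -/

section Lipschitz

variable {𝕜 X Y : Type*} [RCLike 𝕜]
  [NormedAddCommGroup X] [InnerProductSpace 𝕜 X] [CompleteSpace X]
  [NormedAddCommGroup Y] [InnerProductSpace 𝕜 Y] [CompleteSpace Y]
  {F : X → Y} {D : Set X} {xd x₀ : X} {ρ : ℝ} {g : ℝ → ℝ → ℝ} {α : ℕ → ℝ}
  {c₀ c₁ c₂ c₃ c₄ c₆ β₀ L δ : ℝ} {u y : Y}

/-- The representation x₀ − xd = T*u supplies the adjoint factor on the right that the commutator
bounds require. -/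
lemma lipschitz_commutator (hc₆ : CommutatorBounds 𝕜 X Y g c₆)
    (hF : IsScaledOperator 𝕜 F D xd ρ g (α 0) c₃ β₀) (hL : LipschitzDeriv 𝕜 F xd ρ L)
    (hu : x₀ - xd = ContinuousLinearMap.adjoint (fderiv 𝕜 F xd) u) {a : ℝ} (ha : 0 < a) {x : X}
    (hx : x ∈ Metric.ball xd ρ) (hxd : xd ∈ Metric.ball xd ρ) :
    ‖opFun (residual g a) (normalOp (fderiv 𝕜 F x)) (x₀ - xd)
      - opFun (residual g a) (normalOp (fderiv 𝕜 F xd)) (x₀ - xd)‖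
      ≤ c₆ * (L * ‖x - xd‖) * ‖u‖ ∧
    ‖fderiv 𝕜 F x (opFun (residual g a) (normalOp (fderiv 𝕜 F x)) (x₀ - xd)
      - opFun (residual g a) (normalOp (fderiv 𝕜 F xd)) (x₀ - xd))‖
      ≤ c₆ * √a * (L * ‖x - xd‖) * ‖u‖ := by
  have h6 := hc₆.c₆_pos
  have hLx := hL x hx xd hxd
  rw [hu]
  constructor
  · refine (ContinuousLinearMap.le_of_opNorm_le _ (hc₆.residual_sub_comp a ha (fderiv 𝕜 F x)
      (fderiv 𝕜 F xd) (hF.norm_le hx) (hF.norm_le hxd)) u).trans ?_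
    gcongr
  · refine (ContinuousLinearMap.le_of_opNorm_le _ (hc₆.comp_residual_sub_comp a ha (fderiv 𝕜 F x)
      (fderiv 𝕜 F xd) (hF.norm_le hx) (hF.norm_le hxd)) u).trans ?_
    gcongr

/-- One step of the iteration, compared with the linear method, under the Lipschitz condition. -/
lemma lipschitz_step (hg : IsFilterFamily g c₀ c₁ c₂ c₃ c₄) (hc₆ : CommutatorBounds 𝕜 X Y g c₆)
    (hF : IsScaledOperator 𝕜 F D xd ρ g (α 0) c₃ β₀) (hL : LipschitzDeriv 𝕜 F xd ρ L)
    (hL0 : 0 ≤ L) (hu : x₀ - xd = ContinuousLinearMap.adjoint (fderiv 𝕜 F xd) u)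
    (hy : ‖y - F xd‖ ≤ δ) {k : ℕ} (hαk : 0 < α k) {x x' : X}
    (hxk : newtonSeq 𝕜 F g α x₀ y k = x) (hxk' : newtonSeq 𝕜 F g α x₀ y (k + 1) = x')
    (hx : x ∈ Metric.ball xd ρ) :
    ‖x' - xd - opFun (residual g (α k)) (normalOp (fderiv 𝕜 F xd)) (x₀ - xd)‖
      ≤ c₆ * (L * ‖x - xd‖) * ‖u‖ + c₄ * (√(α k))⁻¹ * (L * ‖x - xd‖ ^ 2)
        + c₄ * (√(α k))⁻¹ * δ ∧
    (x' ∈ Metric.ball xd ρ → ‖F x' - y‖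
      ≤ ‖fderiv 𝕜 F xd (opFun (residual g (α k)) (normalOp (fderiv 𝕜 F xd)) (x₀ - xd))‖
        + L * ‖x' - xd‖ ^ 2
        + (c₆ * √(α k) * (L * ‖x - xd‖) * ‖u‖
          + L * ‖x - xd‖ * (c₆ * (L * ‖x - xd‖) * ‖u‖))
        + (L * ‖x - xd‖ * (c₄ * (√(α k))⁻¹ * (L * ‖x - xd‖ ^ 2)) + L * ‖x - xd‖ ^ 2)
        + (L * ‖x - xd‖ * (c₄ * (√(α k))⁻¹ * δ) + δ)) := by
  have hxd : xd ∈ Metric.ball xd ρ := Metric.mem_ball_self (dist_nonneg.trans_lt hx)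
  have hG := hF.norm_sq_le hx
  have hc₄ := hg.c₄_nonneg
  obtain ⟨hD1, hD2⟩ := lipschitz_commutator hc₆ hF hL hu hαk hx hxd
  have hstep := newtonSeq_succ_sub (xd := xd) hg y k hαk hxk hG
  rw [hxk'] at hstep
  have hTG := hL x hx xd hxd
  set G := fderiv 𝕜 F x
  set T := fderiv 𝕜 F xd
  set s := F x - F xd - G (x - xd) with hs
  have hsn : ‖s‖ ≤ L * ‖x - xd‖ ^ 2 := by
    have h := norm_taylor_le_of_lipschitz hF hL hL0 hxd hx
    have e : s = -(F xd - F x - G (xd - x)) := by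
      rw [hs, ← neg_sub x xd, map_neg]; abel
    rwa [e, norm_neg, norm_sub_rev x xd]
  set n := y - F xd
  set d := opFun (residual g (α k)) (normalOp G) (x₀ - xd)
    - opFun (residual g (α k)) (normalOp T) (x₀ - xd) with hd
  set w₁ := opFun (g (α k)) (normalOp G) (ContinuousLinearMap.adjoint G s)
  set w₂ := opFun (g (α k)) (normalOp G) (ContinuousLinearMap.adjoint G n)
  set z := opFun (residual g (α k)) (normalOp T) (x₀ - xd)
  have hw₁ : ‖w₁‖ ≤ c₄ * (√(α k))⁻¹ * (L * ‖x - xd‖ ^ 2) :=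
    (hg.norm_adjoint_apply_le hG hαk s).trans (by gcongr)
  have hw₂ : ‖w₂‖ ≤ c₄ * (√(α k))⁻¹ * δ :=
    (hg.norm_adjoint_apply_le hG hαk n).trans (by gcongr)
  have hGw₁ : ‖G w₁‖ ≤ L * ‖x - xd‖ ^ 2 := (hg.norm_comp_adjoint_apply_le hG hαk s).trans hsn
  have hGw₂ : ‖n - G w₂‖ ≤ δ := (hg.norm_sub_comp_adjoint_apply_le hG hαk n).trans hy
  have hGT : ∀ {w : X} {b : ℝ}, ‖w‖ ≤ b → ‖(G - T) w‖ ≤ L * ‖x - xd‖ * b := fun {w b} hw =>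
    (ContinuousLinearMap.le_of_opNorm_le _ hTG w).trans (by gcongr)
  refine ⟨?_, fun hx' => ?_⟩
  · have e : x' - xd - z = d - w₁ + w₂ := by rw [hstep, hd]; abel
    rw [e]
    calc ‖d - w₁ + w₂‖ ≤ ‖d‖ + ‖w₁‖ + ‖w₂‖ :=
          (norm_add_le _ _).trans (add_le_add_left (norm_sub_le _ _) _)
      _ ≤ _ := by gcongr
  · have htay := norm_taylor_le_of_lipschitz hF hL hL0 hx' hxd
    change ‖F x' - F xd - T (x' - xd)‖ ≤ _ at htay
    have e0 : x' - xd = z + d - w₁ + w₂ := by rw [hstep, hd]; abel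
    -- The terms d, w₁, w₂ are functions of G, so G is applied to them and G − T is paid for
    -- separately. Keeping n − G w₂ together gives δ with constant 1.
    have e : F x' - y = T z + (F x' - F xd - T (x' - xd)) + (G d - (G - T) d)
        - (G w₁ - (G - T) w₁) + (-((G - T) w₂) - (n - G w₂)) := by
      have : T (x' - xd) = T z + T d - T w₁ + T w₂ := by rw [e0]; simp only [map_add, map_sub]
      rw [this]
      simp only [sub_apply]
      have hn : n = y - F xd := rfl
      rw [hn]
      abel
    rw [e]
    have t1 : ‖G d - (G - T) d‖ ≤ c₆ * √(α k) * (L * ‖x - xd‖) * ‖u‖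
          + L * ‖x - xd‖ * (c₆ * (L * ‖x - xd‖) * ‖u‖) :=
      (norm_sub_le _ _).trans (add_le_add hD2 (hGT hD1))
    have t2 : ‖G w₁ - (G - T) w₁‖ ≤ L * ‖x - xd‖ * (c₄ * (√(α k))⁻¹ * (L * ‖x - xd‖ ^ 2))
        + L * ‖x - xd‖ ^ 2 :=
      (norm_sub_le _ _).trans (by rw [add_comm]; exact add_le_add (hGT hw₁) hGw₁)
    have t3 : ‖-((G - T) w₂) - (n - G w₂)‖ ≤ L * ‖x - xd‖ * (c₄ * (√(α k))⁻¹ * δ) + δ :=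
      (norm_sub_le _ _).trans (by rw [norm_neg]; exact add_le_add (hGT hw₂) hGw₂)
    refine (norm_add_le _ _).trans (add_le_add ?_ t3)
    refine (norm_sub_le _ _).trans (add_le_add ?_ t2)
    refine (norm_add_le _ _).trans (add_le_add ?_ t1)
    exact (norm_add_le _ _).trans (add_le_add le_rfl htay)

end Lipschitz

/-! ### Scalar estimates for the Lipschitz case -/

section LipschitzNumeric

/-- The bound L E ≤ C₁ η s cancels the factor s⁻¹ and turns the quadratic Taylor term into a small
multiple of E. -/
lemma lipschitz_first_estimate {A E U L η c₄ c₆ C₁ s δ : ℝ} (hs : 0 < s) (hE : 0 ≤ E)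
    (hc₄ : 0 ≤ c₄) (hc₆ : 0 ≤ c₆) (hLU : L * U ≤ η) (hLE : L * E ≤ C₁ * η * s)
    (hA : A ≤ c₆ * (L * E) * U + c₄ * s⁻¹ * (L * E ^ 2) + c₄ * s⁻¹ * δ) :
    A ≤ η * (c₆ + c₄ * C₁) * E + c₄ * (δ / s) := by
  have h1 : c₆ * (L * E) * U ≤ c₆ * (η * E) := by
    rw [mul_assoc]
    exact mul_le_mul_of_nonneg_left (by nlinarith) hc₆
  have h2 : c₄ * s⁻¹ * (L * E ^ 2) ≤ c₄ * s⁻¹ * (C₁ * η * s * E) :=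
    mul_le_mul_of_nonneg_left (by nlinarith) (by positivity)
  have h3 : c₄ * s⁻¹ * (C₁ * η * s * E) = c₄ * (C₁ * η * E) := by field_simp
  have h4 : c₄ * s⁻¹ * δ = c₄ * (δ / s) := by rw [div_eq_mul_inv]; ring
  linarith

/-- Each of the six nonlinear terms receives a factor η from L U ≤ η or from the bounds on L E and L
E'; what is left is controlled by ψ + δ. The six constants add up to the factor in the conclusion.
-/
lemma lipschitz_second_estimate {R tz ψ E E' U L η c₄ c₆ C C' C₁ s δ : ℝ} (hs : 0 < s)
    (hE : 0 ≤ E) (hE' : 0 ≤ E') (hL : 0 ≤ L) (hc₄ : 0 ≤ c₄) (hc₆ : 0 ≤ c₆)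
    (hC₁ : 0 ≤ C₁) (hψ : 0 ≤ ψ) (hδ : 0 ≤ δ) (hη : 0 ≤ η) (hη1 : η ≤ 1) (hLU : L * U ≤ η)
    (hLE : L * E ≤ C₁ * η * s) (hLE' : L * E' ≤ C₁ * η * s) (hsE : s * E ≤ C * (ψ + δ))
    (hsE' : s * E' ≤ C' * (ψ + δ))
    (hR : R ≤ tz + L * E' ^ 2 + (c₆ * s * (L * E) * U + L * E * (c₆ * (L * E) * U))
      + (L * E * (c₄ * s⁻¹ * (L * E ^ 2)) + L * E ^ 2) + (L * E * (c₄ * s⁻¹ * δ) + δ)) :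
    R ≤ tz + δ + η * (C₁ * C' + c₆ * C + C₁ * c₆ * C + C₁ * c₄ * C₁ * C + C₁ * C + C₁ * c₄)
      * (ψ + δ) := by
  set v := ψ + δ with hv
  have hv0 : 0 ≤ v := by positivity
  have hδv : δ ≤ v := by linarith
  have hsi : 0 < s⁻¹ := inv_pos.2 hs
  have hl0 : 0 ≤ L * E := by positivity
  have hCv : 0 ≤ C * v := le_trans (by positivity) hsE
  have hlE : L * E * E ≤ C₁ * η * (C * v) := by
    calc L * E * E ≤ C₁ * η * s * E := by gcongr
      _ = C₁ * η * (s * E) := by ring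
      _ ≤ _ := by gcongr
  have hlE' : L * E' * E' ≤ C₁ * η * (C' * v) := by
    calc L * E' * E' ≤ C₁ * η * s * E' := by gcongr
      _ = C₁ * η * (s * E') := by ring
      _ ≤ _ := by gcongr
  have hls : L * E * s⁻¹ ≤ C₁ * η := by
    calc L * E * s⁻¹ ≤ C₁ * η * s * s⁻¹ := by gcongr
      _ = C₁ * η := by field_simp
  have hlE0 : 0 ≤ L * E * E := by positivity
  have b1 : L * E' ^ 2 ≤ η * (C₁ * C') * v := by linarith
  have b2 : c₆ * s * (L * E) * U ≤ η * (c₆ * C) * v := by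
    calc c₆ * s * (L * E) * U = c₆ * (L * U * (s * E)) := by ring
      _ ≤ c₆ * (η * (C * v)) := by gcongr
      _ = _ := by ring
  have b3 : L * E * (c₆ * (L * E) * U) ≤ η * (C₁ * c₆ * C) * v := by
    calc L * E * (c₆ * (L * E) * U) = c₆ * (L * U * (L * E * E)) := by ring
      _ ≤ c₆ * (1 * (C₁ * η * (C * v))) := by gcongr; exact hLU.trans hη1
      _ = _ := by ring
  have b4 : L * E * (c₄ * s⁻¹ * (L * E ^ 2)) ≤ η * (C₁ * c₄ * C₁ * C) * v := by
    calc L * E * (c₄ * s⁻¹ * (L * E ^ 2)) = c₄ * (L * E * s⁻¹ * (L * E * E)) := by ring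
      _ ≤ c₄ * (C₁ * (C₁ * η * (C * v))) :=
        mul_le_mul_of_nonneg_left (mul_le_mul (hls.trans (mul_le_of_le_one_right hC₁ hη1)) hlE
          hlE0 hC₁) hc₄
      _ = _ := by ring
  have b5 : L * E ^ 2 ≤ η * (C₁ * C) * v := by linarith
  have b6 : L * E * (c₄ * s⁻¹ * δ) ≤ η * (C₁ * c₄) * v := by
    calc L * E * (c₄ * s⁻¹ * δ) = c₄ * (L * E * s⁻¹ * δ) := by ring
      _ ≤ c₄ * (C₁ * η * v) := by gcongr
      _ = _ := by ring
  linarith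

end LipschitzNumeric

/-! ### Uniqueness of the stopping index, and the trivial case x₀ = xd -/

section Stopping

variable {X Y : Type*} [NormedAddCommGroup Y] {F : X → Y} {x : ℕ → X} {y : Y} {τ δ : ℝ}

lemma IsStoppingIndex.unique {k l : ℕ} (hk : IsStoppingIndex F x y τ δ k)
    (hl : IsStoppingIndex F x y τ δ l) : k = l := by
  rcases lt_trichotomy k l with h | h | h
  · exact absurd hk.1 (not_le.2 (hl.2 k h))
  · exact h
  · exact absurd hl.1 (not_le.2 (hk.2 l h))

end Stopping

section Exact

variable {𝕜 X Y : Type*} [RCLike 𝕜]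
  [NormedAddCommGroup X] [InnerProductSpace 𝕜 X] [CompleteSpace X]
  [NormedAddCommGroup Y] [InnerProductSpace 𝕜 Y] [CompleteSpace Y]
  {F : X → Y} {xd x₀ : X} {ρ τ : ℝ} {g : ℝ → ℝ → ℝ} {α : ℕ → ℝ}

/-- If the starting point is the solution, the iteration stops at once. -/
lemma isStoppingIndex_zero_of_eq (hτ : 1 < τ) (h0 : x₀ = xd) {y : Y} {δ : ℝ} (hδ : 0 < δ)
    (hy : ‖y - F xd‖ ≤ δ) : IsStoppingIndex F (newtonSeq 𝕜 F g α x₀ y) y τ δ 0 := by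
  refine ⟨?_, fun j hj => absurd hj (Nat.not_lt_zero j)⟩
  rw [newtonSeq, h0, norm_sub_rev]
  nlinarith

lemma eventuallyWellDefined_of_eq (hτ : 1 < τ) (hρ : 0 < ρ) (h0 : x₀ = xd) {yd : ℝ → Y}
    (hyd : ∀ δ : ℝ, 0 < δ → ‖yd δ - F xd‖ ≤ δ) :
    EventuallyWellDefined 𝕜 F g α x₀ xd ρ τ yd := by
  filter_upwards [self_mem_nhdsWithin] with δ hδ
  refine ⟨0, isStoppingIndex_zero_of_eq hτ h0 hδ (hyd δ hδ), fun j hj => ?_⟩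
  rw [Nat.le_zero.1 hj, newtonSeq, h0]
  exact Metric.mem_ball_self hρ

lemma isLittleO_of_eq (hτ : 1 < τ) (h0 : x₀ = xd) {yd : ℝ → Y}
    (hyd : ∀ δ : ℝ, 0 < δ → ‖yd δ - F xd‖ ≤ δ) {kd : ℝ → ℕ}
    (hkd : ∀ᶠ δ in 𝓝[>] (0 : ℝ),
      IsStoppingIndex F (newtonSeq 𝕜 F g α x₀ (yd δ)) (yd δ) τ δ (kd δ)) (f : ℝ → ℝ) :
    (fun δ : ℝ => newtonSeq 𝕜 F g α x₀ (yd δ) (kd δ) - xd) =o[𝓝[>] (0 : ℝ)] f := by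
  refine (isLittleO_zero f _).congr' ?_ EventuallyEq.rfl
  filter_upwards [hkd, self_mem_nhdsWithin] with δ h hδ
  rw [h.unique (isStoppingIndex_zero_of_eq hτ h0 hδ (hyd δ hδ)), newtonSeq, h0, sub_self]

end Exact

/-! ### The Lipschitz case: constants and induction step -/

section LipschitzCase

variable {𝕜 X Y : Type*} [RCLike 𝕜]
  [NormedAddCommGroup X] [InnerProductSpace 𝕜 X] [CompleteSpace X]
  [NormedAddCommGroup Y] [InnerProductSpace 𝕜 Y] [CompleteSpace Y]
  {F : X → Y} {D : Set X} {xd x₀ : X} {ρ r τ : ℝ} {g : ℝ → ℝ → ℝ} {α : ℕ → ℝ}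
  {c₀ c₁ c₂ c₃ c₄ c₅ c₆ β₀ L δ η γ C C₁ K : ℝ} {u y : Y}

/-- Smallness of `η` in the Lipschitz case. -/
structure LipschitzConstants (r τ c₀ c₃ c₄ c₅ c₆ γ C C₁ K η : ℝ) : Prop where
  γ_pos : 0 < γ
  γ_eq : 2 * c₀ * r = (τ - 1) * γ
  C_eq : C = 2 * c₅ + 2 * c₄ + 2
  C₁_eq : C₁ = 2 * √r * (c₃ + c₄ * γ)
  K_eq : K = C₁ * (1 + C + c₄) + c₆ * C + C₁ * c₆ * C + C₁ * c₄ * C₁ * C + C₁ * C + C₁ * c₄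
  η_pos : 0 < η
  η_le : η ≤ 1 / 8
  hε : 4 * C * (η * (c₆ + c₄ * C₁)) ≤ 1
  hεr : η * (c₆ + c₄ * C₁) * √r ≤ 1 / 2
  hK : η * (2 * K) ≤ τ - 1
  hK₀ : η * (K * (c₀ + c₃ + γ)) ≤ c₀

/-- γ is dictated by the stopping argument with a = 2c₀; every remaining condition is linear in η
with a positive right-hand side. -/
lemma exists_lipschitzConstants (hr : 1 < r) (hτ : 1 < τ) (h₀ : 0 < c₀) :
    ∃ γ C C₁ K η, LipschitzConstants r τ c₀ c₃ c₄ c₅ c₆ γ C C₁ K η := by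
  set γ := 2 * c₀ * r / (τ - 1)
  set C := 2 * c₅ + 2 * c₄ + 2 with hC
  set C₁ := 2 * √r * (c₃ + c₄ * γ) with hC₁
  set K := C₁ * (1 + C + c₄) + c₆ * C + C₁ * c₆ * C + C₁ * c₄ * C₁ * C + C₁ * C + C₁ * c₄ with hK
  have hτ1 : 0 < τ - 1 := by linarith
  have hpos : ∀ᶠ η in 𝓝[>] (0 : ℝ), 0 < η := self_mem_nhdsWithin
  obtain ⟨η, h1, h2, h3, h4, h5, h6⟩ := (hpos.and <|
    (eventually_mul_le 1 (a := 1 / 8) (by norm_num)).and <|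
    (eventually_mul_le (4 * C * (c₆ + c₄ * C₁)) one_pos).and <|
    (eventually_mul_le ((c₆ + c₄ * C₁) * √r) (half_pos one_pos)).and <|
    (eventually_mul_le (2 * K) hτ1).and
    (eventually_mul_le (K * (c₀ + c₃ + γ)) h₀)).exists
  exact ⟨γ, C, C₁, K, η, by positivity, by simp only [γ]; field_simp, hC, hC₁, hK, h1, by linarith,
    by linarith, by linarith, h5, h6⟩

/-- The a priori bounds that propagate along the iteration in the Lipschitz case. -/
structure LipschitzBounds (g : ℝ → ℝ → ℝ) (α : ℕ → ℝ) (T : X →L[𝕜] Y) (e₀ : X) (U C C₁ δ : ℝ)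
    (e : ℕ → X) (k : ℕ) : Prop where
  le_sqrt : ‖e k‖ ≤ C₁ * √(α k) * U
  le_two_mul : ‖e k‖ ≤ 2 * ‖e₀‖
  le_linearError : ‖e k‖ ≤ C * (linearError g α T e₀ k + δ / √(α k))

set_option maxHeartbeats 400000 in
-- The induction step. While δ < γ α_k‖u‖, the propagated noise δ/√α_k is at most γ‖u‖√α_k, so it
-- obeys the same √α_k-bound as the linear method applied to T*u.
lemma lipschitz_estimates (hg : IsFilterFamily g c₀ c₁ c₂ c₃ c₄) (hα : IsParameterSequence α r)
    (hr : 1 < r) (hc₅ : ResidualRatioBound g α c₅) (hc₆ : CommutatorBounds 𝕜 X Y g c₆)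
    (hF : IsScaledOperator 𝕜 F D xd ρ g (α 0) c₃ β₀) (hL : LipschitzDeriv 𝕜 F xd ρ L)
    (hL0 : 0 ≤ L) (hρ : 4 * ‖x₀ - xd‖ < ρ) (hK : LipschitzConstants r τ c₀ c₃ c₄ c₅ c₆ γ C C₁ K η)
    (hu : x₀ - xd = ContinuousLinearMap.adjoint (fderiv 𝕜 F xd) u) (hLu : L * ‖u‖ ≤ η)
    (hδ : 0 < δ) (hy : ‖y - F xd‖ ≤ δ) (hsmall : c₄ * √(δ * (γ * ‖u‖)) ≤ ‖x₀ - xd‖ / 2) {k : ℕ}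
    (hP : LipschitzBounds g α (fderiv 𝕜 F xd) (x₀ - xd) ‖u‖ C C₁ δ
      (fun j => newtonSeq 𝕜 F g α x₀ y j - xd) k) (hk : δ < γ * (α k * ‖u‖)) :
    LipschitzBounds g α (fderiv 𝕜 F xd) (x₀ - xd) ‖u‖ C C₁ δ
      (fun j => newtonSeq 𝕜 F g α x₀ y j - xd) (k + 1) ∧
    ‖newtonSeq 𝕜 F g α x₀ y (k + 1) - xd
        - opFun (residual g (α k)) (normalOp (fderiv 𝕜 F xd)) (x₀ - xd)‖
      ≤ η * (c₆ + c₄ * C₁) * ‖newtonSeq 𝕜 F g α x₀ y k - xd‖ + c₄ * (δ / √(α k)) ∧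
    ‖F (newtonSeq 𝕜 F g α x₀ y (k + 1)) - y‖
      ≤ ‖fderiv 𝕜 F xd (opFun (residual g (α k)) (normalOp (fderiv 𝕜 F xd)) (x₀ - xd))‖ + δ
        + η * K * (linearResidual g α (fderiv 𝕜 F xd) (x₀ - xd) k + δ) := by
  have hρ0 : 0 < ρ := (by positivity : 0 ≤ 4 * ‖x₀ - xd‖).trans_lt hρ
  have hball : ∀ {x : X}, ‖x - xd‖ ≤ 2 * ‖x₀ - xd‖ → x ∈ Metric.ball xd ρ := fun {x} hx => by
    rw [mem_ball_iff_norm]; linarith [norm_nonneg (x₀ - xd)]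
  have hxd : xd ∈ Metric.ball xd ρ := Metric.mem_ball_self hρ0
  have hT := hF.norm_sq_le hxd
  obtain ⟨hP1, hP2, hP3⟩ := hP
  have hc₄ := hg.c₄_nonneg
  have hc₃ := hg.c₃_pos
  have hc6 := hc₆.c₆_pos
  have hγ := hK.γ_pos
  have hη := hK.η_pos
  have hs := hα.sqrt_pos k
  have hC₁ : 0 ≤ C₁ := by rw [hK.C₁_eq]; positivity
  have hC2 : 2 ≤ C := by rw [hK.C_eq]; linarith [hc₅.1]
  obtain ⟨S1, S2⟩ := lipschitz_step hg hc₆ hF hL hL0 hu hy (hα.pos k) rfl rfl (hball hP2)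
  set E := ‖newtonSeq 𝕜 F g α x₀ y k - xd‖ with hE
  set e' := newtonSeq 𝕜 F g α x₀ y (k + 1) - xd with he'
  set s := √(α k)
  set T := fderiv 𝕜 F xd
  set z := opFun (residual g (α k)) (normalOp T) (x₀ - xd) with hz
  have hE0 : 0 ≤ E := norm_nonneg _
  have hLE : L * E ≤ C₁ * η * s := by
    calc L * E ≤ L * (C₁ * s * ‖u‖) := by gcongr
      _ = C₁ * (L * ‖u‖) * s := by ring
      _ ≤ _ := by gcongr
  have A1 := lipschitz_first_estimate hs hE0 hc₄ hc6.le hLu hLE S1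
  set ε := η * (c₆ + c₄ * C₁) with hε
  have hε0 : 0 ≤ ε := by positivity
  have hCε : 4 * C * ε ≤ 1 := hK.hε
  have hε4 : ε ≤ 1 / 8 := by
    have : 4 * 2 * ε ≤ 4 * C * ε := by gcongr
    linarith
  have hE' : ‖e'‖ ≤ ‖z‖ + (ε * E + c₄ * (δ / s)) := by
    have := norm_sub_norm_le e' z
    linarith
  have hds : δ / s ≤ γ * ‖u‖ * s := by
    rw [div_le_iff₀ hs]
    have hss : s * s = α k := Real.mul_self_sqrt (hα.pos k).le
    rw [mul_assoc, hss]
    linarith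
  -- A second noise bound that vanishes with δ; it confines the iterates to 2‖x₀ − xd‖ independently
  -- of γ.
  have hds2 : δ / s ≤ √(δ * (γ * ‖u‖)) := by
    refine Real.le_sqrt_of_sq_le ?_
    rw [div_pow, Real.sq_sqrt (hα.pos k).le, div_le_iff₀ (hα.pos k), pow_two, mul_assoc]
    exact mul_le_mul_of_nonneg_left (by linarith) hδ.le
  have hs' := hα.sqrt_le_mul (by linarith) k
  have hz1 : ‖z‖ ≤ c₃ * s * ‖u‖ := by
    rw [hz, hu]
    exact hg.norm_residual_adjoint_apply_le hT (hα.pos k) u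
  have hz2 : ‖z‖ ≤ ‖x₀ - xd‖ := hg.norm_residual_apply_le hT (hα.pos k) _
  have hP1' : ‖e'‖ ≤ C₁ * √(α (k + 1)) * ‖u‖ := by
    have h1 : ‖e'‖ ≤ (c₃ + c₄ * γ + ε * C₁) * ‖u‖ * s := by
      have h2 : ε * E ≤ ε * (C₁ * s * ‖u‖) := by gcongr
      have h3 : c₄ * (δ / s) ≤ c₄ * (γ * ‖u‖ * s) := by gcongr
      linarith
    -- C₁ is twice √r(c₃ + c₄γ): half pays for passing from α_k to α_{k+1}, the other half absorbs
    -- the feedback ε C₁.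
    have h4 : (c₃ + c₄ * γ + ε * C₁) * √r ≤ C₁ := by
      have h5 : ε * √r * C₁ ≤ 1 / 2 * C₁ := by gcongr; exact hK.hεr
      have h6 : (c₃ + c₄ * γ) * √r = 1 / 2 * C₁ := by rw [hK.C₁_eq]; ring
      have h7 : (c₃ + c₄ * γ + ε * C₁) * √r = (c₃ + c₄ * γ) * √r + ε * √r * C₁ := by ring
      linarith
    calc ‖e'‖ ≤ (c₃ + c₄ * γ + ε * C₁) * ‖u‖ * s := h1
      _ ≤ (c₃ + c₄ * γ + ε * C₁) * ‖u‖ * (√r * √(α (k + 1))) := by gcongr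
      _ = (c₃ + c₄ * γ + ε * C₁) * √r * √(α (k + 1)) * ‖u‖ := by ring
      _ ≤ _ := by gcongr
  have hP2' : ‖e'‖ ≤ 2 * ‖x₀ - xd‖ := by
    have h1 : c₄ * (δ / s) ≤ ‖x₀ - xd‖ / 2 := le_trans (by gcongr) hsmall
    have h2 : ε * E ≤ 1 / 8 * (2 * ‖x₀ - xd‖) := by gcongr
    linarith [norm_nonneg (x₀ - xd)]
  have hφ := linearError_le_mul_succ hg hα hc₅ hT (x₀ - xd) k
  have hP3' : ‖e'‖ ≤ C * (linearError g α T (x₀ - xd) (k + 1) + δ / √(α (k + 1))) := by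
    have hC := hK.C_eq
    refine error_bound_step (c := c₄) (c₅ := c₅) (ε := ε) (linearError_nonneg _ _)
      (by positivity : 0 ≤ δ / s) hc₅.1.le hε0 ?_ (by linarith [hc₅.1]) (by linarith [hc₅.1]) hP3
      (by change ‖e'‖ ≤ ‖z‖ + _ + _; linarith) hφ (hα.div_sqrt_mono hδ.le (Nat.le_succ k))
    have h2 : ε * (2 * c₅) ≤ ε * C := by gcongr; linarith
    linarith
  refine ⟨⟨hP1', hP2', hP3'⟩, A1, ?_⟩
  have hLE' : L * ‖e'‖ ≤ C₁ * η * s := by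
    have h1 : √(α (k + 1)) ≤ s := Real.sqrt_le_sqrt (hα.antitone (Nat.le_succ k))
    calc L * ‖e'‖ ≤ L * (C₁ * s * ‖u‖) := by
          gcongr
          exact hP1'.trans (by gcongr)
      _ = C₁ * (L * ‖u‖) * s := by ring
      _ ≤ _ := by gcongr
  have hψ0 : 0 ≤ linearResidual g α T (x₀ - xd) k := linearResidual_nonneg _ _
  have hsφ : s * linearError g α T (x₀ - xd) k ≤ linearResidual g α T (x₀ - xd) k :=
    sqrt_mul_linearError_le _ _
  have hsd : s * (δ / s) = δ := by field_simp
  have hsE : s * E ≤ C * (linearResidual g α T (x₀ - xd) k + δ) := by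
    calc s * E ≤ s * (C * (linearError g α T (x₀ - xd) k + δ / s)) := by gcongr
      _ = C * (s * linearError g α T (x₀ - xd) k + s * (δ / s)) := by ring
      _ ≤ _ := by rw [hsd]; gcongr
  have hsE' : s * ‖e'‖ ≤ (1 + C + c₄) * (linearResidual g α T (x₀ - xd) k + δ) := by
    have h1 : s * ‖e'‖ ≤ s * (‖z‖ + (1 * E + c₄ * (δ / s))) := by
      gcongr
      exact hE'.trans (by gcongr; linarith)
    have h2 : s * (‖z‖ + (1 * E + c₄ * (δ / s)))
        = s * ‖z‖ + s * E + c₄ * (s * (δ / s)) := by ring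
    have h3 : s * ‖z‖ ≤ linearResidual g α T (x₀ - xd) k := hsφ
    rw [h2, hsd] at h1
    have h4 : c₄ * δ ≤ c₄ * (linearResidual g α T (x₀ - xd) k + δ) := by gcongr; linarith
    linarith
  rw [hK.K_eq]
  exact lipschitz_second_estimate hs hE0 (norm_nonneg _) hL0 hc₄ hc6.le hC₁ hψ0 hδ.le hη.le
    (by linarith [hK.η_le]) hLu hLE hLE' hsE hsE' (S2 (hball hP2'))

end LipschitzCase

/-! ### The Lipschitz case: stopping and convergence rate -/

section LipschitzCase

variable {𝕜 X Y : Type*} [RCLike 𝕜]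
  [NormedAddCommGroup X] [InnerProductSpace 𝕜 X] [CompleteSpace X]
  [NormedAddCommGroup Y] [InnerProductSpace 𝕜 Y] [CompleteSpace Y]
  {F : X → Y} {D : Set X} {xd x₀ : X} {ρ r τ : ℝ} {g : ℝ → ℝ → ℝ} {α : ℕ → ℝ}
  {c₀ c₁ c₂ c₃ c₄ c₅ c₆ β₀ L δ η γ C C₁ K : ℝ} {u y : Y}

/-- `exists_stopping` with weights α_k‖u‖: the linear residual of T*u is at most c₀ α_k‖u‖, and the
choice of η keeps the nonlinear correction below another c₀ α_k‖u‖. -/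
lemma lipschitz_stopping (hg : IsFilterFamily g c₀ c₁ c₂ c₃ c₄) (hα : IsParameterSequence α r)
    (hr : 1 < r) (hτ : 1 < τ) (hc₅ : ResidualRatioBound g α c₅)
    (hc₆ : CommutatorBounds 𝕜 X Y g c₆)
    (hF : IsScaledOperator 𝕜 F D xd ρ g (α 0) c₃ β₀) (hL : LipschitzDeriv 𝕜 F xd ρ L)
    (hL0 : 0 ≤ L) (hρ : 4 * ‖x₀ - xd‖ < ρ) (hK : LipschitzConstants r τ c₀ c₃ c₄ c₅ c₆ γ C C₁ K η)
    (hu : x₀ - xd = ContinuousLinearMap.adjoint (fderiv 𝕜 F xd) u) (hLu : L * ‖u‖ ≤ η)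
    (hδ : 0 < δ) (hy : ‖y - F xd‖ ≤ δ) (hsmall : c₄ * √(δ * (γ * ‖u‖)) ≤ ‖x₀ - xd‖ / 2)
    (hsmall0 : δ < γ * (α 0 * ‖u‖)) :
    ∃ k, IsStoppingIndex F (newtonSeq 𝕜 F g α x₀ y) y τ δ k ∧
      (∀ j ≤ k, LipschitzBounds g α (fderiv 𝕜 F xd) (x₀ - xd) ‖u‖ C C₁ δ
        (fun j => newtonSeq 𝕜 F g α x₀ y j - xd) j) ∧
      ∀ j < k, δ < γ * (α j * ‖u‖) := by
  have hρ0 : 0 < ρ := (by positivity : 0 ≤ 4 * ‖x₀ - xd‖).trans_lt hρ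
  have hxd : xd ∈ Metric.ball xd ρ := Metric.mem_ball_self hρ0
  have hT := hF.norm_sq_le hxd
  have hc₀ := hg.c₀_pos
  have hc₃ := hg.c₃_pos
  have hc₄ := hg.c₄_nonneg
  have hγ := hK.γ_pos
  have hη := hK.η_pos
  have hr1 : 1 ≤ √r := Real.one_le_sqrt.2 hr.le
  have hest := fun {k : ℕ} => lipschitz_estimates (k := k) hg hα hr hc₅ hc₆ hF hL hL0 hρ hK hu hLu
    hδ hy hsmall
  have hbase : LipschitzBounds g α (fderiv 𝕜 F xd) (x₀ - xd) ‖u‖ C C₁ δ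
      (fun j => newtonSeq 𝕜 F g α x₀ y j - xd) 0 := by
    refine ⟨?_, ?_, ?_⟩
    · change ‖x₀ - xd‖ ≤ _
      have hT3 := (hF.norm_fderiv_le xd hxd).trans (min_le_left _ _)
      rw [hu]
      refine (ContinuousLinearMap.le_of_opNorm_le _ (c := c₃ * √(α 0)) ?_ u).trans ?_
      · rw [LinearIsometryEquiv.norm_map]; exact hT3
      · have : c₃ ≤ C₁ := by
          rw [hK.C₁_eq]
          have h5 : c₃ ≤ c₃ + c₄ * γ := le_add_of_nonneg_right (by positivity)
          have h6 : (1 : ℝ) ≤ 2 * √r := by linarith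
          calc c₃ ≤ c₃ + c₄ * γ := h5
            _ ≤ _ := le_mul_of_one_le_left (by positivity) h6
        gcongr
    · change ‖x₀ - xd‖ ≤ _
      linarith [norm_nonneg (x₀ - xd)]
    · change ‖x₀ - xd‖ ≤ _
      have h5 := hg.norm_le_mul_residual hF.β₀_le (hF.norm_sq_le_β₀ hxd) (hα.pos 0) hF.residual_ge
        (x₀ - xd)
      change _ ≤ 4 / 3 * linearError g α (fderiv 𝕜 F xd) (x₀ - xd) 0 at h5
      have h6 : 0 ≤ linearError g α (fderiv 𝕜 F xd) (x₀ - xd) 0 := linearError_nonneg _ _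
      have h7 : 4 / 3 ≤ C := by rw [hK.C_eq]; linarith [hc₅.1]
      have h8 : 0 ≤ δ / √(α 0) := by positivity
      calc _ ≤ 4 / 3 * (linearError g α (fderiv 𝕜 F xd) (x₀ - xd) 0 + δ / √(α 0)) := by linarith
        _ ≤ _ := by gcongr
  have hres : ∀ k, LipschitzBounds g α (fderiv 𝕜 F xd) (x₀ - xd) ‖u‖ C C₁ δ
        (fun j => newtonSeq 𝕜 F g α x₀ y j - xd) k →
      LipschitzBounds g α (fderiv 𝕜 F xd) (x₀ - xd) ‖u‖ C C₁ δ
        (fun j => newtonSeq 𝕜 F g α x₀ y j - xd) (k + 1) →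
      δ < γ * (α k * ‖u‖) →
      ‖F (newtonSeq 𝕜 F g α x₀ y (k + 1)) - y‖ ≤ δ + 2 * c₀ * (α k * ‖u‖) := by
    intro k hP _ hk
    have h5 := (hest hP hk).2.2
    have hαk := (hα.pos k).le
    have h6 : ‖fderiv 𝕜 F xd (opFun (residual g (α k)) (normalOp (fderiv 𝕜 F xd)) (x₀ - xd))‖
        ≤ c₀ * α k * ‖u‖ := by
      rw [hu]; exact hg.norm_comp_residual_adjoint_apply_le hT (hα.pos k) u
    have h7 : linearError g α (fderiv 𝕜 F xd) (x₀ - xd) k ≤ c₃ * √(α k) * ‖u‖ := by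
      rw [linearError, hu]; exact hg.norm_residual_adjoint_apply_le hT (hα.pos k) u
    have h8 : √(α k) * linearError g α (fderiv 𝕜 F xd) (x₀ - xd) k ≤ c₃ * (α k * ‖u‖) := by
      calc _ ≤ √(α k) * (c₃ * √(α k) * ‖u‖) := by gcongr
        _ = c₃ * (√(α k) * √(α k) * ‖u‖) := by ring
        _ = _ := by rw [Real.mul_self_sqrt hαk]
    have h9 : linearResidual g α (fderiv 𝕜 F xd) (x₀ - xd) k + δ
        ≤ (c₀ + c₃ + γ) * (α k * ‖u‖) := by
      rw [linearResidual]; linarith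
    have hK0 : 0 ≤ K := by
      have h6 := hc₆.c₆_pos
      have h51 := hc₅.1
      have hC₁ : 0 ≤ C₁ := by rw [hK.C₁_eq]; positivity
      have hC : 0 ≤ C := by rw [hK.C_eq]; linarith
      rw [hK.K_eq]
      positivity
    have h10 : η * K * (linearResidual g α (fderiv 𝕜 F xd) (x₀ - xd) k + δ)
        ≤ c₀ * (α k * ‖u‖) := by
      calc _ ≤ η * K * ((c₀ + c₃ + γ) * (α k * ‖u‖)) := by gcongr
        _ = η * (K * (c₀ + c₃ + γ)) * (α k * ‖u‖) := by ring
        _ ≤ _ := by gcongr; exact hK.hK₀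
    linarith
  obtain ⟨k, h1, h2, h3, h4⟩ := exists_stopping (ρ := fun k => ‖F (newtonSeq 𝕜 F g α x₀ y k) - y‖)
    (P := LipschitzBounds g α (fderiv 𝕜 F xd) (x₀ - xd) ‖u‖ C C₁ δ
      (fun j => newtonSeq 𝕜 F g α x₀ y j - xd)) (w := fun k => α k * ‖u‖) (a := 2 * c₀) (r := r)
    (τ := τ) (γ := γ)
    hδ (by positivity) (fun k => mul_nonneg (hα.pos k).le (norm_nonneg _))
    (by simpa using hα.tendsto_zero.mul_const ‖u‖)
    (fun k => by
      have := mul_le_mul_of_nonneg_right (hα.le_mul k) (norm_nonneg u)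
      linarith)
    hsmall0 hbase (fun k hP hk => (hest hP hk).1) hres hK.γ_eq.le hτ
  exact ⟨k, ⟨h1, h2⟩, h3, h4⟩

/-- At the stopping index the source representation gives the rate `O(δ^{1/2})`. -/
lemma lipschitz_error_sq_le (hg : IsFilterFamily g c₀ c₁ c₂ c₃ c₄)
    (hα : IsParameterSequence α r) {T : X →L[𝕜] Y} (hT : ‖T‖ ^ 2 ≤ 1 / 2) {e : ℕ → X} {N : ℕ}
    {ε : ℝ} (hu : e 0 = ContinuousLinearMap.adjoint T u) (hδ : 0 ≤ δ) (hC : 0 ≤ C)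
    (hε : 0 ≤ ε) (hCε : 4 * C * ε ≤ 1) (hτ : 1 < τ)
    (hE : ∀ k ≤ N, ‖e k‖ ≤ C * (linearError g α T (e 0) k + δ / √(α k)))
    (hstep : ∀ k < N, ‖e (k + 1) - opFun (residual g (α k)) (normalOp T) (e 0)‖
      ≤ ε * ‖e k‖ + c₄ * (δ / √(α k)))
    (hγ : ∀ k < N, δ < γ * (α k * ‖u‖)) (hγ0 : 0 ≤ γ)
    (hTe : ‖T (e N)‖ ≤ (1 + τ) * δ + L * ‖e N‖ ^ 2) (hLu : L * ‖u‖ ≤ 1 / 8) :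
    ‖e N‖ ^ 2 ≤ 4 * ((1 + τ) + 2 * (2 * c₄ + 1) ^ 2 * γ) * ‖u‖ * δ := by
  have hc₄ := hg.c₄_nonneg
  have hTu : ‖T (e N)‖ * ‖u‖ ≤ (1 + τ) * δ * ‖u‖ + ‖e N‖ ^ 2 / 8 := by
    have h1 := mul_le_mul_of_nonneg_right hTe (norm_nonneg u)
    have h2 := mul_le_mul_of_nonneg_right hLu (sq_nonneg ‖e N‖)
    linarith
  have hτδ : 0 ≤ (1 + τ) * δ * ‖u‖ := by positivity
  have hγδ : 0 ≤ 2 * (2 * c₄ + 1) ^ 2 * γ * ‖u‖ * δ := by positivity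
  rcases Nat.eq_zero_or_eq_succ_pred N with h0 | hN
  · rw [h0] at hTu ⊢
    have h1 : ‖e 0‖ ^ 2 ≤ ‖T (e 0)‖ * ‖u‖ := by
      rw [← inner_self_eq_norm_sq (𝕜 := 𝕜)]
      conv_lhs => rw [show inner 𝕜 (e 0) (e 0) = inner 𝕜 (e 0) (ContinuousLinearMap.adjoint T u) by
        rw [← hu]]
      rw [ContinuousLinearMap.adjoint_inner_right]
      exact re_inner_le_norm _ _
    linarith
  · set k := N.pred
    have hkN : k < N := by omega
    have hstepk := hstep k hkN
    have hγk := hγ k hkN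
    rw [← Nat.succ_eq_add_one, ← hN] at hstepk
    have hs := hα.sqrt_pos k
    set d := δ / √(α k) with hd
    have hd0 : 0 ≤ d := by positivity
    set R := opFun (residual g (α k)) (normalOp T) with hR
    have hφk : linearError g α T (e 0) k ≤ ‖e N‖ + (ε * ‖e k‖ + c₄ * d) := by
      have := norm_sub_norm_le (R (e 0)) (e N)
      rw [norm_sub_rev] at this
      change linearError g α T (e 0) k - _ ≤ _ at this
      linarith
    have hεE := mul_prev_error_le hC hε hCε (norm_nonneg _) (norm_nonneg _) hd0 hc₄
      (hE k hkN.le) hφk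
    -- Pair e_N with R e_0 = R T*u: moving R and T* across gives ⟨T R e_N, u⟩, and ‖T R e_N‖ ≤ ‖T
    -- e_N‖.
    have h1 : ‖e N‖ ^ 2 ≤ ‖T (e N)‖ * ‖u‖ + ‖e N‖ * ‖e N - R (e 0)‖ := by
      have h2 : ‖e N‖ ^ 2 = RCLike.re (inner 𝕜 (e N) (R (e 0)))
          + RCLike.re (inner 𝕜 (e N) (e N - R (e 0))) := by
        rw [← map_add, ← inner_add_right, add_sub_cancel, inner_self_eq_norm_sq]
      rw [h2]
      refine add_le_add ?_ (re_inner_le_norm _ _)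
      rw [hu, hR, ← opFun_symm (spectrumIn_normalOp hT) le_rfl (hg.residual_continuousOn (hα.pos k)),
        ContinuousLinearMap.adjoint_inner_right]
      refine (re_inner_le_norm _ _).trans ?_
      gcongr
      exact hg.norm_comp_residual_apply_le_self hT (hα.pos k) _
    have h3 : ‖e N‖ * ‖e N - R (e 0)‖ ≤ ‖e N‖ * (‖e N‖ / 2 + (2 * c₄ + 1) * d) := by
      gcongr
      linarith
    have h4 : ‖e N‖ * ((2 * c₄ + 1) * d) ≤ ‖e N‖ ^ 2 / 8 + 2 * ((2 * c₄ + 1) * d) ^ 2 := by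
      nlinarith [sq_nonneg (‖e N‖ / 4 - (2 * c₄ + 1) * d), sq_nonneg (‖e N‖ - 4 * ((2 * c₄ + 1) * d))]
    -- Before stopping δ < γ α_k‖u‖, so δ²/α_k is of order δ.
    have h5 : d ^ 2 ≤ γ * ‖u‖ * δ := by
      rw [hd, div_pow, Real.sq_sqrt (hα.pos k).le, div_le_iff₀ (hα.pos k)]
      nlinarith
    have h6 : 2 * ((2 * c₄ + 1) * d) ^ 2 ≤ 2 * (2 * c₄ + 1) ^ 2 * (γ * ‖u‖ * δ) := by
      rw [mul_pow, ← mul_assoc]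
      gcongr
    nlinarith

/-- What remains for `isLittleO_of_estimates` is the bound on T e at the stopping index. Taylor
leaves L‖e‖² there, which ‖e‖² = O(δ) turns into a small multiple of √α_m ‖e‖ for α_m ≥ cδ. -/
theorem lipschitz_convergence (hg : IsFilterFamily g c₀ c₁ c₂ c₃ c₄)
    (hα : IsParameterSequence α r) (hr : 1 < r) (hτ : 1 < τ) (hc₅ : ResidualRatioBound g α c₅)
    (hc₆ : CommutatorBounds 𝕜 X Y g c₆) {q : ℝ≥0∞} (hq : IsQualification g q)
    (hF : IsScaledOperator 𝕜 F D xd ρ g (α 0) c₃ β₀) (hL : LipschitzDeriv 𝕜 F xd ρ L)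
    (hL0 : 0 ≤ L) (hρ : 4 * ‖x₀ - xd‖ < ρ) (hK : LipschitzConstants r τ c₀ c₃ c₄ c₅ c₆ γ C C₁ K η)
    {ν : ℝ} {ω : X} (hν : 1 / 2 ≤ ν) (hνq : ENNReal.ofReal (ν + 1 / 2) < q)
    (hω : ω ∈ (LinearMap.ker (fderiv 𝕜 F xd).toLinearMap)ᗮ)
    (hs : SourceCondition 𝕜 F xd x₀ ν ω)
    (hu : x₀ - xd = ContinuousLinearMap.adjoint (fderiv 𝕜 F xd) u) (hLu : L * ‖u‖ ≤ η)
    {yd : ℝ → Y} (hyd : ∀ δ : ℝ, 0 < δ → ‖yd δ - F xd‖ ≤ δ) :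
    EventuallyWellDefined 𝕜 F g α x₀ xd ρ τ yd ∧
      ∀ kd : ℝ → ℕ,
        (∀ᶠ δ in 𝓝[>] (0 : ℝ),
          IsStoppingIndex F (newtonSeq 𝕜 F g α x₀ (yd δ)) (yd δ) τ δ (kd δ)) →
        (fun δ : ℝ => newtonSeq 𝕜 F g α x₀ (yd δ) (kd δ) - xd)
          =o[𝓝[>] (0 : ℝ)] (fun δ : ℝ => δ ^ (2 * ν / (1 + 2 * ν))) := by
  have hρ0 : 0 < ρ := (by positivity : 0 ≤ 4 * ‖x₀ - xd‖).trans_lt hρ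
  have hxd : xd ∈ Metric.ball xd ρ := Metric.mem_ball_self hρ0
  -- Separated because the smallness thresholds on δ degenerate when the initial error vanishes.
  by_cases h0 : x₀ = xd
  · exact ⟨eventuallyWellDefined_of_eq hτ hρ0 h0 hyd, fun kd hkd => isLittleO_of_eq hτ h0 hyd hkd _⟩
  have hT := hF.norm_sq_le hxd
  have hc₄ := hg.c₄_nonneg
  have hc₃ := hg.c₃_pos
  have hc6 := hc₆.c₆_pos
  have h51 := hc₅.1
  have hγ := hK.γ_pos
  have hη := hK.η_pos
  have hC₁ : 0 ≤ C₁ := by rw [hK.C₁_eq]; positivity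
  have hC : 0 ≤ C := by rw [hK.C_eq]; linarith
  have hK0 : 0 ≤ K := by rw [hK.K_eq]; positivity
  have he0 : 0 < ‖x₀ - xd‖ := norm_pos_iff.2 (sub_ne_zero.2 h0)
  have hu0 : 0 < ‖u‖ := by
    refine norm_pos_iff.2 fun h => h0 (sub_eq_zero.1 ?_)
    rw [hu, h, map_zero]
  have hsmall : ∀ᶠ δ in 𝓝[>] (0 : ℝ), c₄ * √(δ * (γ * ‖u‖)) ≤ ‖x₀ - xd‖ / 2 := by
    have hcont : Continuous fun δ : ℝ => c₄ * √(δ * (γ * ‖u‖)) := by fun_prop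
    have := (hcont.tendsto 0).mono_left (nhdsWithin_le_nhds (s := Set.Ioi 0))
    simp only [zero_mul, Real.sqrt_zero, mul_zero] at this
    exact this.eventually_le_const (half_pos he0)
  have hsmall0 : ∀ᶠ δ in 𝓝[>] (0 : ℝ), δ < γ * (α 0 * ‖u‖) :=
    (tendsto_id.mono_left nhdsWithin_le_nhds).eventually_lt_const
      (mul_pos hγ (mul_pos (hα.pos 0) hu0))
  have hpos : ∀ᶠ δ in 𝓝[>] (0 : ℝ), 0 < δ := self_mem_nhdsWithin
  have hball : ∀ {x : X}, ‖x - xd‖ ≤ 2 * ‖x₀ - xd‖ → x ∈ Metric.ball xd ρ := fun {x} hx => by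
    rw [mem_ball_iff_norm]; linarith
  refine ⟨?_, fun kd hkd => ?_⟩
  · filter_upwards [hsmall, hsmall0, hpos] with δ h1 h2 hδ
    obtain ⟨k, hk, hP, -⟩ := lipschitz_stopping hg hα hr hτ hc₅ hc₆ hF hL hL0 hρ hK hu hLu hδ
      (hyd δ hδ) h1 h2
    exact ⟨k, hk, fun j hj => hball (hP j hj).le_two_mul⟩
  · set κ := 1 / (4 * (c₄ + 1)) with hκ
    have hκ0 : 0 < κ := by positivity
    set C₂ := 4 * ((1 + τ) + 2 * (2 * c₄ + 1) ^ 2 * γ) * ‖u‖ with hC₂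
    refine isLittleO_of_estimates hg hα hr hc₅ hq hT (by linarith) hνq hω hs
      (e := fun δ j => newtonSeq 𝕜 F g α x₀ (yd δ) j - xd)
      (ρ := fun δ j => ‖F (newtonSeq 𝕜 F g α x₀ (yd δ) j) - yd δ‖) (N := kd)
      (ε := η * (c₆ + c₄ * C₁)) (ε' := η * K) (C := C) (C' := 1 + η * K) (Ct := 1 + τ)
      (c := L ^ 2 * C₂ / κ ^ 2) (κ := κ) hτ hC (by positivity) (by positivity) hK.hε
      (by linarith [hK.hK]) ?_ (by linarith) (Or.inr hν) (fun δ => rfl) ?_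
    · rw [hκ]
      have : 4 * (c₄ * (1 / (4 * (c₄ + 1)))) = c₄ / (c₄ + 1) := by field_simp
      rw [this, div_le_one (by positivity)]
      linarith
    filter_upwards [hsmall, hsmall0, hpos, hkd] with δ h1 h2 hδ hkδ
    obtain ⟨k, hk, hP, hkγ⟩ := lipschitz_stopping hg hα hr hτ hc₅ hc₆ hF hL hL0 hρ hK hu hLu hδ
      (hyd δ hδ) h1 h2
    obtain rfl := hk.unique hkδ
    have hest := fun (j : ℕ) (hj : j < kd δ) => (lipschitz_estimates hg hα hr hc₅ hc₆ hF hL hL0 hρ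
      hK hu hLu hδ (hyd δ hδ) h1 (hP j hj.le) (hkγ j hj)).2
    refine ⟨fun j hj => (hP j hj).le_linearError, fun j hj => (hest j hj).1, fun j hj => ?_,
      hkδ.2, fun m _ hcm => ?_⟩
    · refine (hest j hj).2.trans ?_
      have h3 : ‖fderiv 𝕜 F xd (opFun (residual g (α j)) (normalOp (fderiv 𝕜 F xd)) (x₀ - xd))‖
        ≤ linearResidual g α (fderiv 𝕜 F xd) (x₀ - xd) j := norm_comp_le_linearResidual _ _
      linarith
    · set E := ‖newtonSeq 𝕜 F g α x₀ (yd δ) (kd δ) - xd‖ with hE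
      have hTe : ‖fderiv 𝕜 F xd (newtonSeq 𝕜 F g α x₀ (yd δ) (kd δ) - xd)‖
          ≤ (1 + τ) * δ + L * E ^ 2 := by
        have h3 := norm_taylor_le_of_lipschitz hF hL hL0 (hball (hP _ le_rfl).le_two_mul) hxd
        have h4 := hkδ.1
        have h5 := hyd δ hδ
        set x := newtonSeq 𝕜 F g α x₀ (yd δ) (kd δ)
        have e : fderiv 𝕜 F xd (x - xd) = (F x - yd δ) + (yd δ - F xd)
            - (F x - F xd - fderiv 𝕜 F xd (x - xd)) := by abel
        rw [e]
        refine (norm_sub_le _ _).trans (add_le_add ((norm_add_le _ _).trans ?_) h3)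
        linarith
      have hsq := lipschitz_error_sq_le hg hα hT (e := fun j => newtonSeq 𝕜 F g α x₀ (yd δ) j - xd)
        (N := kd δ) (u := u) (ε := η * (c₆ + c₄ * C₁)) hu hδ.le hC (by positivity) hK.hε hτ
        (fun j hj => (hP j hj).le_linearError) (fun j hj => (hest j hj).1) hkγ hγ.le hTe
        (hLu.trans hK.η_le)
      change E ^ 2 ≤ C₂ * δ at hsq
      -- The constant c = L² C₂/κ² is exactly what makes L² C₂ δ ≤ κ² α_m.
      have hLE : L * E ≤ κ * √(α m) := by
        refine (sq_le_sq₀ (by positivity) (by positivity)).1 ?_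
        rw [mul_pow, mul_pow, Real.sq_sqrt (hα.pos m).le]
        calc L ^ 2 * E ^ 2 ≤ L ^ 2 * (C₂ * δ) := by gcongr
          _ = κ ^ 2 * (L ^ 2 * C₂ / κ ^ 2 * δ) := by field_simp
          _ ≤ κ ^ 2 * α m := by gcongr
      refine hTe.trans ?_
      have : L * E ^ 2 ≤ κ * √(α m) * E := by
        rw [pow_two, ← mul_assoc]
        gcongr
      linarith

end LipschitzCase

/-! ### Scalar estimates for the structured case -/

section StructuredNumeric

/-- Here t and t' stand for ‖T e_k‖ and ‖T e_{k+1}‖. The bound M contains t' itself, with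
coefficient at most C₁η ≤ 1/2, so t' can be absorbed. This yields a recursion for t with a small
factor, which is then fed back into the residual bound. -/
lemma structured_second_estimate {R M P ψ φ t t' nG E E' e₀ K₀ K₁ K₂ η c₈ C C₁ Ct s δ : ℝ}
    (hs : 0 < s) (hE : 0 ≤ E) (hE' : 0 ≤ E') (ht : 0 ≤ t) (ht' : 0 ≤ t')
    (hP : 0 ≤ P) (he₀ : 0 ≤ e₀)
    (hK₀ : 0 ≤ K₀) (hK₁ : 0 ≤ K₁) (hK₂ : 0 ≤ K₂) (hc₈ : 0 ≤ c₈) (hC₁ : 0 ≤ C₁)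
    (hη : 0 ≤ η) (hδ : 0 ≤ δ) (hψ : 0 ≤ ψ) (hK : (K₀ + K₁ + K₂) * e₀ ≤ η)
    (hEe : E ≤ C₁ * e₀) (hEe' : E' ≤ C₁ * e₀) (hφe : φ ≤ e₀) (hPψ : P ≤ ψ)
    (hη1 : η * (2 * C₁) ≤ 1) (hη2 : η * (2 * (5 * C₁ + 1 + 3 * c₈)) ≤ 1)
    (hη3 : η * (2 * c₈ * C) ≤ 1)
    (hsE : s * E ≤ C * (ψ + δ)) (htC : t ≤ Ct * (4 * ψ + δ)) (hCt : 0 ≤ Ct)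
    (hnG : nG ≤ t + (K₁ * E * t + K₂ * t * E))
    (hM : M ≤ (K₁ * E * t' + K₂ * t * E') + (P + (K₁ * E * P + K₂ * t * φ))
      + (c₈ * (K₀ + K₁) * s * E + c₈ * K₂ * (nG + t)) * e₀ + (K₁ + K₂) * E * nG + δ)
    (htM : t' ≤ M + δ) (hR : R ≤ M + (K₁ + K₂) * E' * t') :
    t' ≤ 4 * ψ + η * (2 * (5 * C₁ + 1 + 3 * c₈)) * t + 5 * δ ∧
    R ≤ P + δ + η * (C₁ + 2 * C₁ * (5 + 4 * Ct) + (5 * C₁ + 1 + 3 * c₈) * (4 * Ct) + c₈ * C)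
      * (ψ + δ) := by
  have hKE : ∀ {Z : ℝ}, 0 ≤ Z → Z ≤ C₁ * e₀ → (K₀ + K₁ + K₂) * Z ≤ C₁ * η := fun {Z} h0 h => by
    calc (K₀ + K₁ + K₂) * Z ≤ (K₀ + K₁ + K₂) * (C₁ * e₀) := by gcongr
      _ = C₁ * ((K₀ + K₁ + K₂) * e₀) := by ring
      _ ≤ C₁ * η := by gcongr
  have hE1 := hKE hE hEe
  have hE1' := hKE hE' hEe'
  have k0E : 0 ≤ K₀ * E := by positivity
  have k1E : 0 ≤ K₁ * E := by positivity
  have k2E : 0 ≤ K₂ * E := by positivity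
  have k0E' : 0 ≤ K₀ * E' := by positivity
  have k1E' : 0 ≤ K₁ * E' := by positivity
  have k2E' : 0 ≤ K₂ * E' := by positivity
  have k0e : 0 ≤ K₀ * e₀ := by positivity
  have k1e : 0 ≤ K₁ * e₀ := by positivity
  have k2e : 0 ≤ K₂ * e₀ := by positivity
  have hC₁η : 0 ≤ C₁ * η := by positivity
  have q1 : K₁ * E ≤ C₁ * η := by linarith
  have q2 : K₂ * E' ≤ C₁ * η := by linarith
  have q3 : (K₁ + K₂) * E ≤ C₁ * η := by linarith
  have q4 : (K₁ + K₂) * E' ≤ C₁ * η := by linarith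
  have q5 : K₂ * e₀ ≤ η := by linarith
  have q6 : (K₀ + K₁) * e₀ ≤ η := by linarith
  have a1 : K₁ * E * t' ≤ C₁ * η * t' := mul_le_mul_of_nonneg_right q1 ht'
  have a2 : K₂ * t * E' ≤ C₁ * η * t := by
    calc K₂ * t * E' = K₂ * E' * t := by ring
      _ ≤ _ := mul_le_mul_of_nonneg_right q2 ht
  have a3 : K₁ * E * P ≤ C₁ * η * P := mul_le_mul_of_nonneg_right q1 hP
  have a4 : K₂ * t * φ ≤ η * t := by
    calc K₂ * t * φ = K₂ * φ * t := by ring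
      _ ≤ K₂ * e₀ * t := by gcongr
      _ ≤ _ := mul_le_mul_of_nonneg_right q5 ht
  -- Measured on e_k, the derivatives at x_k and at xd are comparable.
  have hnG2 : nG ≤ 2 * t := by
    have h1 : (K₁ + K₂) * E * t ≤ C₁ * η * t := mul_le_mul_of_nonneg_right q3 ht
    have h2 : C₁ * η * t ≤ 1 * t := mul_le_mul_of_nonneg_right (by linarith) ht
    linarith
  have a5 : c₈ * (K₀ + K₁) * s * E * e₀ ≤ c₈ * η * (s * E) := by
    calc c₈ * (K₀ + K₁) * s * E * e₀ = c₈ * ((K₀ + K₁) * e₀) * (s * E) := by ring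
      _ ≤ _ := mul_le_mul_of_nonneg_right (mul_le_mul_of_nonneg_left q6 hc₈) (by positivity)
  have a6 : c₈ * K₂ * (nG + t) * e₀ ≤ c₈ * η * (3 * t) := by
    calc c₈ * K₂ * (nG + t) * e₀ ≤ c₈ * K₂ * (2 * t + t) * e₀ := by gcongr
      _ = c₈ * (K₂ * e₀) * (3 * t) := by ring
      _ ≤ _ := mul_le_mul_of_nonneg_right (mul_le_mul_of_nonneg_left q5 hc₈) (by positivity)
  have a7 : (K₁ + K₂) * E * nG ≤ C₁ * η * (2 * t) := by
    calc (K₁ + K₂) * E * nG ≤ (K₁ + K₂) * E * (2 * t) := by gcongr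
      _ ≤ _ := mul_le_mul_of_nonneg_right q3 (by positivity)
  have a8 : (K₁ + K₂) * E' * t' ≤ C₁ * η * t' := mul_le_mul_of_nonneg_right q4 ht'
  have hM2 : M ≤ P + δ + C₁ * η * P + C₁ * η * t' + η * (5 * C₁ + 1 + 3 * c₈) * t
      + c₈ * η * (s * E) := by
    have : 0 ≤ C₁ * η * t := by positivity
    linarith
  have hηC : C₁ * η * P ≤ 1 / 2 * P := mul_le_mul_of_nonneg_right (by linarith) hP
  have hηt : C₁ * η * t' ≤ 1 / 2 * t' := mul_le_mul_of_nonneg_right (by linarith) ht'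
  have hv : 0 ≤ ψ + δ := by positivity
  have hsE2 : c₈ * η * (s * E) ≤ c₈ * η * (C * (ψ + δ)) := by gcongr
  have hsE3 : c₈ * η * (C * (ψ + δ)) ≤ 1 / 2 * (ψ + δ) := by
    calc c₈ * η * (C * (ψ + δ)) = (c₈ * η * C) * (ψ + δ) := by ring
      _ ≤ _ := mul_le_mul_of_nonneg_right (by linarith) hv
  have ht'2 : t' ≤ 4 * ψ + η * (2 * (5 * C₁ + 1 + 3 * c₈)) * t + 5 * δ := by linarith
  refine ⟨ht'2, ?_⟩
  have ht4 : t ≤ 4 * Ct * (ψ + δ) := by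
    have : 0 ≤ Ct * δ := by positivity
    linarith
  have ht'3 : t' ≤ (5 + 4 * Ct) * (ψ + δ) := by
    have : η * (2 * (5 * C₁ + 1 + 3 * c₈)) * t ≤ 1 * t := by gcongr
    linarith
  have b1 : C₁ * η * P ≤ η * C₁ * (ψ + δ) := by
    calc C₁ * η * P ≤ C₁ * η * (ψ + δ) := by gcongr; linarith
      _ = _ := by ring
  have b2 : C₁ * η * t' ≤ C₁ * η * ((5 + 4 * Ct) * (ψ + δ)) := by gcongr
  have b3 : η * (5 * C₁ + 1 + 3 * c₈) * t ≤ η * (5 * C₁ + 1 + 3 * c₈) * (4 * Ct * (ψ + δ)) := by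
    gcongr
  linarith

end StructuredNumeric

/-! ### Taylor remainder under the variation condition on the derivative -/

section Variation

variable {𝕜 X Y : Type*} [RCLike 𝕜]
  [NormedAddCommGroup X] [InnerProductSpace 𝕜 X] [NormedAddCommGroup Y] [InnerProductSpace 𝕜 Y]
  {F : X → Y} {D : Set X} {xd : X} {ρ : ℝ} {g : ℝ → ℝ → ℝ} {c₃ β₀ K₁ K₂ : ℝ}

/-- With w = x − z both terms of the variation condition are bounded by the same product, uniformly
along the segment. -/
lemma norm_taylor_le_of_variation {α₀ : ℝ} (hF : IsScaledOperator 𝕜 F D xd ρ g α₀ c₃ β₀)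
    (hV : DerivVariation 𝕜 F xd ρ K₁ K₂) {x z : X} (hx : x ∈ Metric.ball xd ρ)
    (hz : z ∈ Metric.ball xd ρ) :
    ‖F x - F z - fderiv 𝕜 F z (x - z)‖ ≤ (K₁ + K₂) * ‖x - z‖ * ‖fderiv 𝕜 F z (x - z)‖ := by
  obtain ⟨hK₁, hK₂, hV⟩ := hV
  refine norm_map_taylor_le (𝕜 := 𝕜) (fun x hx z hz t ht => ball_segment hx hz ht)
    (fun x hx => hF.differentiableAt hx) (ContinuousLinearMap.id 𝕜 Y) hx hz fun t ht => ?_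
  refine (hV _ (ball_segment (𝕜 := 𝕜) hx hz ht) z hz (x - z)).trans ?_
  have h1 : ‖z + (t : 𝕜) • (x - z) - z‖ ≤ ‖x - z‖ := norm_segment_sub_le x z ht
  have h2 : ‖fderiv 𝕜 F z (z + (t : 𝕜) • (x - z) - z)‖ ≤ ‖fderiv 𝕜 F z (x - z)‖ := by
    rw [add_sub_cancel_left, map_smul, norm_smul, RCLike.norm_ofReal, abs_of_nonneg ht.1]
    exact mul_le_of_le_one_left (norm_nonneg _) ht.2
  calc _ ≤ K₁ * ‖x - z‖ * ‖fderiv 𝕜 F z (x - z)‖ + K₂ * ‖fderiv 𝕜 F z (x - z)‖ * ‖x - z‖ := by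
        gcongr
    _ = _ := by ring

end Variation

/-! ### One Newton step under the structure conditions -/

section StructuredStep

variable {𝕜 X Y : Type*} [RCLike 𝕜]
  [NormedAddCommGroup X] [InnerProductSpace 𝕜 X] [CompleteSpace X]
  [NormedAddCommGroup Y] [InnerProductSpace 𝕜 Y] [CompleteSpace Y]
  {F : X → Y} {D : Set X} {xd x₀ : X} {ρ : ℝ} {g : ℝ → ℝ → ℝ} {α : ℕ → ℝ}
  {c₀ c₁ c₂ c₃ c₄ c₇ c₈ β₀ K₀ K₁ K₂ δ : ℝ} {y : Y}

/-- Range invariance writes F'(w) − F'(z) as F'(z)(R − I), so g(G*G)G* meets another G and g(G*G)G*G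
is a contraction. The factor α^{-1/2} of the general bound disappears. -/
lemma norm_adjoint_taylor_le {α₀ a : ℝ} (hg : IsFilterFamily g c₀ c₁ c₂ c₃ c₄)
    (hF : IsScaledOperator 𝕜 F D xd ρ g α₀ c₃ β₀) (hR : RangeInvariance 𝕜 F xd ρ K₀)
    (ha : 0 < a) {x z : X} (hx : x ∈ Metric.ball xd ρ) (hz : z ∈ Metric.ball xd ρ) :
    ‖opFun (g a) (normalOp (fderiv 𝕜 F z)) (ContinuousLinearMap.adjoint (fderiv 𝕜 F z)
      (F x - F z - fderiv 𝕜 F z (x - z)))‖ ≤ K₀ * ‖x - z‖ ^ 2 := by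
  obtain ⟨hK₀, R, hR⟩ := hR
  refine norm_map_taylor_le (𝕜 := 𝕜) (fun x hx z hz t ht => ball_segment hx hz ht)
    (fun x hx => hF.differentiableAt hx) (opFun (g a) (normalOp (fderiv 𝕜 F z)) ∘L
      ContinuousLinearMap.adjoint (fderiv 𝕜 F z)) hx hz fun t ht => ?_
  set w := z + (t : 𝕜) • (x - z) with hw
  have hwb : w ∈ Metric.ball xd ρ := ball_segment hx hz ht
  obtain ⟨h1, h2⟩ := hR w hwb z hz
  have e : (fderiv 𝕜 F w - fderiv 𝕜 F z) (x - z)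
      = fderiv 𝕜 F z (-((ContinuousLinearMap.id 𝕜 X - R w z) (x - z))) := by
    rw [h1]
    simp only [sub_apply, ContinuousLinearMap.comp_apply, ContinuousLinearMap.id_apply, map_neg,
      map_sub]
    abel
  rw [e, ContinuousLinearMap.comp_apply]
  refine (hg.norm_normalOp_apply_le (hF.norm_sq_le hz) ha _).trans ?_
  rw [norm_neg, pow_two, ← mul_assoc]
  exact ContinuousLinearMap.le_of_opNorm_le _
    (h2.trans (mul_le_mul_of_nonneg_left (norm_segment_sub_le x z ht) hK₀.le)) _

/-- One step of the iteration, compared with the linear method, under the structure conditions. -/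
lemma structured_step (hg : IsFilterFamily g c₀ c₁ c₂ c₃ c₄)
    (hS : StructuredCommutatorBounds 𝕜 g F xd ρ K₀ K₁ K₂ c₇ c₈)
    (hF : IsScaledOperator 𝕜 F D xd ρ g (α 0) c₃ β₀) (hR : RangeInvariance 𝕜 F xd ρ K₀)
    (hV : DerivVariation 𝕜 F xd ρ K₁ K₂)
    (hy : ‖y - F xd‖ ≤ δ) {k : ℕ} (hαk : 0 < α k) {x x' : X}
    (hxk : newtonSeq 𝕜 F g α x₀ y k = x) (hxk' : newtonSeq 𝕜 F g α x₀ y (k + 1) = x')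
    (hx : x ∈ Metric.ball xd ρ) :
    ‖x' - xd - opFun (residual g (α k)) (normalOp (fderiv 𝕜 F xd)) (x₀ - xd)‖
      ≤ c₇ * K₀ * ‖x - xd‖ * ‖x₀ - xd‖ + K₀ * ‖x - xd‖ ^ 2 + c₄ * (√(α k))⁻¹ * δ ∧
    ‖fderiv 𝕜 F x (x - xd)‖ ≤ ‖fderiv 𝕜 F xd (x - xd)‖
      + (K₁ * ‖x - xd‖ * ‖fderiv 𝕜 F xd (x - xd)‖
        + K₂ * ‖fderiv 𝕜 F xd (x - xd)‖ * ‖x - xd‖) ∧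
    ‖fderiv 𝕜 F xd (x' - xd) - (y - F xd)‖
      ≤ (K₁ * ‖x - xd‖ * ‖fderiv 𝕜 F xd (x' - xd)‖
          + K₂ * ‖fderiv 𝕜 F xd (x - xd)‖ * ‖x' - xd‖)
        + (‖fderiv 𝕜 F xd (opFun (residual g (α k)) (normalOp (fderiv 𝕜 F xd)) (x₀ - xd))‖
          + (K₁ * ‖x - xd‖
            * ‖fderiv 𝕜 F xd (opFun (residual g (α k)) (normalOp (fderiv 𝕜 F xd)) (x₀ - xd))‖
            + K₂ * ‖fderiv 𝕜 F xd (x - xd)‖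
              * ‖opFun (residual g (α k)) (normalOp (fderiv 𝕜 F xd)) (x₀ - xd)‖))
        + (c₈ * (K₀ + K₁) * √(α k) * ‖x - xd‖
          + c₈ * K₂ * (‖fderiv 𝕜 F x (x - xd)‖ + ‖fderiv 𝕜 F xd (x - xd)‖)) * ‖x₀ - xd‖
        + (K₁ + K₂) * ‖x - xd‖ * ‖fderiv 𝕜 F x (x - xd)‖ + δ := by
  have hxd : xd ∈ Metric.ball xd ρ := Metric.mem_ball_self (dist_nonneg.trans_lt hx)
  have hG := hF.norm_sq_le hx
  have hc₄ := hg.c₄_nonneg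
  have hstep := newtonSeq_succ_sub (xd := xd) hg y k hαk hxk hG
  rw [hxk'] at hstep
  have hVx := hV.2.2 x hx xd hxd
  have hw₁ := norm_adjoint_taylor_le hg hF hR hαk hxd hx
  have hsn := norm_taylor_le_of_variation hF hV hxd hx
  have hD1 := hS.residual_sub (α k) hαk x hx xd hxd
  have hD2 := hS.comp_residual_sub (α k) hαk x hx xd hxd
  set G := fderiv 𝕜 F x
  set T := fderiv 𝕜 F xd
  set s := F x - F xd - G (x - xd) with hs
  have hse : F xd - F x - G (xd - x) = -s := by
    rw [hs, ← neg_sub x xd, map_neg]; abel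
  rw [hse, map_neg, map_neg, norm_neg, norm_sub_rev xd x] at hw₁
  rw [hse, norm_neg, ← neg_sub x xd, map_neg, norm_neg, norm_neg] at hsn
  set n := y - F xd with hn
  set d := opFun (residual g (α k)) (normalOp G) (x₀ - xd)
    - opFun (residual g (α k)) (normalOp T) (x₀ - xd) with hd
  set w₁ := opFun (g (α k)) (normalOp G) (ContinuousLinearMap.adjoint G s)
  set w₂ := opFun (g (α k)) (normalOp G) (ContinuousLinearMap.adjoint G n)
  set z := opFun (residual g (α k)) (normalOp T) (x₀ - xd)
  have hw₂ : ‖w₂‖ ≤ c₄ * (√(α k))⁻¹ * δ :=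
    (hg.norm_adjoint_apply_le hG hαk n).trans (by gcongr)
  have hGw₁ := (hg.norm_comp_adjoint_apply_le hG hαk s).trans hsn
  have hGw₂ : ‖n - G w₂‖ ≤ δ := (hg.norm_sub_comp_adjoint_apply_le hG hαk n).trans hy
  have hdn : ‖d‖ ≤ c₇ * K₀ * ‖x - xd‖ * ‖x₀ - xd‖ :=
    ContinuousLinearMap.le_of_opNorm_le _ hD1 (x₀ - xd)
  have hGd := ContinuousLinearMap.le_of_opNorm_le _ hD2 (x₀ - xd)
  change ‖G d‖ ≤ _ at hGd
  have hGle : ∀ v : X, ‖G v‖ ≤ ‖T v‖ + (K₁ * ‖x - xd‖ * ‖T v‖ + K₂ * ‖T (x - xd)‖ * ‖v‖) := by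
    intro v
    have e : G v = T v + (G - T) v := by simp
    rw [e]
    exact (norm_add_le _ _).trans (add_le_add le_rfl (hVx v))
  refine ⟨?_, hGle _, ?_⟩
  · have e : x' - xd - z = d - w₁ + w₂ := by rw [hstep, hd]; abel
    rw [e]
    calc ‖d - w₁ + w₂‖ ≤ ‖d‖ + ‖w₁‖ + ‖w₂‖ :=
          (norm_add_le _ _).trans (add_le_add_left (norm_sub_le _ _) _)
      _ ≤ _ := by gcongr
  · have e0 : x' - xd = z + d - w₁ + w₂ := by rw [hstep, hd]; abel
    -- G(x' − xd) is computed first, since the filter bounds involve G. Subtracting the noise leaves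
    -- n − G w₂, with norm at most δ.
    have e : T (x' - xd) - n = -((G - T) (x' - xd)) + G z + G d - G w₁ - (n - G w₂) := by
      have : G (x' - xd) = G z + G d - G w₁ + G w₂ := by
        conv_lhs => rw [e0]
        simp only [map_add, map_sub]
      rw [sub_apply, this]
      abel
    rw [e]
    refine (norm_sub_le _ _).trans (add_le_add ?_ hGw₂)
    refine (norm_sub_le _ _).trans (add_le_add ?_ hGw₁)
    refine (norm_add_le _ _).trans (add_le_add ?_ hGd)
    refine (norm_add_le _ _).trans (add_le_add ?_ (hGle z))
    rw [norm_neg]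
    exact hVx _

end StructuredStep

/-! ### The structured case: constants, induction, stopping and rate -/

section StructuredCase

variable {𝕜 X Y : Type*} [RCLike 𝕜]
  [NormedAddCommGroup X] [InnerProductSpace 𝕜 X] [CompleteSpace X]
  [NormedAddCommGroup Y] [InnerProductSpace 𝕜 Y] [CompleteSpace Y]
  {F : X → Y} {D : Set X} {xd x₀ : X} {ρ r τ : ℝ} {g : ℝ → ℝ → ℝ} {α : ℕ → ℝ}
  {c₀ c₁ c₂ c₃ c₄ c₅ c₇ c₈ β₀ K₀ K₁ K₂ δ η γ C C₁ Ct K : ℝ} {y : Y}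

/-- Smallness of `η` under the structure conditions. -/
structure StructuredConstants (r τ c₃ c₄ c₅ c₇ c₈ γ C C₁ Ct K η : ℝ) : Prop where
  C_eq : C = 2 * c₅ + 2 * c₄ + 2
  C₁_eq : C₁ = 2 * (1 + c₄ * γ)
  Ct_eq : Ct = 2 * (√r * c₅) + 10
  K_eq : K = C₁ + 2 * C₁ * (5 + 4 * Ct) + (5 * C₁ + 1 + 3 * c₈) * (4 * Ct) + c₈ * C
  η_pos : 0 < η
  hC₁ : η * (2 * C₁) ≤ 1
  hε : 4 * C * (η * (c₇ + C₁)) ≤ 1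
  hεt : η * (2 * (5 * C₁ + 1 + 3 * c₈)) ≤ 1
  hεtr : η * (2 * (5 * C₁ + 1 + 3 * c₈)) * (√r * c₅) ≤ 1 / 2
  hC : η * (2 * c₈ * C) ≤ 1
  hK : η * (2 * K) ≤ τ - 1
  hKγ : η * (K * (c₃ + 1 + γ) * √r) ≤ (τ - 1) * γ - c₃ * √r

/-- The strict lower bound on γ leaves room (τ − 1)γ − c₃√r > 0 for the nonlinear part of the
residual. -/
lemma exists_structuredConstants (hτ : 1 < τ) (hγ : c₃ * √r / (τ - 1) < γ) :
    ∃ C C₁ Ct K η, StructuredConstants r τ c₃ c₄ c₅ c₇ c₈ γ C C₁ Ct K η := by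
  set C := 2 * c₅ + 2 * c₄ + 2 with hC
  set C₁ := 2 * (1 + c₄ * γ) with hC₁
  set Ct := 2 * (√r * c₅) + 10 with hCt
  set K := C₁ + 2 * C₁ * (5 + 4 * Ct) + (5 * C₁ + 1 + 3 * c₈) * (4 * Ct) + c₈ * C with hK
  have hτ1 : 0 < τ - 1 := by linarith
  have hγ1 : 0 < (τ - 1) * γ - c₃ * √r := by
    rw [div_lt_iff₀ hτ1] at hγ
    linarith
  have hpos : ∀ᶠ η in 𝓝[>] (0 : ℝ), 0 < η := self_mem_nhdsWithin
  obtain ⟨η, h1, h2, h3, h4, h5, h6, h7, h8⟩ := (hpos.and <|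
    (eventually_mul_le (2 * C₁) one_pos).and <|
    (eventually_mul_le (4 * C * (c₇ + C₁)) one_pos).and <|
    (eventually_mul_le (2 * (5 * C₁ + 1 + 3 * c₈)) one_pos).and <|
    (eventually_mul_le (2 * (5 * C₁ + 1 + 3 * c₈) * (√r * c₅)) (half_pos one_pos)).and <|
    (eventually_mul_le (2 * c₈ * C) one_pos).and <|
    (eventually_mul_le (2 * K) hτ1).and
    (eventually_mul_le (K * (c₃ + 1 + γ) * √r) hγ1)).exists
  exact ⟨C, C₁, Ct, K, η, hC, hC₁, hCt, hK, h1, h2, by linarith, h4, by linarith, h6, h7, h8⟩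

/-- The a priori bounds that propagate along the iteration under the structure conditions. -/
structure StructuredBounds (g : ℝ → ℝ → ℝ) (α : ℕ → ℝ) (T : X →L[𝕜] Y) (e₀ : X) (C C₁ Ct δ : ℝ)
    (e : ℕ → X) (k : ℕ) : Prop where
  le_mul : ‖e k‖ ≤ C₁ * ‖e₀‖
  le_linearError : ‖e k‖ ≤ C * (linearError g α T e₀ k + δ / √(α k))
  map_le : ‖T (e k)‖ ≤ Ct * (4 * linearResidual g α T e₀ k + δ)

set_option maxHeartbeats 400000 in
-- The induction step. A separate bound on ‖T e_k‖ is carried along because the K₂-terms involve it.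
-- While δ < γ√α_k‖x₀ − xd‖, the propagated noise is at most γ‖x₀ − xd‖.
lemma structured_estimates (hg : IsFilterFamily g c₀ c₁ c₂ c₃ c₄) (hα : IsParameterSequence α r)
    (hr : 1 < r) (hc₅ : ResidualRatioBound g α c₅)
    (hS : StructuredCommutatorBounds 𝕜 g F xd ρ K₀ K₁ K₂ c₇ c₈)
    (hF : IsScaledOperator 𝕜 F D xd ρ g (α 0) c₃ β₀) (hR : RangeInvariance 𝕜 F xd ρ K₀)
    (hV : DerivVariation 𝕜 F xd ρ K₁ K₂) (hγ : 0 < γ)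
    (hρ : 2 * (1 + c₄ * γ) * ‖x₀ - xd‖ < ρ)
    (hK : StructuredConstants r τ c₃ c₄ c₅ c₇ c₈ γ C C₁ Ct K η)
    (hKe : (K₀ + K₁ + K₂) * ‖x₀ - xd‖ ≤ η) (hδ : 0 < δ) (hy : ‖y - F xd‖ ≤ δ) {k : ℕ}
    (hP : StructuredBounds g α (fderiv 𝕜 F xd) (x₀ - xd) C C₁ Ct δ
      (fun j => newtonSeq 𝕜 F g α x₀ y j - xd) k) (hk : δ < γ * (√(α k) * ‖x₀ - xd‖)) :
    StructuredBounds g α (fderiv 𝕜 F xd) (x₀ - xd) C C₁ Ct δ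
      (fun j => newtonSeq 𝕜 F g α x₀ y j - xd) (k + 1) ∧
    ‖newtonSeq 𝕜 F g α x₀ y (k + 1) - xd
        - opFun (residual g (α k)) (normalOp (fderiv 𝕜 F xd)) (x₀ - xd)‖
      ≤ η * (c₇ + C₁) * ‖newtonSeq 𝕜 F g α x₀ y k - xd‖ + c₄ * (δ / √(α k)) ∧
    ‖F (newtonSeq 𝕜 F g α x₀ y (k + 1)) - y‖
      ≤ ‖fderiv 𝕜 F xd (opFun (residual g (α k)) (normalOp (fderiv 𝕜 F xd)) (x₀ - xd))‖ + δ
        + η * K * (linearResidual g α (fderiv 𝕜 F xd) (x₀ - xd) k + δ) := by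
  have hc₄ := hg.c₄_nonneg
  have hρ0 : 0 < ρ := (by positivity : 0 ≤ 2 * (1 + c₄ * γ) * ‖x₀ - xd‖).trans_lt hρ
  have hball : ∀ {x : X}, ‖x - xd‖ ≤ C₁ * ‖x₀ - xd‖ → x ∈ Metric.ball xd ρ := fun {x} hx => by
    rw [mem_ball_iff_norm]
    rw [hK.C₁_eq] at hx
    exact hx.trans_lt hρ
  have hxd : xd ∈ Metric.ball xd ρ := Metric.mem_ball_self hρ0
  have hT := hF.norm_sq_le hxd
  obtain ⟨hP1, hP2, hP3⟩ := hP
  have h51 := hc₅.1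
  have hc₇ := hS.c₇_pos
  have hc₈ := hS.c₈_pos
  have hK₀ := hR.1
  have hK₁ := hV.1
  have hK₂ := hV.2.1
  have hη := hK.η_pos
  have hs := hα.sqrt_pos k
  have hC₁ : 2 ≤ C₁ := by
    rw [hK.C₁_eq]
    have : 0 ≤ c₄ * γ := by positivity
    linarith
  have hC2 : 2 ≤ C := by rw [hK.C_eq]; linarith
  have hCt0 : 0 ≤ Ct := by rw [hK.Ct_eq]; positivity
  obtain ⟨S1, S2, S3⟩ := structured_step hg hS hF hR hV hy (hα.pos k) rfl rfl (hball hP1)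
  have S4 := fun h => norm_taylor_le_of_variation (x := newtonSeq 𝕜 F g α x₀ y (k + 1))
    hF hV h hxd
  change ‖newtonSeq 𝕜 F g α x₀ y k - xd‖ ≤ _ at hP1 hP2
  change ‖fderiv 𝕜 F xd (newtonSeq 𝕜 F g α x₀ y k - xd)‖ ≤ _ at hP3
  set E := ‖newtonSeq 𝕜 F g α x₀ y k - xd‖ with hE
  set x' := newtonSeq 𝕜 F g α x₀ y (k + 1)
  set e' := x' - xd with he'
  set s := √(α k)
  set T := fderiv 𝕜 F xd
  set z := opFun (residual g (α k)) (normalOp T) (x₀ - xd) with hz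
  set e₀ := ‖x₀ - xd‖ with he₀
  have hE0 : 0 ≤ E := norm_nonneg _
  have he₀0 : 0 ≤ e₀ := norm_nonneg _
  have A1 : ‖e' - z‖ ≤ η * (c₇ + C₁) * E + c₄ * (δ / s) := by
    have h1 : K₀ * e₀ ≤ η := by
      have : 0 ≤ K₁ * e₀ := by positivity
      have : 0 ≤ K₂ * e₀ := by positivity
      linarith
    have h2 : c₇ * K₀ * E * e₀ ≤ c₇ * η * E := by
      calc c₇ * K₀ * E * e₀ = c₇ * (K₀ * e₀) * E := by ring
        _ ≤ _ := by gcongr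
    have h3 : K₀ * E ^ 2 ≤ C₁ * η * E := by
      calc K₀ * E ^ 2 = K₀ * E * E := by ring
        _ ≤ K₀ * (C₁ * e₀) * E := by gcongr
        _ = C₁ * (K₀ * e₀) * E := by ring
        _ ≤ _ := by gcongr
    have h4 : c₄ * s⁻¹ * δ = c₄ * (δ / s) := by rw [div_eq_mul_inv]; ring
    linarith
  set ε := η * (c₇ + C₁) with hε
  have hε0 : 0 ≤ ε := by positivity
  have hCε : 4 * C * ε ≤ 1 := hK.hε
  have hε4 : ε ≤ 1 / 8 := by
    have : 4 * 2 * ε ≤ 4 * C * ε := by gcongr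
    linarith
  have hE' : ‖e'‖ ≤ ‖z‖ + (ε * E + c₄ * (δ / s)) := by
    have := norm_sub_norm_le e' z
    linarith
  have hds : δ / s ≤ γ * e₀ := by
    rw [div_le_iff₀ hs]
    linarith
  have hz2 : ‖z‖ ≤ e₀ := hg.norm_residual_apply_le hT (hα.pos k) _
  have hP1' : ‖e'‖ ≤ C₁ * e₀ := by
    have h1 : c₄ * (δ / s) ≤ c₄ * (γ * e₀) := by gcongr
    have h2 : ε * E ≤ 1 / 8 * (C₁ * e₀) := by gcongr
    have h3 : C₁ * e₀ = 2 * e₀ + 2 * (c₄ * (γ * e₀)) := by rw [hK.C₁_eq]; ring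
    have h4 : 0 ≤ c₄ * (γ * e₀) := by positivity
    linarith
  have hφ := linearError_le_mul_succ hg hα hc₅ hT (x₀ - xd) k
  have hψ := linearResidual_le_mul_succ hg hα hr hc₅ hT (x₀ - xd) k
  have hP2' : ‖e'‖ ≤ C * (linearError g α T (x₀ - xd) (k + 1) + δ / √(α (k + 1))) := by
    have hC := hK.C_eq
    refine error_bound_step (c := c₄) (c₅ := c₅) (ε := ε) (linearError_nonneg _ _)
      (by positivity : 0 ≤ δ / s) h51.le hε0 ?_ (by linarith) (by linarith) hP2
      (by change ‖e'‖ ≤ ‖z‖ + _ + _; linarith) hφ (hα.div_sqrt_mono hδ.le (Nat.le_succ k))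
    have h2 : ε * (2 * c₅) ≤ ε * C := by gcongr; linarith
    linarith
  set ψ := linearResidual g α T (x₀ - xd) k with hψd
  have hψ0 : 0 ≤ ψ := linearResidual_nonneg _ _
  have hsφ : s * linearError g α T (x₀ - xd) k ≤ ψ := sqrt_mul_linearError_le _ _
  have hsd : s * (δ / s) = δ := by field_simp
  have hsE : s * E ≤ C * (ψ + δ) := by
    calc s * E ≤ s * (C * (linearError g α T (x₀ - xd) k + δ / s)) := by gcongr
      _ = C * (s * linearError g α T (x₀ - xd) k + s * (δ / s)) := by ring
      _ ≤ _ := by rw [hsd]; gcongr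
  have htM : ‖T e'‖ ≤ ‖T e' - (y - F xd)‖ + δ := by
    have := norm_sub_norm_le (T e') (y - F xd)
    linarith
  have hRes : ‖F x' - y‖ ≤ ‖T e' - (y - F xd)‖ + (K₁ + K₂) * ‖e'‖ * ‖T e'‖ := by
    have e : F x' - y = (T e' - (y - F xd)) + (F x' - F xd - T e') := by abel
    rw [e]
    exact (norm_add_le _ _).trans (add_le_add le_rfl (S4 (hball hP1')))
  obtain ⟨B1, B2⟩ := structured_second_estimate hs hE0 (norm_nonneg e') (norm_nonneg _)
    (norm_nonneg _) (norm_nonneg _) he₀0 hK₀.le hK₁.le hK₂.le hc₈.le (by linarith) hη.le hδ.le hψ0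
    hKe hP1 hP1' hz2 (norm_comp_le_linearResidual _ _) hK.hC₁ hK.hεt hK.hC hsE hP3 hCt0 S2 S3 htM
    hRes
  refine ⟨⟨hP1', hP2', ?_⟩, A1, ?_⟩
  · have hr1 : 1 ≤ √r := Real.one_le_sqrt.2 hr.le
    -- The same scalar recursion, now for ‖T e_k‖ with φ = 4ψ, constant d = δ and ratio √r c₅.
    refine error_bound_step (c := 5) (c₅ := √r * c₅)
      (ε := η * (2 * (5 * C₁ + 1 + 3 * c₈))) (φ := 4 * ψ) (by positivity) hδ.le
      (one_le_mul_of_one_le_of_one_le hr1 h51.le) (by positivity) hK.hεtr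
      (by rw [hK.Ct_eq]; linarith) ?_ hP3 B1 (by linarith) le_rfl
    rw [hK.Ct_eq]
    have : 0 ≤ √r * c₅ := by positivity
    linarith
  · rw [hK.K_eq]
    exact B2

/-- Without a source condition the linear residual is only bounded by c₃√α_k‖x₀ − xd‖, so the
weights are √α_k‖x₀ − xd‖ and the ratio is √r. -/
lemma structured_stopping (hg : IsFilterFamily g c₀ c₁ c₂ c₃ c₄) (hα : IsParameterSequence α r)
    (hr : 1 < r) (hτ : 1 < τ) (hc₅ : ResidualRatioBound g α c₅)
    (hS : StructuredCommutatorBounds 𝕜 g F xd ρ K₀ K₁ K₂ c₇ c₈)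
    (hF : IsScaledOperator 𝕜 F D xd ρ g (α 0) c₃ β₀) (hR : RangeInvariance 𝕜 F xd ρ K₀)
    (hV : DerivVariation 𝕜 F xd ρ K₁ K₂) (hγ : 0 < γ)
    (hρ : 2 * (1 + c₄ * γ) * ‖x₀ - xd‖ < ρ)
    (hK : StructuredConstants r τ c₃ c₄ c₅ c₇ c₈ γ C C₁ Ct K η)
    (hKe : (K₀ + K₁ + K₂) * ‖x₀ - xd‖ ≤ η) (hδ : 0 < δ) (hy : ‖y - F xd‖ ≤ δ)
    (hsmall : δ < γ * (√(α 0) * ‖x₀ - xd‖)) :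
    ∃ k, IsStoppingIndex F (newtonSeq 𝕜 F g α x₀ y) y τ δ k ∧
      (∀ j ≤ k, StructuredBounds g α (fderiv 𝕜 F xd) (x₀ - xd) C C₁ Ct δ
        (fun j => newtonSeq 𝕜 F g α x₀ y j - xd) j) ∧
      ∀ j < k, δ < γ * (√(α j) * ‖x₀ - xd‖) := by
  have hc₃ := hg.c₃_pos
  have hc₄ := hg.c₄_nonneg
  have hρ0 : 0 < ρ := (by positivity : 0 ≤ 2 * (1 + c₄ * γ) * ‖x₀ - xd‖).trans_lt hρ
  have hxd : xd ∈ Metric.ball xd ρ := Metric.mem_ball_self hρ0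
  have hT := hF.norm_sq_le hxd
  have h51 := hc₅.1
  have hc₈ := hS.c₈_pos
  have hη := hK.η_pos
  have hC₁ : 2 ≤ C₁ := by
    rw [hK.C₁_eq]
    have : 0 ≤ c₄ * γ := by positivity
    linarith
  have hC2 : 4 / 3 ≤ C := by rw [hK.C_eq]; linarith
  have hCt : 10 ≤ Ct := by
    rw [hK.Ct_eq]
    have : 0 ≤ √r * c₅ := by positivity
    linarith
  have hK0 : 0 ≤ K := by rw [hK.K_eq]; positivity
  have hest := fun {k : ℕ} => structured_estimates (k := k) hg hα hr hc₅ hS hF hR hV hγ hρ hK hKe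
    hδ hy
  have hbase : StructuredBounds g α (fderiv 𝕜 F xd) (x₀ - xd) C C₁ Ct δ
      (fun j => newtonSeq 𝕜 F g α x₀ y j - xd) 0 := by
    refine ⟨le_mul_of_one_le_left (norm_nonneg _) (by linarith), ?_, ?_⟩
    · change ‖x₀ - xd‖ ≤ _
      have h5 := hg.norm_le_mul_residual hF.β₀_le (hF.norm_sq_le_β₀ hxd) (hα.pos 0) hF.residual_ge
        (x₀ - xd)
      change _ ≤ 4 / 3 * linearError g α (fderiv 𝕜 F xd) (x₀ - xd) 0 at h5
      have h6 : 0 ≤ linearError g α (fderiv 𝕜 F xd) (x₀ - xd) 0 := linearError_nonneg _ _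
      have h8 : 0 ≤ δ / √(α 0) := by positivity
      calc _ ≤ 4 / 3 * (linearError g α (fderiv 𝕜 F xd) (x₀ - xd) 0 + δ / √(α 0)) := by linarith
        _ ≤ _ := by gcongr
    · change ‖fderiv 𝕜 F xd (x₀ - xd)‖ ≤ _
      have h5 := hg.norm_comp_le_mul_residual hF.β₀_le (hF.norm_sq_le_β₀ hxd) (hα.pos 0)
        hF.residual_ge (x₀ - xd)
      have h6 : ‖fderiv 𝕜 F xd (opFun (residual g (α 0)) (normalOp (fderiv 𝕜 F xd)) (x₀ - xd))‖
        ≤ linearResidual g α (fderiv 𝕜 F xd) (x₀ - xd) 0 := norm_comp_le_linearResidual _ _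
      have h7 : 0 ≤ linearResidual g α (fderiv 𝕜 F xd) (x₀ - xd) 0 := linearResidual_nonneg _ _
      calc _ ≤ 1 * (4 * linearResidual g α (fderiv 𝕜 F xd) (x₀ - xd) 0 + δ) := by linarith
        _ ≤ _ := by gcongr; linarith
  set a := c₃ + η * (K * (c₃ + 1 + γ)) with ha
  have hres : ∀ k, StructuredBounds g α (fderiv 𝕜 F xd) (x₀ - xd) C C₁ Ct δ
        (fun j => newtonSeq 𝕜 F g α x₀ y j - xd) k →
      StructuredBounds g α (fderiv 𝕜 F xd) (x₀ - xd) C C₁ Ct δ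
        (fun j => newtonSeq 𝕜 F g α x₀ y j - xd) (k + 1) →
      δ < γ * (√(α k) * ‖x₀ - xd‖) →
      ‖F (newtonSeq 𝕜 F g α x₀ y (k + 1)) - y‖ ≤ δ + a * (√(α k) * ‖x₀ - xd‖) := by
    intro k hP _ hk
    have h5 := (hest hP hk).2.2
    have h6 := hg.norm_comp_residual_apply_le hT (hα.pos k) (x₀ - xd)
    have h7 : √(α k) * linearError g α (fderiv 𝕜 F xd) (x₀ - xd) k ≤ √(α k) * ‖x₀ - xd‖ :=
      mul_le_mul_of_nonneg_left (hg.norm_residual_apply_le hT (hα.pos k) _) (Real.sqrt_nonneg _)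
    have h9 : linearResidual g α (fderiv 𝕜 F xd) (x₀ - xd) k + δ
        ≤ (c₃ + 1 + γ) * (√(α k) * ‖x₀ - xd‖) := by
      rw [linearResidual]; linarith
    have h10 : η * K * (linearResidual g α (fderiv 𝕜 F xd) (x₀ - xd) k + δ)
        ≤ η * K * ((c₃ + 1 + γ) * (√(α k) * ‖x₀ - xd‖)) := by gcongr
    rw [ha]
    linarith
  have hw : Tendsto (fun k => √(α k) * ‖x₀ - xd‖) atTop (𝓝 0) := by
    simpa using (hα.tendsto_zero.sqrt).mul_const ‖x₀ - xd‖
  obtain ⟨k, h1, h2, h3, h4⟩ := exists_stopping (ρ := fun k => ‖F (newtonSeq 𝕜 F g α x₀ y k) - y‖)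
    (P := StructuredBounds g α (fderiv 𝕜 F xd) (x₀ - xd) C C₁ Ct δ
      (fun j => newtonSeq 𝕜 F g α x₀ y j - xd)) (w := fun k => √(α k) * ‖x₀ - xd‖) (a := a)
    (r := √r) (τ := τ) (γ := γ)
    hδ (by positivity) (fun k => by positivity) hw
    (fun k => by
      have := mul_le_mul_of_nonneg_right (hα.sqrt_le_mul (by linarith) k) (norm_nonneg (x₀ - xd))
      linarith)
    hsmall hbase (fun k hP hk => (hest hP hk).1) hres (by rw [ha]; linarith [hK.hKγ]) hτ
  exact ⟨k, ⟨h1, h2⟩, h3, h4⟩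

/-- The Taylor remainder at the stopping index is at most half of ‖T e‖, so ‖T e‖ ≤ 2(1 + τ)δ with
no condition on m: one may take c = κ = 0, and every ν ≥ 0 is admitted. -/
theorem structured_convergence (hg : IsFilterFamily g c₀ c₁ c₂ c₃ c₄)
    (hα : IsParameterSequence α r) (hr : 1 < r) (hτ : 1 < τ) (hc₅ : ResidualRatioBound g α c₅)
    (hS : StructuredCommutatorBounds 𝕜 g F xd ρ K₀ K₁ K₂ c₇ c₈)
    {q : ℝ≥0∞} (hq : IsQualification g q)
    (hF : IsScaledOperator 𝕜 F D xd ρ g (α 0) c₃ β₀) (hR : RangeInvariance 𝕜 F xd ρ K₀)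
    (hV : DerivVariation 𝕜 F xd ρ K₁ K₂) (hγ : 0 < γ)
    (hρ : 2 * (1 + c₄ * γ) * ‖x₀ - xd‖ < ρ)
    (hK : StructuredConstants r τ c₃ c₄ c₅ c₇ c₈ γ C C₁ Ct K η)
    (hKe : (K₀ + K₁ + K₂) * ‖x₀ - xd‖ ≤ η)
    {yd : ℝ → Y} (hyd : ∀ δ : ℝ, 0 < δ → ‖yd δ - F xd‖ ≤ δ) :
    EventuallyWellDefined 𝕜 F g α x₀ xd ρ τ yd ∧
      ∀ kd : ℝ → ℕ,
        (∀ᶠ δ in 𝓝[>] (0 : ℝ),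
          IsStoppingIndex F (newtonSeq 𝕜 F g α x₀ (yd δ)) (yd δ) τ δ (kd δ)) →
        ∀ (ν : ℝ) (ω : X), 0 ≤ ν → ENNReal.ofReal (ν + 1 / 2) < q →
          ω ∈ (LinearMap.ker (fderiv 𝕜 F xd).toLinearMap)ᗮ →
          SourceCondition 𝕜 F xd x₀ ν ω →
          (fun δ : ℝ => newtonSeq 𝕜 F g α x₀ (yd δ) (kd δ) - xd)
            =o[𝓝[>] (0 : ℝ)] (fun δ : ℝ => δ ^ (2 * ν / (1 + 2 * ν))) := by
  have hc₃ := hg.c₃_pos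
  have hc₄ := hg.c₄_nonneg
  have hρ0 : 0 < ρ := (by positivity : 0 ≤ 2 * (1 + c₄ * γ) * ‖x₀ - xd‖).trans_lt hρ
  have hxd : xd ∈ Metric.ball xd ρ := Metric.mem_ball_self hρ0
  by_cases h0 : x₀ = xd
  · exact ⟨eventuallyWellDefined_of_eq hτ hρ0 h0 hyd,
      fun kd hkd _ _ _ _ _ _ => isLittleO_of_eq hτ h0 hyd hkd _⟩
  have hT := hF.norm_sq_le hxd
  have h51 := hc₅.1
  have hc₇ := hS.c₇_pos
  have hc₈ := hS.c₈_pos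
  have hη := hK.η_pos
  have hC₁ : 0 ≤ C₁ := by rw [hK.C₁_eq]; positivity
  have hC : 0 ≤ C := by rw [hK.C_eq]; positivity
  have hCt : 0 ≤ Ct := by rw [hK.Ct_eq]; positivity
  have hK0 : 0 ≤ K := by rw [hK.K_eq]; positivity
  have he0 : 0 < ‖x₀ - xd‖ := norm_pos_iff.2 (sub_ne_zero.2 h0)
  have hsmall : ∀ᶠ δ in 𝓝[>] (0 : ℝ), δ < γ * (√(α 0) * ‖x₀ - xd‖) :=
    (tendsto_id.mono_left nhdsWithin_le_nhds).eventually_lt_const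
      (mul_pos hγ (mul_pos (hα.sqrt_pos 0) he0))
  have hpos : ∀ᶠ δ in 𝓝[>] (0 : ℝ), 0 < δ := self_mem_nhdsWithin
  have hball : ∀ {x : X}, ‖x - xd‖ ≤ C₁ * ‖x₀ - xd‖ → x ∈ Metric.ball xd ρ := fun {x} hx => by
    rw [mem_ball_iff_norm]
    rw [hK.C₁_eq] at hx
    exact hx.trans_lt hρ
  refine ⟨?_, fun kd hkd ν ω hν hνq hω hs => ?_⟩
  · filter_upwards [hsmall, hpos] with δ h1 hδ
    obtain ⟨k, hk, hP, -⟩ := structured_stopping hg hα hr hτ hc₅ hS hF hR hV hγ hρ hK hKe hδ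
      (hyd δ hδ) h1
    exact ⟨k, hk, fun j hj => hball (hP j hj).le_mul⟩
  refine isLittleO_of_estimates hg hα hr hc₅ hq hT hν hνq hω hs
    (e := fun δ j => newtonSeq 𝕜 F g α x₀ (yd δ) j - xd)
    (ρ := fun δ j => ‖F (newtonSeq 𝕜 F g α x₀ (yd δ) j) - yd δ‖) (N := kd)
    (ε := η * (c₇ + C₁)) (ε' := η * K) (C := C) (C' := 1 + η * K) (Ct := 2 * (1 + τ))
    (c := 0) (κ := 0) hτ hC (by positivity) (by positivity) hK.hε
    (by linarith [hK.hK]) (by simp) (by linarith) (Or.inl rfl) (fun δ => rfl) ?_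
  filter_upwards [hsmall, hpos, hkd] with δ h1 hδ hkδ
  obtain ⟨k, hk, hP, hkγ⟩ := structured_stopping hg hα hr hτ hc₅ hS hF hR hV hγ hρ hK hKe hδ
    (hyd δ hδ) h1
  obtain rfl := hk.unique hkδ
  have hest := fun (j : ℕ) (hj : j < kd δ) => (structured_estimates hg hα hr hc₅ hS hF hR hV hγ hρ
    hK hKe hδ (hyd δ hδ) (hP j hj.le) (hkγ j hj)).2
  refine ⟨fun j hj => (hP j hj).le_linearError, fun j hj => (hest j hj).1, fun j hj => ?_,
    hkδ.2, fun m _ _ => ?_⟩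
  · refine (hest j hj).2.trans ?_
    have h3 : ‖fderiv 𝕜 F xd (opFun (residual g (α j)) (normalOp (fderiv 𝕜 F xd)) (x₀ - xd))‖
      ≤ linearResidual g α (fderiv 𝕜 F xd) (x₀ - xd) j := norm_comp_le_linearResidual _ _
    linarith
  · have hPN : ‖newtonSeq 𝕜 F g α x₀ (yd δ) (kd δ) - xd‖ ≤ C₁ * ‖x₀ - xd‖ :=
      (hP _ le_rfl).le_mul
    have h3 := norm_taylor_le_of_variation hF hV (hball hPN) hxd
    have h4 := hkδ.1
    have h5 := hyd δ hδ
    set x := newtonSeq 𝕜 F g α x₀ (yd δ) (kd δ)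
    have h6 : (K₁ + K₂) * ‖x - xd‖ ≤ 1 / 2 := by
      have hK₀ := hR.1
      have hK₁ := hV.1
      have hK₂ := hV.2.1
      calc (K₁ + K₂) * ‖x - xd‖ ≤ (K₀ + K₁ + K₂) * (C₁ * ‖x₀ - xd‖) := by
            gcongr; linarith
        _ = C₁ * ((K₀ + K₁ + K₂) * ‖x₀ - xd‖) := by ring
        _ ≤ C₁ * η := by gcongr
        _ ≤ _ := by linarith [hK.hC₁]
    have h7 : ‖fderiv 𝕜 F xd (x - xd)‖
        ≤ (1 + τ) * δ + 1 / 2 * ‖fderiv 𝕜 F xd (x - xd)‖ := by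
      have e : fderiv 𝕜 F xd (x - xd) = (F x - yd δ) + (yd δ - F xd)
          - (F x - F xd - fderiv 𝕜 F xd (x - xd)) := by abel
      calc ‖fderiv 𝕜 F xd (x - xd)‖ ≤ ‖F x - yd δ‖ + ‖yd δ - F xd‖
            + ‖F x - F xd - fderiv 𝕜 F xd (x - xd)‖ := by
            conv_lhs => rw [e]
            exact (norm_sub_le _ _).trans (add_le_add (norm_add_le _ _) le_rfl)
        _ ≤ _ := by
            have := mul_le_mul_of_nonneg_right h6 (norm_nonneg (fderiv 𝕜 F xd (x - xd)))
            linarith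
    change ‖fderiv 𝕜 F xd (x - xd)‖ ≤ _
    linarith

/-- With the convention 0^0 = 1 the function t^0 is constantly 1, so ω = x₀ − xd serves. -/
lemma sourceCondition_zero (hT : ‖fderiv 𝕜 F xd‖ ^ 2 ≤ 1 / 2) :
    SourceCondition 𝕜 F xd x₀ 0 (x₀ - xd) := by
  simp only [SourceCondition, Real.rpow_zero]
  rw [opFun_one (spectrumIn_normalOp hT) le_rfl, ContinuousLinearMap.id_apply]

end StructuredCase

end NewtonReg

/-! ### Assembly of the two cases -/

theorem theorem2p3 :
    -- (i)
    (∀ r τ c₀ c₁ c₂ c₃ c₄ c₅ c₆ : ℝ, 1 < r → 1 < τ →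
      ∃ η₀ : ℝ, 0 < η₀ ∧
      ∀ (𝕜 : Type w) [RCLike 𝕜]
        (X : Type u) [NormedAddCommGroup X] [InnerProductSpace 𝕜 X] [CompleteSpace X]
        (Y : Type v) [NormedAddCommGroup Y] [InnerProductSpace 𝕜 Y] [CompleteSpace Y]
        (g : ℝ → ℝ → ℝ) (α : ℕ → ℝ) (q : ℝ≥0∞)
        (F : X → Y) (D : Set X) (xd x₀ : X) (ρ β₀ L : ℝ),
        NewtonReg.IsFilterFamily g c₀ c₁ c₂ c₃ c₄ →
        NewtonReg.IsParameterSequence α r →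
        NewtonReg.ResidualRatioBound g α c₅ →
        NewtonReg.CommutatorBounds 𝕜 X Y g c₆ →
        NewtonReg.IsQualification g q →
        NewtonReg.IsScaledOperator 𝕜 F D xd ρ g (α 0) c₃ β₀ →
        NewtonReg.LipschitzDeriv 𝕜 F xd ρ L →
        4 * ‖x₀ - xd‖ < ρ →
        1 < q →
        ∀ (ν : ℝ) (ω : X), 1 / 2 ≤ ν → ENNReal.ofReal (ν + 1 / 2) < q →
        ω ∈ (LinearMap.ker (fderiv 𝕜 F xd).toLinearMap)ᗮ →
        NewtonReg.SourceCondition 𝕜 F xd x₀ ν ω →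
        ∀ u : Y, u ∈ (LinearMap.ker (ContinuousLinearMap.adjoint (fderiv 𝕜 F xd)).toLinearMap)ᗮ →
        x₀ - xd = ContinuousLinearMap.adjoint (fderiv 𝕜 F xd) u →
        L * ‖u‖ ≤ η₀ →
        ∀ yd : ℝ → Y, (∀ δ : ℝ, 0 < δ → ‖yd δ - F xd‖ ≤ δ) →
          NewtonReg.EventuallyWellDefined 𝕜 F g α x₀ xd ρ τ yd ∧
          ∀ kd : ℝ → ℕ,
            (∀ᶠ δ in 𝓝[>] (0 : ℝ), NewtonReg.IsStoppingIndex F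
              (NewtonReg.newtonSeq 𝕜 F g α x₀ (yd δ)) (yd δ) τ δ (kd δ)) →
            (fun δ : ℝ => NewtonReg.newtonSeq 𝕜 F g α x₀ (yd δ) (kd δ) - xd)
              =o[𝓝[>] (0 : ℝ)] (fun δ : ℝ => δ ^ (2 * ν / (1 + 2 * ν)))) ∧
    -- (ii), and the convergence without a rate
    (∀ r τ c₀ c₁ c₂ c₃ c₄ c₅ c₇ c₈ γ₁ : ℝ, 1 < r → 1 < τ → c₃ * √r / (τ - 1) < γ₁ →
      ∃ η₁ : ℝ, 0 < η₁ ∧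
      ∀ (𝕜 : Type w) [RCLike 𝕜]
        (X : Type u) [NormedAddCommGroup X] [InnerProductSpace 𝕜 X] [CompleteSpace X]
        (Y : Type v) [NormedAddCommGroup Y] [InnerProductSpace 𝕜 Y] [CompleteSpace Y]
        (g : ℝ → ℝ → ℝ) (α : ℕ → ℝ) (q : ℝ≥0∞)
        (F : X → Y) (D : Set X) (xd x₀ : X) (ρ β₀ K₀ K₁ K₂ : ℝ),
        NewtonReg.IsFilterFamily g c₀ c₁ c₂ c₃ c₄ →
        NewtonReg.IsParameterSequence α r →
        NewtonReg.ResidualRatioBound g α c₅ →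
        NewtonReg.StructuredCommutatorBounds 𝕜 g F xd ρ K₀ K₁ K₂ c₇ c₈ →
        NewtonReg.IsQualification g q →
        NewtonReg.IsScaledOperator 𝕜 F D xd ρ g (α 0) c₃ β₀ →
        NewtonReg.RangeInvariance 𝕜 F xd ρ K₀ →
        NewtonReg.DerivVariation 𝕜 F xd ρ K₁ K₂ →
        2 * (1 + c₄ * γ₁) * ‖x₀ - xd‖ < ρ →
        (K₀ + K₁ + K₂) * ‖x₀ - xd‖ ≤ η₁ →
        ∀ yd : ℝ → Y, (∀ δ : ℝ, 0 < δ → ‖yd δ - F xd‖ ≤ δ) →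
          NewtonReg.EventuallyWellDefined 𝕜 F g α x₀ xd ρ τ yd ∧
          ∀ kd : ℝ → ℕ,
            (∀ᶠ δ in 𝓝[>] (0 : ℝ), NewtonReg.IsStoppingIndex F
              (NewtonReg.newtonSeq 𝕜 F g α x₀ (yd δ)) (yd δ) τ δ (kd δ)) →
            (∀ (ν : ℝ) (ω : X), 0 ≤ ν → ENNReal.ofReal (ν + 1 / 2) < q →
              ω ∈ (LinearMap.ker (fderiv 𝕜 F xd).toLinearMap)ᗮ →
              NewtonReg.SourceCondition 𝕜 F xd x₀ ν ω →
              (fun δ : ℝ => NewtonReg.newtonSeq 𝕜 F g α x₀ (yd δ) (kd δ) - xd)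
                =o[𝓝[>] (0 : ℝ)] (fun δ : ℝ => δ ^ (2 * ν / (1 + 2 * ν)))) ∧
            (x₀ - xd ∈ (LinearMap.ker (fderiv 𝕜 F xd).toLinearMap)ᗮ →
              Tendsto (fun δ : ℝ => NewtonReg.newtonSeq 𝕜 F g α x₀ (yd δ) (kd δ))
                (𝓝[>] (0 : ℝ)) (𝓝 xd))) := by
  refine ⟨fun r τ c₀ c₁ c₂ c₃ c₄ c₅ c₆ hr hτ => ?_,
    fun r τ c₀ c₁ c₂ c₃ c₄ c₅ c₇ c₈ γ₁ hr hτ hγ => ?_⟩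
  · by_cases h₀ : 0 < c₀
    · obtain ⟨γ, C, C₁, K, η, hK⟩ := NewtonReg.exists_lipschitzConstants (c₀ := c₀) (c₃ := c₃)
        (c₄ := c₄) (c₅ := c₅) (c₆ := c₆) hr hτ h₀
      refine ⟨η, hK.η_pos, ?_⟩
      intro 𝕜 _ X _ _ _ Y _ _ _ g α q F D xd x₀ ρ β₀ L hg hα hc₅ hc₆ hq hF hL hρ _ ν ω hν hνq hω
        hs u _ hu hLu yd hyd
      refine NewtonReg.lipschitz_convergence (L := max L 0) hg hα hr hτ hc₅ hc₆ hq hF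
        -- L is not assumed nonnegative, so it is replaced by `max L 0`, which preserves the
        -- Lipschitz bound and the smallness of L‖u‖.
        (fun x hx z hz => (hL x hx z hz).trans
          (mul_le_mul_of_nonneg_right (le_max_left _ _) (norm_nonneg _)))
        (le_max_right _ _) hρ hK hν hνq hω hs hu ?_ hyd
      rw [max_mul_of_nonneg _ _ (norm_nonneg u), zero_mul]
      exact max_le hLu hK.η_pos.le
    · refine ⟨1, one_pos, ?_⟩
      intro 𝕜 _ X _ _ _ Y _ _ _ g α q F D xd x₀ ρ β₀ L hg
      exact absurd hg.c₀_pos h₀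
  · obtain ⟨C, C₁, Ct, K, η, hK⟩ := NewtonReg.exists_structuredConstants (c₄ := c₄) (c₅ := c₅)
      (c₇ := c₇) (c₈ := c₈) hτ hγ
    refine ⟨η, hK.η_pos, ?_⟩
    intro 𝕜 _ X _ _ _ Y _ _ _ g α q F D xd x₀ ρ β₀ K₀ K₁ K₂ hg hα hc₅ hS hq hF hR hV hρ hKe yd hyd
    have hc₃ := hg.c₃_pos
    have hc₄ := hg.c₄_nonneg
    have hγ0 : 0 < γ₁ := by
      have : 0 < τ - 1 := by linarith
      exact lt_of_le_of_lt (by positivity) hγ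
    have hρ0 : 0 < ρ := (by positivity : 0 ≤ 2 * (1 + c₄ * γ₁) * ‖x₀ - xd‖).trans_lt hρ
    obtain ⟨h1, h2⟩ := NewtonReg.structured_convergence hg hα hr hτ hc₅ hS hq hF hR hV hγ0 hρ hK hKe
      hyd
    refine ⟨h1, fun kd hkd => ⟨h2 kd hkd, fun hker => ?_⟩⟩
    have h3 : ENNReal.ofReal (0 + 1 / 2) < q := by
      refine lt_of_lt_of_le ?_ (hg.one_le_qualification hq)
      rw [ENNReal.ofReal_lt_one]
      norm_num
    -- At ν = 0 the rate is o(δ^0) = o(1), that is, convergence.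
    have h4 := h2 kd hkd 0 (x₀ - xd) le_rfl h3 hker
      (NewtonReg.sourceCondition_zero (hF.norm_sq_le (Metric.mem_ball_self hρ0)))
    simp only [mul_zero, zero_div, Real.rpow_zero] at h4
    exact tendsto_sub_nhds_zero_iff.1 ((isLittleO_one_iff ℝ).1 h4)
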